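/- **Setting.** Let $\Gamma,\Lambda$ be countable discrete groups, $\Gamma\curvearrowright^\sigma(X,\mu)$ and $\Lambda\curvearrowright^\theta(Y,\nu)$ essentially free measure preserving actions on standard probability spaces, with $\sigma$ weak mixing. Write $\mathcal R_\sigma$, $\mathcal R_\theta$ for the orbit equivalence relations. Let $Y_0\subset Y$ be measurable with $\nu(Y_0)>0$, let $\nu_{Y_0}$ be the normalized restriction of $\nu$, $\mathcal R_\theta^{Y_0}$ the restriction of $\mathcal R_\theta$ to $Y_0$, and $n=\nu(Y_0)^{-1}$. Let $\Delta:(X,\mu)\to(Y_0,\nu_{Y_0})$ be measure preserving and such that * either (local OE) $\theta$ is ergodic and, for a.e. $t\in X$, $\Delta$ is a bijection of the $\mathcal R_\sigma$-class of $t$ onto the $\mathcal R_\theta^{Y_0}$-class of $\Delta(t)$; * or (embedding) $\Delta$ is an isomorphism of probability spaces taking a.e. $\mathcal R_\sigma$-class into an $\mathcal R_\theta^{Y_0}$-class. Let $w(t,g)\in\Lambda$ be the Zimmer cocycle, i.e. the a.e. unique $h\in\Lambda$ with $\Delta(g^{-1}t)=h^{-1}\Delta(t)$. Let $\delta:\Gamma\to\Lambda$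 be a group morphism and $v:X\to\Lambda$ a measurable map with $v(t)^{-1}w(t,g)v(g^{-1}t)=\delta(g)$ for a.e. $t$, for every $g\in\Gamma$. Put $q_h=\chi_{\{v=h\}}$, $K=\ker\delta$, $\Lambda_0=\delta(\Gamma)$, $A=L^\infty X$, $B=L^\infty Y$, $M=A\rtimes\Gamma$, $P=B\rtimes\Lambda$, with canonical unitaries $u_g\in M$, $v_h\in P$. In the embedding case identify $X$ with $Y_0$, and so $A$ with $L^\infty(Y_0)$ and $M$ with a subalgebra of $\chi_{Y_0}P\chi_{Y_0}$, by means of $\Delta$; thus $u_g=\sum_h\chi_{\{t\,:\,w(t,g)=h\}}v_h\in P$. In the local OE case realize the amplification $\mathcal R_\sigma^n$ on a set $X^n$, $X=X\times\{0\}\subset X^n\subset X\times\mathbb Z$, of measure $n$, as the restriction to $X^n$ of the orbit relation of $\Gamma\times\mathbb Z\curvearrowright X\times\mathbb Z$, together with an extension of $\Delta$ to a local OE $\Delta^n:X^n\to Y$ of $\mathcal R_\sigma^n$ and $\mathcal R_\theta$. Let $A^n=L^\infty(X^n)$, and let $M^n$ be the corner at $\chi_{X^n}$ of $L^\infty(X\times\mathbb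 Z)\rtimes(\Gamma\times\mathbb Z)$. Let $\theta'$ be the pull back of $\theta$: $\theta'_h(z)$ is the point $z'$ in the $\mathcal R_\sigma^n$-class of $z$ with $\Delta^n(z')=\theta_h(\Delta^n(z))$. View $v_h$ in $M^n$ as the canonical unitary implementing $\theta'_h$, and $u_g$ as an element of $M=\chi_XM^n\chi_X$. Put $p=\chi_X$ (that is, $p=\chi_{Y_0}$ in the embedding case). **Claim.** In both cases the series $b=\sum_h q_hv_h$ converges strongly to a bounded operator in $P$ (embedding), resp. $M^n$ (local OE); $u_gb=bv_{\delta(g)}$ for all $g\in\Gamma$; $b$ is a scalar multiple of a partial isometry; and $K$ is a finite normal subgroup of $\Gamma$. Moreover: (i) Let $\Delta$ be a local OE. Then $(X^n,\Delta^n)$ as above exists, and for every such choice: $bb^*=\sum_{k\in K}u_k$, and $b^*b=|K|q$ where $q=\chi_W$ for a measurable $W\subset X^n$, with $q$ invariant under $\theta'_h$, $h\in\Lambda_0$; $\Lambda_0$ has finite index $[\Lambda:\Lambda_0]=n|K|$; and $\alpha=|K|^{-1}\mathrm{Ad}(b^*)$ is a $*$-isomorphism of the fixed point algebra $A^K$ onto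 $A^nq$ that conjugates the action of $\Gamma/K$ given by $\sigma$ with the action of $\Lambda_0$ given by $\theta'$, with respect to the isomorphism $\Gamma/K\simeq\Lambda_0$ induced by $\delta$. If $\Gamma$ has no non-trivial finite normal subgroup, then $\delta$ is injective, $n=[\Lambda:\Lambda_0]$ is an integer, $b^*b=q$, $bb^*=p$, and $\mathrm{Ad}(b^*)$ is a $*$-isomorphism of $A$ onto $A^nq$ that conjugates $\sigma$ with $\theta'_{|\Lambda_0}$. It is implemented by an element of the full group of $\mathcal R_\sigma^n$: there is $\varphi\in[\mathcal R_\sigma^n]$ with $\varphi(X)=W$ a.e., $b^*(\chi_X\cdot(a\circ\varphi))b=\chi_Wa$ for every bounded measurable $a$, and $\varphi(\sigma_g t)=\theta'_{\delta(g)}(\varphi(t))$ for all $g\in\Gamma$ and a.e. $t\in X$. (ii) Let $\Delta$ be an embedding. There are a finite $\sigma(\Gamma)$-invariant measurable subequivalence relation $\mathcal K\subset\mathcal R_\theta^{Y_0}$ containing $\mathcal R_{\sigma(K)}$, an integer $m\ge1$ such that a.e. class of $\mathcal K$ has $m$ elements, and a projection $q=\chi_W\in B$, invariant under $\theta_h$,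 $h\in\Lambda_0$, such that $b^*b=mq$ and $\alpha=m^{-1}\mathrm{Ad}(b^*)$ is a $*$-isomorphism of $A^{\mathcal K}$ (the functions in $A$ constant on $\mathcal K$-classes) onto $Bq$ that conjugates the $\Gamma/K$-action given by $\sigma$ with the $\Lambda_0$-action given by $\theta$, with respect to $\delta$. If in addition every finite $\sigma(\Gamma)$-invariant measurable subequivalence relation of $\mathcal R_\theta^{Y_0}$ is contained in $\mathcal R_\sigma$, then $\mathcal K=\mathcal R_{\sigma(K)}$ a.e., $b^*b=|K|q$, $bb^*=\sum_{k\in K}u_k$, and $\alpha=|K|^{-1}\mathrm{Ad}(b^*)$ is an isomorphism of $A^K$ onto $Bq$, conjugating the two actions. If, moreover, $\Gamma$ has no non-trivial finite normal subgroup, then $\delta$ is injective, $b\in P$ is a partial isometry normalizing $B$ with $bb^*=p$ and $b^*b=q$, and $\mathrm{Ad}(b^*)$ is a $*$-isomorphism of $A$ onto $Bq$ that conjugates $\sigma$ with $\theta_{|\Lambda_0}$. It is implemented by some $\varphi\in[\mathcal R_\theta]$ with $\varphi(Y_0)=W$ a.e., $b^*(\chi_{Y_0}\cdot(a\circ\varphi))b=\chi_Wa$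 for every bounded measurable $a$, and $\varphi(\Delta(\sigma_gt))=\theta_{\delta(g)}(\varphi(\Delta(t)))$ for all $g\in\Gamma$ and a.e. $t\in X$. -/

import Mathlib

open MeasureTheory ProbabilityTheory Set
open scoped ENNReal ComplexConjugate

noncomputable section

namespace OE

/-! ### Actions, orbit relations, orbit equivalence -/

section Actions

variable {X Y Z : Type*} [MeasurableSpace X] [MeasurableSpace Y] [MeasurableSpace Z]

/-- Essential freeness: every `g ≠ 1` has a null set of fixed points. -/
def EssFree (G : Type*) [Group G] [MulAction G Z] (m : Measure Z) : Prop :=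
  ∀ g : G, g ≠ 1 → ∀ᵐ z ∂m, g • z ≠ z

/-- Weak mixing of the action of `G` on `L^∞(Z, m)`: for every finite set `F` of bounded functions
of integral `0` and every `ε > 0` there is `g` with `|τ(f^* σ_g(f'))| ≤ ε` for all `f, f' ∈ F`,
where `σ_g(f') = f' ∘ g⁻¹`. -/
def WeakMixing (G : Type*) [Group G] [MulAction G Z] (m : Measure Z) : Prop :=
  ∀ F : Finset (Z → ℂ), (∀ f ∈ F, MemLp f ⊤ m ∧ ∫ z, f z ∂m = 0) → ∀ ε : ℝ, 0 < ε →
    ∃ g : G, ∀ f ∈ F, ∀ f' ∈ F, ‖∫ z, conj (f z) * f' (g⁻¹ • z) ∂m‖ ≤ ε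

/-- The orbit equivalence relation of the action of `G`, restricted to the subset `D`. -/
def orbitRelOn (G : Type*) [Group G] [MulAction G Z] (D : Set Z) (z z' : Z) : Prop :=
  z ∈ D ∧ z' ∈ D ∧ z' ∈ MulAction.orbit G z

/-- `Δ` is a local orbit equivalence of the relations `R`, `S`: it preserves the measure and for
almost every `t` it is a bijection of the `R`-class of `t` onto the `S`-class of `Δ t`. -/
def IsLocalOE (R : X → X → Prop) (S : Y → Y → Prop) (μ : Measure X) (ν : Measure Y)
    (Δ : X → Y) : Prop :=
  MeasurePreserving Δ μ ν ∧ ∀ᵐ t ∂μ, BijOn Δ {t' | R t t'} {y | S (Δ t) y}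

/-- `Δ` is an embedding of the relation `R` into the relation `S`: it is an isomorphism of
measure spaces (with inverse `Δinv`, modulo null sets) which takes almost every `R`-class into an
`S`-class. -/
structure IsEmbedding (R : X → X → Prop) (S : Y → Y → Prop) (μ : Measure X) (ν : Measure Y)
    (Δ : X → Y) (Δinv : Y → X) : Prop where
  measurePreserving : MeasurePreserving Δ μ ν
  measurePreserving_inv : MeasurePreserving Δinv ν μ
  left_inv : ∀ᵐ t ∂μ, Δinv (Δ t) = t
  right_inv : ∀ᵐ y ∂ν, Δ (Δinv y) = y
  maps_rel : ∀ᵐ t ∂μ, ∀ t', R t t' → S (Δ t) (Δ t')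

/-- `φ` belongs to the full group of the relation `R` on the measure space `(Z, m)`: it is a
measure preserving automorphism (modulo null sets) whose graph is contained in `R` (a.e.). -/
structure IsInFullGroup (R : Z → Z → Prop) (m : Measure Z) (φ : Z → Z) : Prop where
  measurePreserving : MeasurePreserving φ m m
  exists_inv : ∃ φ' : Z → Z, MeasurePreserving φ' m m ∧
    (∀ᵐ z ∂m, φ' (φ z) = z) ∧ ∀ᵐ z ∂m, φ (φ' z) = z
  graph : ∀ᵐ z ∂m, R z (φ z)

/-- The Zimmer cocycle of `Δ`: for almost every `t`, `w(t, g)` is the unique `h` such that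
`Δ (g⁻¹ t) = h⁻¹ Δ(t)`. -/
def zimmerCocycle {Γ Λ : Type*} [Group Γ] [Group Λ] [MulAction Γ X] [MulAction Λ Y]
    (Δ : X → Y) (t : X) (g : Γ) : Λ :=
  Classical.epsilon fun h : Λ => Δ (g⁻¹ • t) = h⁻¹ • Δ t

/-- `Γ` has no non-trivial finite normal subgroup. -/
def NoFiniteNormalSubgroup (Γ : Type*) [Group Γ] : Prop :=
  ∀ N : Subgroup Γ, N.Normal → Finite N → N = ⊥

end Actions

/-! ### The group measure space von Neumann algebra -/

section CrossedProduct

variable {Z : Type*} [MeasurableSpace Z]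

/-- The Hilbert space `L²(Z, m) ⊗ ℓ²(G)`. -/
abbrev L2 (G : Type*) [MeasurableSpace G] (m : Measure Z) : Type _ :=
  Lp ℂ 2 (m.prod (Measure.count : Measure G))

/-- Bounded operators on `L²(Z, m) ⊗ ℓ²(G)`. -/
abbrev Op (G : Type*) [MeasurableSpace G] (m : Measure Z) : Type _ :=
  L2 G m →L[ℂ] L2 G m

theorem memLp_comp_fst {G : Type*} [MeasurableSpace G] {m : Measure Z} {a : Z → ℂ}
    (ha : MemLp a ⊤ m) :
    MemLp (fun w : Z × G => a w.1) ⊤ (m.prod (Measure.count : Measure G)) := by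
  have hq : Measure.QuasiMeasurePreserving (Prod.fst : Z × G → Z)
      (m.prod (Measure.count : Measure G)) m := Measure.quasiMeasurePreserving_fst
  obtain ⟨h1, h2⟩ := ha
  refine ⟨h1.comp_quasiMeasurePreserving hq, ?_⟩
  rw [eLpNorm_exponent_top] at h2 ⊢
  refine lt_of_le_of_lt ?_ h2
  refine essSup_le_of_ae_le _ ?_
  exact hq.ae (ae_le_eLpNormEssSup (f := a) (μ := m))

open scoped Classical in
/-- Multiplication by the function `a ∈ L^∞(Z, m)` on `L²(Z, m) ⊗ ℓ²(G)`. -/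
def mulOp (G : Type*) [MeasurableSpace G] (m : Measure Z) (a : Z → ℂ) : Op G m :=
  if ha : MemLp a ⊤ m then
    (ContinuousLinearMap.mul ℂ ℂ).holderL (m.prod (Measure.count : Measure G)) ⊤ 2 2
      ((memLp_comp_fst (G := G) ha).toLp _)
  else 0

/-- The projection `χ_D ∈ L^∞(Z, m)`. -/
def proj (G : Type*) [MeasurableSpace G] (m : Measure Z) (D : Set Z) : Op G m :=
  mulOp G m (D.indicator 1)

/-- `L^∞(D, m) ⊆ L^∞(Z, m)`, as an algebra of multiplication operators. -/
def linf (G : Type*) [MeasurableSpace G] (m : Measure Z) (D : Set Z) : Set (Op G m) :=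
  {T | ∃ a : Z → ℂ, MemLp a ⊤ m ∧ (∀ z ∉ D, a z = 0) ∧ T = mulOp G m a}

section

variable {G : Type*} [Group G] [Countable G] [MeasurableSpace G] [DiscreteMeasurableSpace G]
  [MulAction G Z] [MeasurableConstSMul G Z] (m : Measure Z) [SFinite m]
  [SMulInvariantMeasure G Z m]

theorem measurePreserving_diag (g : G) :
    MeasurePreserving (fun w : Z × G => (g⁻¹ • w.1, g⁻¹ * w.2))
      (m.prod (Measure.count : Measure G)) (m.prod (Measure.count : Measure G)) := by
  have h2 : MeasurePreserving (fun k : G => g⁻¹ * k) Measure.count Measure.count := by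
    refine ⟨Measurable.of_discrete, ?_⟩
    ext s hs
    rw [Measure.map_apply Measurable.of_discrete hs, Measure.count_apply hs,
      Measure.count_apply (Measurable.of_discrete hs),
      Set.encard_preimage_of_bijective (Group.mulLeft_bijective g⁻¹) s]
  exact (measurePreserving_smul g⁻¹ m).prod h2

/-- The canonical unitary `u_g = σ_g ⊗ λ_g` on `L²(Z, m) ⊗ ℓ²(G)`. -/
def canU (g : G) : Op G m :=
  (Lp.compMeasurePreservingₗᵢ ℂ (fun w : Z × G => (g⁻¹ • w.1, g⁻¹ * w.2))
    (measurePreserving_diag m g)).toContinuousLinearMap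

/-- The generators of the group measure space algebra, and their adjoints. -/
def generators (G : Type*) [Group G] [Countable G] [MeasurableSpace G]
    [DiscreteMeasurableSpace G] [MulAction G Z] [MeasurableConstSMul G Z] (m : Measure Z)
    [SFinite m] [SMulInvariantMeasure G Z m] : Set (Op G m) :=
  let S := linf G m univ ∪ range (canU (G := G) m)
  S ∪ star S

/-- The group measure space von Neumann algebra `L^∞(Z, m) ⋊ G`: the von Neumann algebra generated
(as a double commutant) by `L^∞(Z, m)` and the canonical unitaries. -/
def crossedProduct (G : Type*) [Group G] [Countable G] [MeasurableSpace G]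
    [DiscreteMeasurableSpace G] [MulAction G Z] [MeasurableConstSMul G Z] (m : Measure Z)
    [SFinite m] [SMulInvariantMeasure G Z m] : VonNeumannAlgebra (L2 G m) where
  toStarSubalgebra := StarSubalgebra.centralizer ℂ (Set.centralizer (generators G m))
  centralizer_centralizer' := by
    have hstar : star (Set.centralizer (generators G m)) = Set.centralizer (generators G m) := by
      have hS : star (generators G m) = generators G m := by
        simp only [generators, Set.union_star, star_star]
        rw [Set.union_comm]
      rw [Set.star_centralizer, hS]
    have hc : (StarSubalgebra.centralizer ℂ (Set.centralizer (generators G m))).carrier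
        = Set.centralizer (Set.centralizer (generators G m)) := by
      have := StarSubalgebra.coe_centralizer ℂ (Set.centralizer (generators G m))
      rw [hstar, Set.union_self] at this
      exact this
    rw [hc, Set.centralizer_centralizer_centralizer]

/-- The corner `e N e` of the von Neumann algebra `N` at the projection `e ∈ N`. -/
def corner {H : Type*} [NormedAddCommGroup H] [InnerProductSpace ℂ H] [CompleteSpace H]
    (N : VonNeumannAlgebra H) (e : H →L[ℂ] H) : Set (H →L[ℂ] H) :=
  {x | x ∈ N ∧ e * x = x ∧ x * e = x}

/-- `T = Σ_i f i`, with convergence in the strong operator topology. -/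
def StrongHasSum {ι H : Type*} [NormedAddCommGroup H] [NormedSpace ℂ H]
    (f : ι → H →L[ℂ] H) (T : H →L[ℂ] H) : Prop :=
  ∀ ξ : H, HasSum (fun i => f i ξ) (T ξ)

/-- `T` is the canonical partial isometry `u_φ` of `L^∞(Z, m) ⋊ G` (for a free action of `G`)
which implements a local isomorphism `φ` of `Z` with graph in the orbit relation of `G`. Here `φ`
is given by the relation `ρ z z'`, which says that `z` is in the range of `φ` and `z' = φ⁻¹(z)`;
and `u_φ = Σ_g χ_{E_g} u_g`, where `E_g` is the set of those `z` for which
`φ⁻¹(z) = g⁻¹ z`. -/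
def IsCanonicalFor (ρ : Z → Z → Prop) (T : Op G m) : Prop :=
  StrongHasSum (fun g : G => proj G m {z | ρ z (g⁻¹ • z)} * canU m g) T

end

section Ad

variable {H : Type*} [NormedAddCommGroup H] [InnerProductSpace ℂ H] [CompleteSpace H]

/-- `b` is a scalar multiple of a partial isometry. -/
def IsScalarMulPartialIsometry (b : H →L[ℂ] H) : Prop :=
  ∃ (c : ℂ) (s : H →L[ℂ] H), s * star s * s = s ∧ b = c • s

/-- The map `c⁻¹ Ad(b^*) : x ↦ c⁻¹ b^* x b`. -/
def scaledAd (c : ℕ) (b x : H →L[ℂ] H) : H →L[ℂ] H :=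
  (c : ℂ)⁻¹ • (star b * x * b)

/-- `α` restricts to an isomorphism of the `*`-algebra `S` onto the `*`-algebra `T`. -/
def IsStarIsoOn (α : (H →L[ℂ] H) → (H →L[ℂ] H)) (S T : Set (H →L[ℂ] H)) : Prop :=
  BijOn α S T ∧ (∀ x ∈ S, ∀ y ∈ S, α (x + y) = α x + α y ∧ α (x * y) = α x * α y) ∧
    ∀ x ∈ S, α (star x) = star (α x) ∧ ∀ c : ℂ, α (c • x) = c • α x

/-- The algebra `S` is invariant under `σ_g = Ad(u_g)`, `g ∈ Γ`; the kernel of `δ` acts trivially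
on it, so that `Γ / ker δ` acts on `S`; `δ(Γ)` acts on the algebra `T` by `θ_h = Ad(v_h)`; and
`α` is an isomorphism of `S` onto `T` which conjugates these two actions with respect to the
identification of `Γ / ker δ` with `δ(Γ)` given by `δ`. -/
def ConjugatesVia {Γ Λ : Type*} [Group Γ] [Group Λ] (δ : Γ →* Λ)
    (u : Γ → H →L[ℂ] H) (v : Λ → H →L[ℂ] H) (α : (H →L[ℂ] H) → (H →L[ℂ] H))
    (S T : Set (H →L[ℂ] H)) : Prop :=
  IsStarIsoOn α S T ∧
  (∀ g, ∀ x ∈ S, u g * x * star (u g) ∈ S) ∧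
  (∀ k ∈ δ.ker, ∀ x ∈ S, u k * x * star (u k) = x) ∧
  (∀ h ∈ δ.range, ∀ y ∈ T, v h * y * star (v h) ∈ T) ∧
  ∀ g, ∀ x ∈ S, α (u g * x * star (u g)) = v (δ g) * α x * star (v (δ g))

/-- The fixed point algebra of `{Ad(u_k)}_{k ∈ K}` on `S`. -/
def fixedAlg {Γ : Type*} [Group Γ] (K : Subgroup Γ) (u : Γ → H →L[ℂ] H)
    (S : Set (H →L[ℂ] H)) : Set (H →L[ℂ] H) :=
  {x | x ∈ S ∧ ∀ k ∈ K, u k * x * star (u k) = x}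

end Ad

end CrossedProduct

/-! ### Amplifications

The group `Γ × ℤ` acts on `X × ℤ` by the product of the given action and translations. The
amplification `R_σ^n` is the restriction of the orbit relation of this action to a subset
`X^n ⊆ X × ℤ` of measure `n`, and `M^n` is the corner of `L^∞(X × ℤ) ⋊ (Γ × ℤ)` at `χ_{X^n}`. -/

section Amplification

/-- The group `Γ × ℤ`, written multiplicatively. -/
abbrev Stab (Γ : Type*) : Type _ := Γ × Multiplicative ℤ

instance : MeasurableSpace (Multiplicative ℤ) := ⊤

instance : DiscreteMeasurableSpace (Multiplicative ℤ) := ⟨fun _ => trivial⟩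

variable {Γ Λ X Y : Type*} [Group Γ] [Group Λ] [MeasurableSpace X] [MeasurableSpace Y]
  [MulAction Γ X] [MulAction Λ Y]

instance stabAction : MulAction (Stab Γ) (X × ℤ) where
  smul a z := (a.1 • z.1, a.2.toAdd + z.2)
  one_smul z := Prod.ext (one_smul Γ z.1) (zero_add z.2)
  mul_smul a b z := Prod.ext (mul_smul a.1 b.1 z.1) (add_assoc a.2.toAdd b.2.toAdd z.2)

instance [MeasurableConstSMul Γ X] : MeasurableConstSMul (Stab Γ) (X × ℤ) where
  measurable_const_smul a :=
    ((measurable_const_smul a.1).comp measurable_fst).prodMk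
      ((Measurable.of_discrete (f := fun j : ℤ => a.2.toAdd + j)).comp measurable_snd)

/-- The measure `μ × (counting measure)` on `X × ℤ`. -/
abbrev stabMeasure (μ : Measure X) : Measure (X × ℤ) := μ.prod Measure.count

instance [MeasurableConstSMul Γ X] (μ : Measure X) [SFinite μ] [SMulInvariantMeasure Γ X μ] :
    SMulInvariantMeasure (Stab Γ) (X × ℤ) (stabMeasure μ) where
  measure_preimage_smul a s hs := by
    have h2 : MeasurePreserving (fun j : ℤ => a.2.toAdd + j) Measure.count Measure.count := by
      refine ⟨Measurable.of_discrete, ?_⟩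
      ext t ht
      rw [Measure.map_apply Measurable.of_discrete ht, Measure.count_apply ht,
        Measure.count_apply (Measurable.of_discrete ht),
        Set.encard_preimage_of_bijective (AddGroup.addLeft_bijective a.2.toAdd) t]
    exact ((measurePreserving_smul a.1 μ).prod h2).measure_preimage hs.nullMeasurableSet

/-- The copy `X × {0}` of `X` in `X × ℤ`. -/
def zeroCopy (X : Type*) : Set (X × ℤ) := {z | z.2 = 0}

/-- A realization of the amplification `Δ^n : X^n → Y`, `n = ν(Y₀)⁻¹`, of a local orbit equivalence
`Δ : X → Y₀` of `R_σ` and `R_θ^{Y₀}`: a subset `X^n` of `X × ℤ` of measure `n` which contains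
`X = X × {0}`, and a local orbit equivalence `Δ^n` of `R_σ^n` and `R_θ` (for the normalized
measure on `X^n`) which extends `Δ`. -/
structure Amplification (Γ Λ : Type*) {X Y : Type*} [Group Γ] [Group Λ] [MeasurableSpace X]
    [MeasurableSpace Y] [MulAction Γ X] [MulAction Λ Y] (μ : Measure X) (ν : Measure Y)
    (Y₀ : Set Y) (Δ : X → Y) where
  carrier : Set (X × ℤ)
  measurableSet_carrier : MeasurableSet carrier
  zeroCopy_subset : zeroCopy X ⊆ carrier
  measure_carrier : stabMeasure μ carrier = (ν Y₀)⁻¹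
  toFun : X × ℤ → Y
  extends_map : ∀ᵐ t ∂μ, toFun (t, 0) = Δ t
  isLocalOE : IsLocalOE (orbitRelOn (Stab Γ) carrier) (orbitRelOn Λ univ)
    ((stabMeasure μ)[|carrier]) ν toFun

/-- The pull back `θ'` of `θ` to `X^n`: `E.pullback h z z'` says that `z' = θ'_h(z)`, i.e. `z'` is
the (a.e. unique) point in the `R_σ^n`-class of `z` with `Δ^n(z') = θ_h(Δ^n(z))`. -/
def Amplification.pullback {μ : Measure X} {ν : Measure Y} {Y₀ : Set Y} {Δ : X → Y}
    (E : Amplification Γ Λ μ ν Y₀ Δ) (h : Λ) (z z' : X × ℤ) : Prop :=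
  orbitRelOn (Stab Γ) E.carrier z z' ∧ E.toFun z' = h • E.toFun z

end Amplification

/-! ### Finite invariant subequivalence relations -/

section Subrelations

variable {X Y : Type*} [MeasurableSpace X] [MeasurableSpace Y]

/-- `κ` is a finite `σ(Γ)`-invariant (measurable) subequivalence relation of `R_θ^{Y₀}`, where the
action `σ` on `X` is transported to `Y₀` by means of the isomorphism `Δ : X → Y₀`. -/
structure IsFiniteInvariantSubrel (Γ Λ : Type*) [Group Γ] [Group Λ] [MulAction Γ X]
    [MulAction Λ Y] (ν : Measure Y) (Y₀ : Set Y) (Δ : X → Y) (Δinv : Y → X)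
    (κ : Y → Y → Prop) : Prop where
  measurableSet : MeasurableSet {w : Y × Y | κ w.1 w.2}
  subrel : ∀ y y', κ y y' → orbitRelOn Λ Y₀ y y'
  refl : ∀ y ∈ Y₀, κ y y
  symm : ∀ y y', κ y y' → κ y' y
  trans : ∀ y y' y'', κ y y' → κ y' y'' → κ y y''
  finite : ∀ᵐ y ∂(ν.restrict Y₀), {y' | κ y y'}.Finite
  invariant : ∀ g : Γ, ∀ᵐ y ∂(ν.restrict Y₀), ∀ y', κ y y' →
    κ (Δ (g • Δinv y)) (Δ (g • Δinv y'))

/-- The algebra of the functions in `L^∞(Y₀)` which are constant on the classes of `κ`. -/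
def quotientAlg (G : Type*) [MeasurableSpace G] (ν : Measure Y) (Y₀ : Set Y)
    (κ : Y → Y → Prop) : Set (Op G ν) :=
  {T | ∃ a : Y → ℂ, MemLp a ⊤ ν ∧ (∀ y ∉ Y₀, a y = 0) ∧
    (∀ᵐ y ∂(ν.restrict Y₀), ∀ y', κ y y' → a y = a y') ∧ T = mulOp G ν a}

end Subrelations

end OE

end

set_option linter.unusedSectionVars false

namespace OE

/-! ### Multiplication operators and canonical unitaries, pointwise -/

section Pointwise

variable {Z : Type*} [MeasurableSpace Z] {G : Type*} [MeasurableSpace G] {m : Measure Z}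

/-! Write `D` for the copy of `X` in `X^n` (local OE) or for `Y₀` (embedding), `C` for `X^n` or `Y`,
`s` for the action of `Γ` on `D` and `t` for the action of `Λ` on `C`. On `{v = h}` the operator `b`
agrees with `v_h`, which is composition with `t h⁻¹`; hence `b` is composition with the map `f z = t
(v z)⁻¹ z` from `D` to `C` (called `twist t v` below), lifted to `Z × G`. The graph of `f` lies in
the ambient orbit relation, and the hypothesis on `v` and `δ` says that `f (s g z) = t (δ g) (f z)`.
All assertions about `b` become assertions about the fibres of `f`.

Let `N y` be the number of points in the fibre over `y`. Since `f` acts piecewise by group elements,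
`∫_D F ∘ f = ∫ N F` (`setLIntegral_comp_eq`). With `F = 1` this shows that `N` is finite a.e.; by
equivariance `N ∘ f` is `Γ`-invariant; and weak mixing, used only through ergodicity, makes it a
constant `n` (`exists_isUntwisting`). So `N = n χ_W` a.e. with `W` the essential image of `f`. This
gives boundedness of `b`, the identity `b^* b = n χ_W`, and the fact that `n⁻¹ Ad(b^*)` inverts `α ↦
α ∘ f`, from `L^∞(W)` onto the functions on `D` that are constant on fibres (`conjugatesVia`). The
kernel `K` of `δ` acts freely inside each fibre, so it is finite.

If the fibres lie in `Γ`-orbits, they are `K`-orbits: `f (s g z) = f z` means that `t (δ g)` fixes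
`f z`, so `δ g = 1` by freeness. Then `n = |K|` and `b b^* = Σ u_k` (`mul_star_self`). For a local
OE this is automatic, as points of `X × {0}` in one ambient orbit are `Γ`-equivalent. For an
embedding the fibres are the classes of a finite invariant relation `κ`, and the maximality
hypothesis applied to `κ` puts them in `Γ`-orbits. In the local OE case the translates of `W` by `Λ
/ δ(Γ)` partition `X^n`, and comparison of measures gives the index (`card_quotient_mul`).

If the fibres are `K`-orbits and `K` is trivial, `f` is injective. It extends to the full group by
sending a point outside `D` along `f⁻¹` until it leaves `W`, which happens a.e. because the measure
of `C` is finite (`IsPartialIso.exists_extension`).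

Operators are handled through `Implements`: products become compositions of maps, and equal maps
give equal operators. Almost everywhere statements are turned into statements on a conull invariant
set (`IsGoodSet`), so that they can be used at every point of an orbit. -/

theorem ae_fst {P : Z → Prop} (h : ∀ᵐ z ∂m, P z) :
    ∀ᵐ w ∂m.prod (Measure.count : Measure G), P w.1 :=
  (Measure.quasiMeasurePreserving_fst (μ := m) (ν := (Measure.count : Measure G))).ae h

theorem op_ext {T T' : Op G m}
    (h : ∀ ξ : L2 G m, ∀ᵐ w ∂m.prod (Measure.count : Measure G), T ξ w = T' ξ w) : T = T' :=
  ContinuousLinearMap.ext fun ξ => Lp.ext (h ξ)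

theorem mulOp_ae {a : Z → ℂ} (ha : MemLp a ⊤ m) (ξ : L2 G m) :
    ∀ᵐ w ∂m.prod (Measure.count : Measure G), mulOp G m a ξ w = a w.1 * ξ w := by
  have h : mulOp G m a ξ = (ContinuousLinearMap.mul ℂ ℂ).holder 2
      ((memLp_comp_fst (G := G) ha).toLp _) ξ := by
    rw [mulOp, dif_pos ha]; rfl
  rw [h]
  filter_upwards [ContinuousLinearMap.coeFn_holder (r := 2) (ContinuousLinearMap.mul ℂ ℂ)
    ((memLp_comp_fst (G := G) ha).toLp _) ξ, (memLp_comp_fst (G := G) ha).coeFn_toLp] with w h1 h2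
  rw [h1, h2]; rfl

theorem memLp_indicator_one {D : Set Z} (hD : MeasurableSet D) :
    MemLp (D.indicator (1 : Z → ℂ)) ⊤ m :=
  (memLp_top_const (1 : ℂ)).indicator hD

theorem proj_ae {D : Set Z} (hD : MeasurableSet D) (ξ : L2 G m) :
    ∀ᵐ w ∂m.prod (Measure.count : Measure G),
      proj G m D ξ w = D.indicator (1 : Z → ℂ) w.1 * ξ w :=
  mulOp_ae (memLp_indicator_one hD) ξ

theorem mulOp_congr {a b : Z → ℂ} (h : a =ᵐ[m] b) : mulOp G m a = mulOp G m b := by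
  by_cases ha : MemLp a ⊤ m
  · have hb : MemLp b ⊤ m := (memLp_congr_ae h).1 ha
    refine op_ext fun ξ => ?_
    filter_upwards [mulOp_ae ha ξ, mulOp_ae hb ξ, ae_fst h] with w h1 h2 h3
    rw [h1, h2, h3]
  · have hb : ¬ MemLp b ⊤ m := fun hb => ha ((memLp_congr_ae h).2 hb)
    rw [mulOp, mulOp, dif_neg ha, dif_neg hb]

theorem proj_congr {D E : Set Z} (h : ∀ᵐ z ∂m, z ∈ D ↔ z ∈ E) : proj G m D = proj G m E := by
  refine mulOp_congr ?_
  filter_upwards [h] with z hz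
  by_cases hD : z ∈ D
  · rw [indicator_of_mem hD, indicator_of_mem (hz.1 hD)]
  · rw [indicator_of_notMem hD, indicator_of_notMem fun h => hD (hz.2 h)]

theorem memLp_top_mul {a b : Z → ℂ} (ha : MemLp a ⊤ m) (hb : MemLp b ⊤ m) :
    MemLp (fun z => a z * b z) ⊤ m :=
  hb.mul' ha

theorem mulOp_mul {a b : Z → ℂ} (ha : MemLp a ⊤ m) (hb : MemLp b ⊤ m) :
    mulOp G m a * mulOp G m b = mulOp G m fun z => a z * b z := by
  refine op_ext fun ξ => ?_
  filter_upwards [mulOp_ae ha (mulOp G m b ξ), mulOp_ae hb ξ,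
    mulOp_ae (memLp_top_mul ha hb) ξ] with w h1 h2 h3
  rw [mul_apply_eq_comp, h1, h2, h3, mul_assoc]

theorem proj_mul_mulOp {D : Set Z} (hD : MeasurableSet D) {a : Z → ℂ} (ha : MemLp a ⊤ m)
    (h : ∀ z ∉ D, a z = 0) : proj G m D * mulOp G m a = mulOp G m a := by
  rw [proj, mulOp_mul (memLp_indicator_one hD) ha]
  congr 1
  funext z
  by_cases hz : z ∈ D
  · simp [hz]
  · simp [hz, h z hz]

theorem mulOp_mul_proj {D : Set Z} (hD : MeasurableSet D) {a : Z → ℂ} (ha : MemLp a ⊤ m)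
    (h : ∀ z ∉ D, a z = 0) : mulOp G m a * proj G m D = mulOp G m a := by
  rw [proj, mulOp_mul ha (memLp_indicator_one hD)]
  congr 1
  funext z
  by_cases hz : z ∈ D
  · simp [hz]
  · simp [hz, h z hz]

theorem proj_mul_proj {D E : Set Z} (hD : MeasurableSet D) (hE : MeasurableSet E) (h : D ⊆ E) :
    proj G m E * proj G m D = proj G m D ∧ proj G m D * proj G m E = proj G m D :=
  have h0 : ∀ z ∉ E, D.indicator (1 : Z → ℂ) z = 0 := fun _ hz =>
    indicator_of_notMem (fun hz' => hz (h hz')) _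
  ⟨proj_mul_mulOp hE (memLp_indicator_one hD) h0, mulOp_mul_proj hE (memLp_indicator_one hD) h0⟩

/-- `a ↦ mulOp a` is injective modulo null sets. -/
theorem mulOp_injective [SigmaFinite m] [Inhabited G] [Countable G] [DiscreteMeasurableSpace G]
    {a b : Z → ℂ} (ha : MemLp a ⊤ m) (hb : MemLp b ⊤ m)
    (h : mulOp G m a = mulOp G m b) : a =ᵐ[m] b := by
  have key : ∀ n, ∀ᵐ z ∂m, z ∈ spanningSets m n → a z = b z := by
    intro n
    have hs : MeasurableSet (spanningSets m n ×ˢ ({default} : Set G)) :=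
      (measurableSet_spanningSets m n).prod (measurableSet_singleton _)
    have hfin : (m.prod (Measure.count : Measure G)) (spanningSets m n ×ˢ {default}) ≠ ⊤ := by
      rw [Measure.prod_prod, Measure.count_singleton, mul_one]
      exact (measure_spanningSets_lt_top m n).ne
    -- Test vector: the indicator of a set of finite measure over a single group element.
    -- Multiplication by `a` and by `b` then exhibits the values of both functions on that set.
    let ξ : L2 G m := indicatorConstLp 2 hs hfin (1 : ℂ)
    have h1 : ∀ᵐ w ∂m.prod (Measure.count : Measure G),
        w ∈ spanningSets m n ×ˢ ({default} : Set G) → a w.1 = b w.1 := by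
      filter_upwards [mulOp_ae ha ξ, mulOp_ae hb ξ,
        indicatorConstLp_coeFn (p := 2) (hs := hs) (hμs := hfin) (c := (1 : ℂ))] with w h1 h2 h3 hw
      have h4 : ξ w = 1 := by rw [show ξ w = _ from h3, indicator_of_mem hw]
      rw [h4, mul_one] at h1 h2
      rw [← h1, ← h2, h]
    have h2 := Measure.ae_ae_of_ae_prod h1
    filter_upwards [h2] with z hz hzn
    have h3 : ∀ g : G, (z, g) ∈ spanningSets m n ×ˢ ({default} : Set G) → a z = b z := by
      have : ∀ᵐ g ∂(Measure.count : Measure G),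
        (z, g) ∈ spanningSets m n ×ˢ ({default} : Set G) → a z = b z := hz
      rw [Measure.ae_count_iff] at this
      exact this
    exact h3 default ⟨hzn, rfl⟩
  filter_upwards [ae_all_iff.2 key] with z hz
  have : z ∈ ⋃ n, spanningSets m n := by rw [iUnion_spanningSets]; trivial
  obtain ⟨n, hn⟩ := mem_iUnion.1 this
  exact hz n hn

/-- For a measurable partition `D = ⊔ D_i` the projections `χ_{D_i}` sum up strongly to `χ_D`. -/
theorem strongHasSum_proj {ι : Type*} [Countable ι] {D : ι → Set Z} (hD : ∀ i, MeasurableSet (D i))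
    (hdisj : Pairwise (Function.onFun Disjoint D)) :
    StrongHasSum (fun i => proj G m (D i)) (proj G m (⋃ i, D i)) := by
  classical
  intro ξ
  set U := ⋃ i, D i with hU
  have hUm : MeasurableSet U := MeasurableSet.iUnion hD
  set M := m.prod (Measure.count : Measure G) with hM
  -- The error of the partial sum over `F` has squared norm `ρ (s F)`, where `ρ` is the finite
  -- measure with density `|ξ|²` and `s F` is the part of `U` not yet covered; it tends to `0` by
  -- continuity from above.
  let ρ : Measure (Z × G) := M.withDensity fun w => ‖ξ w‖ₑ ^ 2
  have hρtop : ρ univ ≠ ⊤ := by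
    rw [withDensity_apply _ MeasurableSet.univ, Measure.restrict_univ]
    have := (Lp.memLp ξ).2
    rw [eLpNorm_lt_top_iff_lintegral_rpow_enorm_lt_top (by norm_num) (by norm_num)] at this
    simpa using this.ne
  let s : Finset ι → Set (Z × G) := fun F => Prod.fst ⁻¹' (U \ ⋃ i ∈ F, D i)
  have hs : ∀ F, MeasurableSet (s F) := fun F =>
    measurable_fst (hUm.diff (Finset.measurableSet_biUnion F fun i _ => hD i))
  have hanti : Antitone s := fun F F' hF w hw =>
    ⟨hw.1, fun h => hw.2 (biUnion_subset_biUnion_left hF h)⟩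
  have hlim := tendsto_measure_iInter_atTop (μ := ρ) (fun F => (hs F).nullMeasurableSet) hanti
    ⟨∅, ne_top_of_le_ne_top hρtop (measure_mono (subset_univ _))⟩
  have hempty : (⋂ F, s F) = ∅ := by
    ext w
    simp only [mem_iInter, mem_empty_iff_false, iff_false]
    intro h
    obtain ⟨i, hi⟩ := mem_iUnion.1 (h ∅).1
    exact (h {i}).2 (by simpa using hi)
  rw [hempty, measure_empty] at hlim
  have hnorm : ∀ F : Finset ι, edist (∑ i ∈ F, proj G m (D i) ξ) (proj G m U ξ)
      = (ρ (s F)) ^ (1 / 2 : ℝ) := by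
    intro F
    rw [Lp.edist_def, eLpNorm_eq_lintegral_rpow_enorm_toReal (by norm_num) (by norm_num),
      withDensity_apply _ (hs F), ← lintegral_indicator (hs F)]
    simp only [ENNReal.toReal_ofNat]
    congr 1
    refine lintegral_congr_ae ?_
    have hall : ∀ᵐ w ∂M, ∀ i, proj G m (D i) ξ w = (D i).indicator (1 : Z → ℂ) w.1 * ξ w :=
      ae_all_iff.2 fun i => proj_ae (hD i) ξ
    have hsum : ∀ᵐ w ∂M, (∑ i ∈ F, proj G m (D i) ξ : L2 G m) w
        = ∑ i ∈ F, (proj G m (D i) ξ : L2 G m) w := by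
      filter_upwards [Lp.coeFn_finsetSum F fun i => proj G m (D i) ξ] with w hw
      rw [hw, Finset.sum_apply]
    filter_upwards [hall, hsum, proj_ae hUm ξ] with w h1 h2 h3
    rw [Pi.sub_apply, h2, h3, Finset.sum_congr rfl fun i _ => h1 i, ← Finset.sum_mul, ← sub_mul]
    by_cases hwU : w.1 ∈ U
    · obtain ⟨i, hi⟩ := mem_iUnion.1 hwU
      have h0 : ∀ j, j ≠ i → (D j).indicator (1 : Z → ℂ) w.1 = 0 := fun j hj =>
        indicator_of_notMem (fun h => (disjoint_left.1 (hdisj hj)) h hi) _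
      by_cases hiF : i ∈ F
      · have : w ∉ s F := fun h => h.2 (mem_biUnion hiF hi)
        rw [indicator_of_notMem this, Finset.sum_eq_single i (fun j _ hj => h0 j hj)
          (fun h => absurd hiF h)]
        simp [hi, hwU]
      · have : w ∈ s F := ⟨hwU, fun h => by
          obtain ⟨j, hj, hj'⟩ := mem_iUnion₂.1 h
          by_cases hji : j = i
          · exact hiF (hji ▸ hj)
          · exact disjoint_left.1 (hdisj hji) hj' hi⟩
        rw [indicator_of_mem this, Finset.sum_eq_zero fun j hj => h0 j fun h => hiF (h ▸ hj)]
        simp [hwU]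
    · have h0 : ∀ j, (D j).indicator (1 : Z → ℂ) w.1 = 0 := fun j =>
        indicator_of_notMem (fun h => hwU (mem_iUnion.2 ⟨j, h⟩)) _
      have : w ∉ s F := fun h => hwU h.1
      rw [indicator_of_notMem this, Finset.sum_eq_zero fun j _ => h0 j]
      simp [hwU]
  rw [HasSum, SummationFilter.unconditional_filter, tendsto_iff_edist_tendsto_0]
  simp only [hnorm]
  have := hlim.ennrpow_const (1 / 2 : ℝ)
  simpa using this

end Pointwise

section Group

variable {Z : Type*} [MeasurableSpace Z] {G : Type*} [Group G] [Countable G] [MeasurableSpace G]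
  [DiscreteMeasurableSpace G] [MulAction G Z] [MeasurableConstSMul G Z] {m : Measure Z} [SFinite m]
  [SMulInvariantMeasure G Z m]

theorem canU_ae (g : G) (ξ : L2 G m) :
    ∀ᵐ w ∂m.prod (Measure.count : Measure G), canU m g ξ w = ξ (g⁻¹ • w.1, g⁻¹ * w.2) :=
  Lp.coeFn_compMeasurePreserving ξ (measurePreserving_diag m g)

theorem ae_diag {P : Z × G → Prop} (h : ∀ᵐ w ∂m.prod (Measure.count : Measure G), P w) :
    ∀ᵐ w ∂m.prod (Measure.count : Measure G), ∀ a : G, P (a⁻¹ • w.1, a⁻¹ * w.2) :=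
  ae_all_iff.2 fun a => (measurePreserving_diag m a).quasiMeasurePreserving.ae h

variable (G) in
theorem ae_all_smul {P : Z → Prop} (h : ∀ᵐ z ∂m, P z) : ∀ᵐ z ∂m, ∀ g : G, P (g • z) :=
  ae_all_iff.2 fun g => (measurePreserving_smul g m).quasiMeasurePreserving.ae h

theorem proj_mul_canU_ae {D : Set Z} (hD : MeasurableSet D) (g : G) (ξ : L2 G m) :
    ∀ᵐ w ∂m.prod (Measure.count : Measure G), (proj G m D * canU m g) ξ w
      = D.indicator (1 : Z → ℂ) w.1 * ξ (g⁻¹ • w.1, g⁻¹ * w.2) := by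
  filter_upwards [proj_ae hD (canU m g ξ), canU_ae g ξ] with w h1 h2
  rw [mul_apply_eq_comp, h1, h2]

/-! ### Operators implementing partially defined maps with graph in the orbit relation -/

/-- `T` is composition with the partially defined map `f` with domain `E`, which has its graph in
the orbit relation. -/
def Implements (T : Op G m) (E : Set Z) (f : Z → Z) : Prop :=
  ∀ ξ : L2 G m, ∀ᵐ w ∂m.prod (Measure.count : Measure G),
    (w.1 ∉ E → T ξ w = 0) ∧
      (w.1 ∈ E → ∀ a : G, f w.1 = a⁻¹ • w.1 → T ξ w = ξ (a⁻¹ • w.1, a⁻¹ * w.2))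

/-- `Implements` puts no condition on `T` at points where `f z` is outside the orbit of `z`; `ho`
excludes them, and then the map determines the operator. -/
theorem Implements.eq {T T' : Op G m} {E E' : Set Z} {f f' : Z → Z} (hT : Implements T E f)
    (hT' : Implements T' E' f') (hE : ∀ᵐ z ∂m, z ∈ E ↔ z ∈ E')
    (hf : ∀ᵐ z ∂m, z ∈ E → f z = f' z) (ho : ∀ᵐ z ∂m, z ∈ E → ∃ a : G, f z = a • z) : T = T' := by
  refine op_ext fun ξ => ?_
  filter_upwards [hT ξ, hT' ξ, ae_fst hE, ae_fst hf, ae_fst ho] with w h1 h2 h3 h4 h5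
  by_cases hw : w.1 ∈ E
  · obtain ⟨a, ha⟩ := h5 hw
    have ha' : f w.1 = (a⁻¹)⁻¹ • w.1 := by rw [inv_inv, ha]
    rw [h1.2 hw _ ha', h2.2 (h3.1 hw) _ (by rw [← h4 hw, ha'])]
  · rw [h1.1 hw, h2.1 fun h => hw (h3.2 h)]

/-- Composition operators multiply contravariantly, so the map of the left factor is applied first.
The group elements of the two steps multiply, which takes care of the coordinate in `G`. -/
theorem Implements.mul {T T' : Op G m} {E E' : Set Z} {f f' : Z → Z} (hT : Implements T E f)
    (hT' : Implements T' E' f') (ho : ∀ᵐ z ∂m, z ∈ E → ∃ a : G, f z = a • z) :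
    Implements (T * T') {z | z ∈ E ∧ f z ∈ E'} (fun z => f' (f z)) := by
  intro ξ
  filter_upwards [hT (T' ξ), ae_diag (hT' ξ), ae_fst ho] with w h1 h2 h3
  rw [mul_apply_eq_comp]
  constructor
  · intro hw
    by_cases hE : w.1 ∈ E
    · obtain ⟨a, ha⟩ := h3 hE
      have ha' : f w.1 = (a⁻¹)⁻¹ • w.1 := by rw [inv_inv, ha]
      rw [h1.2 hE _ ha']
      exact (h2 a⁻¹).1 fun h => hw ⟨hE, by rwa [ha']⟩
    · exact h1.1 hE
  · rintro ⟨hE, hE'⟩ b hb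
    obtain ⟨a, ha⟩ := h3 hE
    have ha' : f w.1 = (a⁻¹)⁻¹ • w.1 := by rw [inv_inv, ha]
    rw [h1.2 hE _ ha', (h2 a⁻¹).2 (by rwa [← ha']) (a * b) (by
      rw [← ha', hb, ha', smul_smul]; congr 1; group)]
    simp only [smul_smul, ← mul_assoc, show (a * b)⁻¹ * a⁻¹⁻¹ = b⁻¹ by group]

/-- Freeness is essential: a nontrivial `a` fixing `z` would force `ξ (z, k) = ξ (z, a⁻¹ k)`. -/
theorem implements_proj {D : Set Z} (hD : MeasurableSet D)
    (hfree : ∀ᵐ z ∂m, ∀ a : G, a • z = z → a = 1) :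
    Implements (G := G) (proj G m D) D id := by
  intro ξ
  filter_upwards [proj_ae hD ξ, ae_fst hfree] with w h1 h2
  refine ⟨fun h => by rw [h1]; simp [h], fun h a ha => ?_⟩
  have : a⁻¹ = 1 := h2 _ ha.symm
  rw [h1, this]
  simp [h]

theorem implements_canU (hfree : ∀ᵐ z ∂m, ∀ a : G, a • z = z → a = 1) (g : G) :
    Implements (canU m g) univ (fun z => g⁻¹ • z) := by
  intro ξ
  filter_upwards [canU_ae g ξ, ae_fst hfree] with w h1 h2
  refine ⟨fun h => absurd trivial h, fun _ a ha => ?_⟩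
  have : a * g⁻¹ = 1 := h2 _ (by rw [mul_smul, ha, smul_inv_smul])
  obtain rfl : a = g := by rwa [mul_inv_eq_one] at this
  exact h1

/-- If `a = α ∘ f` on `E`, then `a T = T α`. -/
theorem Implements.mulOp_mul {T : Op G m} {E : Set Z} {f : Z → Z} (hT : Implements T E f)
    (ho : ∀ᵐ z ∂m, z ∈ E → ∃ a : G, f z = a • z) {a α : Z → ℂ} (ha : MemLp a ⊤ m)
    (hα : MemLp α ⊤ m) (h : ∀ᵐ z ∂m, z ∈ E → a z = α (f z)) :
    mulOp G m a * T = T * mulOp G m α := by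
  refine op_ext fun ξ => ?_
  filter_upwards [mulOp_ae ha (T ξ), hT ξ, hT (mulOp G m α ξ), ae_diag (mulOp_ae hα ξ), ae_fst h,
    ae_fst ho] with w h1 h2 h3 h4 h5 h6
  rw [mul_apply_eq_comp, mul_apply_eq_comp, h1]
  by_cases hw : w.1 ∈ E
  · obtain ⟨g, hg⟩ := h6 hw
    have hg' : f w.1 = (g⁻¹)⁻¹ • w.1 := by rw [inv_inv, hg]
    rw [h2.2 hw _ hg', h3.2 hw _ hg', h4, h5 hw, hg']
  · rw [h2.1 hw, h3.1 hw, mul_zero]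

theorem Implements.proj_mul {T : Op G m} {E D : Set Z} {f : Z → Z} (hT : Implements T E f)
    (hD : MeasurableSet D) (h : E ⊆ D) : proj G m D * T = T := by
  refine op_ext fun ξ => ?_
  filter_upwards [proj_ae hD (T ξ), hT ξ] with w h1 h2
  rw [mul_apply_eq_comp, h1]
  by_cases hw : w.1 ∈ E
  · simp [h hw]
  · rw [h2.1 hw, mul_zero]

theorem Implements.mul_proj {T : Op G m} {E D : Set Z} {f : Z → Z} (hT : Implements T E f)
    (hE : MeasurableSet E) (hD : MeasurableSet D)
    (ho : ∀ᵐ z ∂m, z ∈ E → ∃ a : G, f z = a • z) (h : ∀ᵐ z ∂m, z ∈ E → f z ∈ D) :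
    T * proj G m D = T := by
  conv_rhs => rw [← hT.proj_mul hE subset_rfl]
  refine (hT.mulOp_mul ho (memLp_indicator_one hE) (memLp_indicator_one hD) ?_).symm
  filter_upwards [h] with z hz hzE
  simp [hz hzE, hzE]

end Group

/-! ### Counting fibres and changing variables along maps with graph in the orbit relation -/

section Counting

/-- Simultaneous measurable choice of an element of a countable set. -/
theorem exists_measurable_select {α ι : Type*} [MeasurableSpace α] [Countable ι] [Nonempty ι]
    [MeasurableSpace ι] {S : ι → Set α} (hS : ∀ i, MeasurableSet (S i)) :
    ∃ c : α → ι, Measurable c ∧ ∀ x i, x ∈ S i → x ∈ S (c x) := by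
  classical
  obtain ⟨e, he⟩ := exists_surjective_nat ι
  -- The second alternative keeps the search total: where no `S i` contains `x`, it stops at `0`
  -- with an irrelevant value.
  let p : ℕ → α → Prop := fun n x => x ∈ S (e n) ∨ x ∉ ⋃ i, S i
  have hp : ∀ x, ∃ n, p n x := fun x => by
    by_cases hx : x ∈ ⋃ i, S i
    · obtain ⟨i, hi⟩ := mem_iUnion.1 hx
      obtain ⟨n, rfl⟩ := he i
      exact ⟨n, Or.inl hi⟩
    · exact ⟨0, Or.inr hx⟩
  refine ⟨fun x => e (Nat.find (hp x)), ?_, fun x i hi => ?_⟩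
  · exact Measurable.find (f := fun n _ => e n) (fun _ => measurable_const)
      (p := p) (fun n => (hS (e n)).union (MeasurableSet.iUnion hS).compl) hp
  · exact (Nat.find_spec (hp x)).resolve_right fun h => h (mem_iUnion.2 ⟨i, hi⟩)

theorem measurable_select_apply {α β ι : Type*} [MeasurableSpace α] [MeasurableSpace β]
    [Countable ι] [MeasurableSpace ι] [DiscreteMeasurableSpace ι] {F : ι → α → β}
    (hF : ∀ i, Measurable (F i)) {c : α → ι} (hc : Measurable c) : Measurable fun x => F (c x) x :=
  (measurable_from_prod_countable_right (f := fun p : ι × α => F p.1 p.2) hF).comp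
    (hc.prodMk measurable_id)

/-- Change of variables for a countable family of measure preserving maps `T a` with inverses
`S a`, restricted to sets `E a`. -/
theorem tsum_setLIntegral_comp {Ω ι : Type*} [MeasurableSpace Ω] [Countable ι] {ρ : Measure Ω}
    {T S : ι → Ω → Ω} (hT : ∀ a, MeasurePreserving (T a) ρ ρ) (hS : ∀ a, Measurable (S a))
    (hST : ∀ a w, S a (T a w) = w) {E : ι → Set Ω} (hE : ∀ a, MeasurableSet (E a))
    {F : Ω → ℝ≥0∞} (hF : Measurable F) :
    ∑' a, ∫⁻ w in E a, F (T a w) ∂ρ = ∫⁻ w, (∑' a, (E a).indicator 1 (S a w)) * F w ∂ρ := by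
  have h1 : ∀ a, ∫⁻ w in E a, F (T a w) ∂ρ = ∫⁻ w, (E a).indicator 1 (S a w) * F w ∂ρ := by
    intro a
    have hm : Measurable fun w => (E a).indicator (1 : Ω → ℝ≥0∞) (S a w) * F w :=
      ((measurable_one.indicator (hE a)).comp (hS a)).mul hF
    rw [← lintegral_indicator (hE a), ← (hT a).lintegral_comp hm]
    refine lintegral_congr fun w => ?_
    rw [hST]
    by_cases hw : w ∈ E a <;> simp [hw]
  simp_rw [h1]
  have hm : ∀ a, AEMeasurable (fun w => (E a).indicator (1 : Ω → ℝ≥0∞) (S a w) * F w) ρ :=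
    fun a => (((measurable_one.indicator (hE a)).comp (hS a)).mul hF).aemeasurable
  rw [← lintegral_tsum hm]
  exact lintegral_congr fun w => ENNReal.tsum_mul_right

variable {Z : Type*} [MeasurableSpace Z] (G : Type*) [Group G] [MulAction G Z]

/-- The number of points of the `G`-orbit of `z` which lie in `E` and are mapped to `z` by `f`
(if the stabilizer of `z` is trivial). -/
noncomputable def multiplicity (E : Set Z) (f : Z → Z) (z : Z) : ℕ∞ :=
  {a : G | a • z ∈ E ∧ f (a • z) = z}.encard

variable {G} [Countable G] [MeasurableSpace G]
  [DiscreteMeasurableSpace G] [MeasurableConstSMul G Z] {m : Measure Z} [SFinite m]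
  [SMulInvariantMeasure G Z m] [MeasurableEq Z]

theorem measurableSet_canonical {E : Set Z} {f : Z → Z} (hE : MeasurableSet E)
    (hf : Measurable f) (a : G) : MeasurableSet {z | z ∈ E ∧ f z = a⁻¹ • z} :=
  hE.inter (measurableSet_eq_fun hf (measurable_const_smul a⁻¹))

/-- A partially defined map with graph in the orbit relation is given by a measurable cocycle. -/
theorem exists_cocycle {E : Set Z} {f : Z → Z} (hE : MeasurableSet E) (hf : Measurable f)
    (hfree : ∀ᵐ z ∂m, ∀ a : G, a • z = z → a = 1)
    (ho : ∀ᵐ z ∂m, z ∈ E → ∃ a : G, f z = a • z) :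
    ∃ c : Z → G, Measurable c ∧ ∀ᵐ z ∂m, z ∈ E → ∀ a : G, f z = a⁻¹ • z ↔ c z = a := by
  obtain ⟨c, hc, h⟩ := exists_measurable_select (measurableSet_canonical (G := G) hE hf)
  refine ⟨c, hc, ?_⟩
  filter_upwards [hfree, ho] with z h1 h2 hz
  obtain ⟨b, hb⟩ := h2 hz
  have hcz : f z = (c z)⁻¹ • z := (h z b⁻¹ ⟨hz, by rw [inv_inv, hb]⟩).2
  refine fun a => ⟨fun ha => ?_, fun ha => ha ▸ hcz⟩
  have : c z * a⁻¹ = 1 := h1 _ (by rw [mul_smul, ← ha, hcz, smul_inv_smul])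
  rwa [mul_inv_eq_one] at this

/-- Turns the fibre count into a sum over `G` of indicators of the pieces on which the cocycle is
constant, the form that comes out of the change of variables. -/
theorem multiplicity_eq_tsum {E : Set Z} {f : Z → Z} {c : Z → G} {z : Z}
    (h : ∀ b : G, b • z ∈ E → ∀ a : G, f (b • z) = a⁻¹ • b • z ↔ c (b • z) = a) :
    (multiplicity G E f z : ℝ≥0∞)
      = ∑' a : G, {z | z ∈ E ∧ c z = a}.indicator (1 : Z → ℝ≥0∞) (a • z) := by
  rw [multiplicity, ← ENNReal.tsum_set_one,
    tsum_subtype {a : G | a • z ∈ E ∧ f (a • z) = z} fun _ => (1 : ℝ≥0∞)]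
  refine tsum_congr fun a => ?_
  have : a ∈ {a : G | a • z ∈ E ∧ f (a • z) = z} ↔ a • z ∈ {z | z ∈ E ∧ c z = a} := by
    refine and_congr_right fun ha => ?_
    rw [← h a ha a, inv_smul_smul]
  by_cases ha : a ∈ {a : G | a • z ∈ E ∧ f (a • z) = z}
  · rw [indicator_of_mem ha, indicator_of_mem (this.1 ha)]; rfl
  · rw [indicator_of_notMem ha, indicator_of_notMem fun h => ha (this.2 h)]

/-- On the piece of `E` where the cocycle is `a`, the map `f` is the measure preserving `z ↦ a⁻¹ z`;
a point `z` collects one contribution from every piece containing a preimage of it. -/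
theorem setLIntegral_comp_eq {E : Set Z} {f : Z → Z} (hE : MeasurableSet E) (hf : Measurable f)
    (hfree : ∀ᵐ z ∂m, ∀ a : G, a • z = z → a = 1)
    (ho : ∀ᵐ z ∂m, z ∈ E → ∃ a : G, f z = a • z) {F : Z → ℝ≥0∞} (hF : Measurable F) :
    ∫⁻ z in E, F (f z) ∂m = ∫⁻ z, (multiplicity G E f z : ℝ≥0∞) * F z ∂m := by
  obtain ⟨c, hc, h⟩ := exists_cocycle hE hf hfree ho
  have hEa : ∀ a, MeasurableSet {z | z ∈ E ∧ c z = a} := fun a =>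
    hE.inter (hc (measurableSet_singleton a))
  have hU : E = ⋃ a, {z | z ∈ E ∧ c z = a} := by ext z; simp
  have hd : Pairwise (Function.onFun Disjoint fun a => {z | z ∈ E ∧ c z = a}) := by
    intro a b hab
    refine disjoint_left.2 fun z hz hz' => hab (hz.2.symm.trans hz'.2)
  have h1 : ∫⁻ z in E, F (f z) ∂m
      = ∑' a : G, ∫⁻ z in {z | z ∈ E ∧ c z = a}, F (a⁻¹ • z) ∂m := by
    conv_lhs => rw [hU]
    rw [lintegral_iUnion hEa hd]
    refine tsum_congr fun a => setLIntegral_congr_fun_ae (hEa a) ?_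
    filter_upwards [h] with z hz hza
    rw [(hz hza.1 a).2 hza.2]
  rw [h1, tsum_setLIntegral_comp (T := fun a z => a⁻¹ • z) (S := fun a z => a • z)
    (fun a => measurePreserving_smul a⁻¹ m) (fun a => measurable_const_smul a)
    (fun a w => smul_inv_smul a w) hEa hF]
  refine lintegral_congr_ae ?_
  filter_upwards [ae_all_smul G h] with z hz
  rw [multiplicity_eq_tsum hz]

theorem enorm_sq_eq_lintegral {α : Type*} [MeasurableSpace α] {ρ : Measure α} (ξ : Lp ℂ 2 ρ) :
    ‖ξ‖ₑ ^ 2 = ∫⁻ w, ‖ξ w‖ₑ ^ 2 ∂ρ := by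
  rw [Lp.enorm_def, eLpNorm_eq_lintegral_rpow_enorm_toReal (by norm_num) (by norm_num),
    ← ENNReal.rpow_natCast, ← ENNReal.rpow_mul]
  simp

/-- The change of variables along the lift of `z ↦ (c z)⁻¹ z` to `Z × G`. -/
theorem lintegral_cocycle_comp {E : Set Z} {f : Z → Z} (hE : MeasurableSet E)
    {c : Z → G} (hc : Measurable c)
    (h : ∀ᵐ z ∂m, z ∈ E → ∀ a : G, f z = a⁻¹ • z ↔ c z = a)
    {F : Z × G → ℝ≥0∞} (hF : Measurable F) :
    ∫⁻ w, (E.indicator 1 w.1) * F ((c w.1)⁻¹ • w.1, (c w.1)⁻¹ * w.2)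
        ∂m.prod (Measure.count : Measure G)
      = ∫⁻ w, (multiplicity G E f w.1 : ℝ≥0∞) * F w ∂m.prod (Measure.count : Measure G) := by
  set ρ := m.prod (Measure.count : Measure G)
  have hEa : ∀ a, MeasurableSet {w : Z × G | w.1 ∈ E ∧ c w.1 = a} := fun a =>
    measurable_fst (hE.inter (hc (measurableSet_singleton a)))
  have hU : Prod.fst ⁻¹' E = ⋃ a, {w : Z × G | w.1 ∈ E ∧ c w.1 = a} := by ext z; simp
  have hd : Pairwise (Function.onFun Disjoint fun a => {w : Z × G | w.1 ∈ E ∧ c w.1 = a}) := by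
    intro a b hab
    refine disjoint_left.2 fun z hz hz' => hab (hz.2.symm.trans hz'.2)
  have h1 : ∫⁻ w, (E.indicator 1 w.1) * F ((c w.1)⁻¹ • w.1, (c w.1)⁻¹ * w.2) ∂ρ
      = ∑' a : G, ∫⁻ w in {w : Z × G | w.1 ∈ E ∧ c w.1 = a}, F (a⁻¹ • w.1, a⁻¹ * w.2) ∂ρ := by
    calc _ = ∫⁻ w in Prod.fst ⁻¹' E, F ((c w.1)⁻¹ • w.1, (c w.1)⁻¹ * w.2) ∂ρ := by
            rw [← lintegral_indicator (measurable_fst hE)]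
            refine lintegral_congr fun w => ?_
            by_cases hw : w.1 ∈ E
            · rw [indicator_of_mem hw, indicator_of_mem (by exact hw)]; simp
            · rw [indicator_of_notMem hw, indicator_of_notMem (by exact hw), zero_mul]
      _ = _ := by
            rw [hU, lintegral_iUnion hEa hd]
            refine tsum_congr fun a => setLIntegral_congr_fun (hEa a) fun w hw => ?_
            rw [← hw.2]
  rw [h1, tsum_setLIntegral_comp (T := fun a w => (a⁻¹ • w.1, a⁻¹ * w.2))
    (S := fun a w => (a • w.1, a * w.2)) (fun a => measurePreserving_diag m a)
    (fun a => ((measurable_const_smul a).comp measurable_fst).prodMk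
      ((Measurable.of_discrete (f := fun k : G => a * k)).comp measurable_snd))
    (fun a w => by simp) hEa hF]
  refine lintegral_congr_ae ?_
  filter_upwards [ae_fst (ae_all_smul G h)] with w hw
  rw [multiplicity_eq_tsum hw]
  rfl

/-- The mass of `ξ` over `z` is counted once for each point of the fibre over `z`. This is where
fibre counts enter the computation of `T^* T`. -/
theorem Implements.enorm_sq {T : Op G m} {E : Set Z} {f : Z → Z} (hT : Implements T E f)
    (hE : MeasurableSet E) (hf : Measurable f) (hfree : ∀ᵐ z ∂m, ∀ a : G, a • z = z → a = 1)
    (ho : ∀ᵐ z ∂m, z ∈ E → ∃ a : G, f z = a • z) (ξ : L2 G m) :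
    ‖T ξ‖ₑ ^ 2 = ∫⁻ w, (multiplicity G E f w.1 : ℝ≥0∞) * ‖ξ w‖ₑ ^ 2
      ∂m.prod (Measure.count : Measure G) := by
  obtain ⟨c, hc, h⟩ := exists_cocycle hE hf hfree ho
  rw [enorm_sq_eq_lintegral, ← lintegral_cocycle_comp hE hc h
    (F := fun w => ‖ξ w‖ₑ ^ 2) ((Lp.stronglyMeasurable ξ).measurable.enorm.pow_const 2)]
  refine lintegral_congr_ae ?_
  filter_upwards [hT ξ, ae_fst h] with w h1 h2
  by_cases hw : w.1 ∈ E
  · rw [h1.2 hw (c w.1) ((h2 hw _).2 rfl), indicator_of_mem hw]; simp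
  · rw [h1.1 hw, indicator_of_notMem hw]; simp

theorem star_mulOp {a : Z → ℂ} (ha : MemLp a ⊤ m) :
    star (mulOp G m a) = mulOp G m fun z => conj (a z) := by
  symm
  rw [ContinuousLinearMap.star_eq_adjoint, ContinuousLinearMap.eq_adjoint_iff]
  intro ξ η
  have ha' : MemLp (fun z => conj (a z)) ⊤ m := ha.star
  rw [L2.inner_def, L2.inner_def]
  refine integral_congr_ae ?_
  filter_upwards [mulOp_ae ha η, mulOp_ae ha' ξ] with w h1 h2
  rw [h1, h2]
  simp only [RCLike.inner_apply, map_mul, RingHomCompTriple.comp_apply, RingHom.id_apply]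
  ring

theorem star_proj {D : Set Z} (hD : MeasurableSet D) : star (proj G m D) = proj G m D := by
  rw [proj, star_mulOp (memLp_indicator_one hD)]
  congr 1
  funext z
  by_cases hz : z ∈ D <;> simp [hz]

theorem proj_enorm_sq {D : Set Z} (hD : MeasurableSet D) (ξ : L2 G m) :
    ‖proj G m D ξ‖ₑ ^ 2 = ∫⁻ w, D.indicator 1 w.1 * ‖ξ w‖ₑ ^ 2
      ∂m.prod (Measure.count : Measure G) := by
  rw [enorm_sq_eq_lintegral]
  refine lintegral_congr_ae ?_
  filter_upwards [proj_ae hD ξ] with w hw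
  rw [hw]
  by_cases h : w.1 ∈ D <;> simp [h]

/-- If the fibres of `f` over almost every point of `W` have `n` elements, the other ones being
empty, then the operator `T` implementing `f` satisfies `T^* T = n χ_W`. -/
theorem Implements.star_mul_self {T : Op G m} {E W : Set Z} {f : Z → Z} (hT : Implements T E f)
    (hE : MeasurableSet E) (hf : Measurable f) (hfree : ∀ᵐ z ∂m, ∀ a : G, a • z = z → a = 1)
    (ho : ∀ᵐ z ∂m, z ∈ E → ∃ a : G, f z = a • z) (hW : MeasurableSet W) {n : ℕ}
    (hn : ∀ᵐ z ∂m, multiplicity G E f z = W.indicator (fun _ => (n : ℕ∞)) z) :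
    star T * T = (n : ℂ) • proj G m W := by
  have hnorm : ∀ ξ : L2 G m, ‖T ξ‖ ^ 2 = n * ‖proj G m W ξ‖ ^ 2 := by
    intro ξ
    have h : ‖T ξ‖ₑ ^ 2 = n * ‖proj G m W ξ‖ₑ ^ 2 := by
      rw [hT.enorm_sq hE hf hfree ho, proj_enorm_sq hW, ← lintegral_const_mul' _ _ (by simp)]
      refine lintegral_congr_ae ?_
      filter_upwards [ae_fst hn] with w hw
      rw [hw, ← mul_assoc]
      congr 1
      by_cases hwW : w.1 ∈ W <;> simp [hwW]
    have := congrArg ENNReal.toReal h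
    simpa using this
  -- Over `ℂ` an operator is determined by its quadratic form, so the norm identity is enough.
  refine ContinuousLinearMap.coe_injective ((ext_inner_map _ _).1 fun ξ => ?_)
  simp only [ContinuousLinearMap.coe_coe]
  have h1 : inner ℂ ((star T * T) ξ) ξ = ((‖T ξ‖ ^ 2 : ℝ) : ℂ) := by
    rw [mul_apply_eq_comp, ContinuousLinearMap.star_eq_adjoint,
      ContinuousLinearMap.adjoint_inner_left, inner_self_eq_norm_sq_to_K]
    push_cast; rfl
  have h2 : inner ℂ (proj G m W ξ) ξ = ((‖proj G m W ξ‖ ^ 2 : ℝ) : ℂ) := by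
    have h3 : proj G m W = star (proj G m W) * proj G m W := by
      rw [star_proj hW, (proj_mul_proj hW hW subset_rfl).1]
    conv_lhs => rw [h3]
    rw [mul_apply_eq_comp, ContinuousLinearMap.star_eq_adjoint,
      ContinuousLinearMap.adjoint_inner_left, inner_self_eq_norm_sq_to_K]
    push_cast; rfl
  rw [h1, hnorm, smul_apply, inner_smul_left, h2]
  simp

/-- A partially defined map with graph in the orbit relation and bounded fibres is implemented by a
bounded operator, which is canonical for it. -/
theorem exists_implements {E : Set Z} {f : Z → Z} (hE : MeasurableSet E) (hf : Measurable f)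
    (hfree : ∀ᵐ z ∂m, ∀ a : G, a • z = z → a = 1)
    (ho : ∀ᵐ z ∂m, z ∈ E → ∃ a : G, f z = a • z) {n : ℕ}
    (hn : ∀ᵐ z ∂m, multiplicity G E f z ≤ n) :
    ∃ T : Op G m, Implements T E f := by
  classical
  obtain ⟨c, hc, h⟩ := exists_cocycle hE hf hfree ho
  set ρ := m.prod (Measure.count : Measure G)
  -- The lift of `f` moves the `G`-coordinate by the same group element as the point, so it is
  -- piecewise the measure preserving diagonal translation.
  let S : Z × G → Z × G := fun w => ((c w.1)⁻¹ • w.1, (c w.1)⁻¹ * w.2)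
  have hS : Measurable S :=
    measurable_select_apply (F := fun (a : G) (w : Z × G) => (a⁻¹ • w.1, a⁻¹ * w.2))
      (fun a => (measurePreserving_diag m a).measurable) (hc.comp measurable_fst)
  let Fn : L2 G m → Z × G → ℂ := fun ξ w => (Prod.fst ⁻¹' E).indicator (fun w => ξ (S w)) w
  have hFn : ∀ ξ, Measurable (Fn ξ) := fun ξ =>
    ((Lp.stronglyMeasurable ξ).measurable.comp hS).indicator (measurable_fst hE)
  have hnorm : ∀ ξ, ∫⁻ w, ‖Fn ξ w‖ₑ ^ 2 ∂ρ ≤ n * ‖ξ‖ₑ ^ 2 := by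
    intro ξ
    have h1 : ∫⁻ w, ‖Fn ξ w‖ₑ ^ 2 ∂ρ
        = ∫⁻ w, (E.indicator 1 w.1) * (fun w => ‖ξ w‖ₑ ^ 2) (S w) ∂ρ := by
      refine lintegral_congr fun w => ?_
      by_cases hw : w.1 ∈ E
      · have : w ∈ Prod.fst ⁻¹' E := hw
        simp [Fn, hw]
      · have : w ∉ Prod.fst ⁻¹' E := hw
        simp [Fn, hw]
    rw [h1, lintegral_cocycle_comp hE hc h
      (F := fun w => ‖ξ w‖ₑ ^ 2) ((Lp.stronglyMeasurable ξ).measurable.enorm.pow_const 2),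
      enorm_sq_eq_lintegral, ← lintegral_const_mul' _ _ (by simp)]
    refine lintegral_mono_ae ?_
    filter_upwards [ae_fst hn] with w hw
    gcongr
    exact_mod_cast hw
  have hmem : ∀ ξ, MemLp (Fn ξ) 2 ρ := by
    intro ξ
    refine ⟨(hFn ξ).aestronglyMeasurable, ?_⟩
    rw [eLpNorm_lt_top_iff_lintegral_rpow_enorm_lt_top (by norm_num) (by norm_num)]
    simp only [ENNReal.toReal_ofNat, ENNReal.rpow_ofNat]
    exact (hnorm ξ).trans_lt (ENNReal.mul_lt_top (by simp) (by simp))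
  let L : L2 G m →ₗ[ℂ] L2 G m :=
    { toFun := fun ξ => (hmem ξ).toLp _
      map_add' := fun ξ η => by
        rw [← MemLp.toLp_add]
        refine MemLp.toLp_congr _ _ ?_
        filter_upwards [ae_diag (Lp.coeFn_add ξ η)] with w hw
        by_cases h : w ∈ Prod.fst ⁻¹' E
        · simpa [Fn, indicator_of_mem h, S] using hw (c w.1)
        · simp [Fn, indicator_of_notMem h]
      map_smul' := fun r ξ => by
        rw [← MemLp.toLp_const_smul]
        refine MemLp.toLp_congr _ _ ?_
        filter_upwards [ae_diag (Lp.coeFn_smul r ξ)] with w hw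
        by_cases h : w ∈ Prod.fst ⁻¹' E
        · simpa [Fn, indicator_of_mem h, S] using hw (c w.1)
        · simp [Fn, indicator_of_notMem h] }
  have hL : ∀ ξ, ‖L ξ‖ ≤ Real.sqrt n * ‖ξ‖ := by
    intro ξ
    have h1 : ‖L ξ‖ₑ ^ 2 ≤ n * ‖ξ‖ₑ ^ 2 := by
      rw [enorm_sq_eq_lintegral]
      refine le_trans (le_of_eq (lintegral_congr_ae ?_)) (hnorm ξ)
      filter_upwards [(hmem ξ).coeFn_toLp] with w hw
      rw [← hw]; rfl
    have h2 : ‖L ξ‖ ^ 2 ≤ n * ‖ξ‖ ^ 2 := by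
      have := ENNReal.toReal_mono (ENNReal.mul_ne_top (by simp) (by simp)) h1
      simpa using this
    refine le_of_sq_le_sq ?_ (by positivity)
    rw [mul_pow, Real.sq_sqrt (by positivity)]
    exact h2
  refine ⟨L.mkContinuous _ hL, fun ξ => ?_⟩
  have hL' : L.mkContinuous _ hL ξ = (hmem ξ).toLp _ := rfl
  rw [hL']
  filter_upwards [(hmem ξ).coeFn_toLp, ae_fst h] with w h1 h2
  rw [h1]
  refine ⟨fun hw => indicator_of_notMem (by exact hw) _, fun hw a ha => ?_⟩
  have : c w.1 = a := (h2 hw a).1 ha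
  simp only [Fn]
  rw [indicator_of_mem (by exact hw)]
  simp only [S, this]

/-- Where `f` coincides with translation by `a⁻¹`, composition with `f` is the canonical unitary of
`a`; these are the coefficients of `T` in the crossed product. -/
theorem Implements.proj_mul_eq {T : Op G m} {E : Set Z} {f : Z → Z} (hT : Implements T E f)
    (hE : MeasurableSet E) (hf : Measurable f) (a : G) :
    proj G m {z | z ∈ E ∧ f z = a⁻¹ • z} * T
      = proj G m {z | z ∈ E ∧ f z = a⁻¹ • z} * canU m a := by
  refine op_ext fun ξ => ?_
  have hm := measurableSet_canonical hE hf a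
  filter_upwards [proj_ae hm (T ξ), proj_mul_canU_ae hm a ξ, hT ξ] with w h1 h2 h3
  rw [mul_apply_eq_comp, h1, h2]
  by_cases hw : w.1 ∈ {z | z ∈ E ∧ f z = a⁻¹ • z}
  · rw [h3.2 hw.1 a hw.2]
  · rw [indicator_of_notMem hw, zero_mul, zero_mul]

theorem StrongHasSum.mul_right {ι H : Type*} [NormedAddCommGroup H] [NormedSpace ℂ H]
    {f : ι → H →L[ℂ] H} {T : H →L[ℂ] H} (h : StrongHasSum f T) (S : H →L[ℂ] H) :
    StrongHasSum (fun i => f i * S) (T * S) := fun ξ => h (S ξ)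

/-- Over a partition of `E`, up to a null set. -/
theorem strongHasSum_proj_of_ae {ι : Type*} [Countable ι] {D : ι → Set Z} {E : Set Z}
    (hD : ∀ i, MeasurableSet (D i))
    (h : ∀ᵐ z ∂m, z ∈ E ↔ ∃ i, z ∈ D i)
    (hd : ∀ᵐ z ∂m, ∀ i j, z ∈ D i → z ∈ D j → i = j) :
    StrongHasSum (fun i => proj G m (D i)) (proj G m E) := by
  -- Removing the null overlaps makes the sets honestly disjoint without changing the projections.
  let D' : ι → Set Z := fun i => D i \ ⋃ j ∈ {j | j ≠ i}, D j
  have hD' : ∀ i, MeasurableSet (D' i) := fun i =>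
    (hD i).diff (MeasurableSet.biUnion (to_countable _) fun j _ => hD j)
  have hdisj : Pairwise (Function.onFun Disjoint D') := fun i j hij =>
    disjoint_left.2 fun z hz hz' => hz.2 (mem_biUnion (x := j) hij.symm hz'.1)
  have h1 : ∀ i, proj G m (D' i) = proj G m (D i) := fun i => proj_congr <| by
    filter_upwards [hd] with z hz
    refine ⟨fun h => h.1, fun h => ⟨h, fun h' => ?_⟩⟩
    obtain ⟨j, hj, hj'⟩ := mem_iUnion₂.1 h'
    exact hj (hz _ _ hj' h)
  have h2 : proj G m (⋃ i, D' i) = proj G m E := proj_congr <| by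
    filter_upwards [h, hd] with z hz hz'
    rw [hz]
    constructor
    · intro h
      obtain ⟨i, hi⟩ := mem_iUnion.1 h
      exact ⟨i, hi.1⟩
    · rintro ⟨i, hi⟩
      refine mem_iUnion.2 ⟨i, hi, fun h' => ?_⟩
      obtain ⟨j, hj, hj'⟩ := mem_iUnion₂.1 h'
      exact hj (hz' _ _ hj' hi)
  have := strongHasSum_proj (G := G) (m := m) hD' hdisj
  simpa only [h1, h2] using this

/-- The pieces on which `f` is a fixed translation partition `E`; multiply the resulting resolution
of `χ_E` by `T` on the right. -/
theorem Implements.strongHasSum {T : Op G m} {E : Set Z} {f : Z → Z} (hT : Implements T E f)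
    (hE : MeasurableSet E) (hf : Measurable f) (hfree : ∀ᵐ z ∂m, ∀ a : G, a • z = z → a = 1)
    (ho : ∀ᵐ z ∂m, z ∈ E → ∃ a : G, f z = a • z) :
    StrongHasSum (fun a : G => proj G m {z | z ∈ E ∧ f z = a⁻¹ • z} * canU m a) T := by
  have h : StrongHasSum (fun a : G => proj G m {z | z ∈ E ∧ f z = a⁻¹ • z}) (proj G m E) := by
    refine strongHasSum_proj_of_ae (measurableSet_canonical hE hf) ?_ ?_
    · filter_upwards [ho] with z hz
      refine ⟨fun h => ?_, fun ⟨a, ha⟩ => ha.1⟩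
      obtain ⟨a, ha⟩ := hz h
      exact ⟨a⁻¹, h, by rw [inv_inv, ha]⟩
    · filter_upwards [hfree] with z hz a b ha hb
      have : b * a⁻¹ = 1 := hz _ (by rw [mul_smul, ← ha.2, hb.2, smul_inv_smul])
      rw [mul_inv_eq_one] at this
      exact this.symm
  have h' := h.mul_right T
  simp only [hT.proj_mul_eq hE hf, hT.proj_mul hE subset_rfl] at h'
  exact h'

theorem Implements.isCanonicalFor {T : Op G m} {E : Set Z} {f : Z → Z} (hT : Implements T E f)
    (hE : MeasurableSet E) (hf : Measurable f) (hfree : ∀ᵐ z ∂m, ∀ a : G, a • z = z → a = 1)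
    (ho : ∀ᵐ z ∂m, z ∈ E → ∃ a : G, f z = a • z) {r : Z → Z → Prop}
    (hr : ∀ᵐ z ∂m, ∀ a : G, r z (a • z) ↔ z ∈ E ∧ f z = a • z) :
    IsCanonicalFor (G := G) m r T := by
  have h := hT.strongHasSum hE hf hfree ho
  have h1 : ∀ a : G, proj G m {z | r z (a⁻¹ • z)} = proj G m {z | z ∈ E ∧ f z = a⁻¹ • z} :=
    fun a => proj_congr <| by
      filter_upwards [hr] with z hz
      exact hz a⁻¹
  rw [IsCanonicalFor]
  simp only [h1]
  exact h

end Counting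

/-! ### Membership in the crossed product -/

section Membership

variable {Z : Type*} [MeasurableSpace Z] {G : Type*} [Group G] [Countable G] [MeasurableSpace G]
  [DiscreteMeasurableSpace G] [MulAction G Z] [MeasurableConstSMul G Z] {m : Measure Z} [SFinite m]
  [SMulInvariantMeasure G Z m]

/-- The generators form a self-adjoint set, hence so does their commutant, and the star-centralizer
reduces to the plain double commutant. -/
theorem mem_crossedProduct_iff {T : Op G m} : T ∈ crossedProduct G m ↔
    ∀ S ∈ Set.centralizer (generators G m), S * T = T * S := by
  have hS : star (generators G m) = generators G m := by
    simp only [generators, Set.union_star, star_star]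
    rw [Set.union_comm]
  have hstar : star (Set.centralizer (generators G m)) = Set.centralizer (generators G m) := by
    rw [Set.star_centralizer, hS]
  have hc := StarSubalgebra.coe_centralizer ℂ (Set.centralizer (generators G m))
  rw [hstar, Set.union_self] at hc
  have : T ∈ crossedProduct G m ↔
    T ∈ (StarSubalgebra.centralizer ℂ (Set.centralizer (generators G m)) : Set (Op G m)) := Iff.rfl
  rw [this, hc]
  rfl

theorem generator_mem_crossedProduct {T : Op G m} (h : T ∈ generators G m) :
    T ∈ crossedProduct G m :=
  mem_crossedProduct_iff.2 fun _ hS => (hS T h).symm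

theorem mulOp_mem_crossedProduct {a : Z → ℂ} (ha : MemLp a ⊤ m) :
    mulOp G m a ∈ crossedProduct G m :=
  generator_mem_crossedProduct (Or.inl (Or.inl ⟨a, ha, fun _ hz => absurd trivial hz, rfl⟩))

theorem canU_mem_crossedProduct (g : G) : canU m g ∈ crossedProduct G m :=
  generator_mem_crossedProduct (Or.inl (Or.inr ⟨g, rfl⟩))

/-- A double commutant is strongly closed: commuting with a fixed bounded operator passes to strong
sums. -/
theorem StrongHasSum.mem_crossedProduct {ι : Type*} {f : ι → Op G m} {T : Op G m}
    (h : StrongHasSum f T) (hf : ∀ i, f i ∈ crossedProduct G m) : T ∈ crossedProduct G m := by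
  refine mem_crossedProduct_iff.2 fun S hS => ContinuousLinearMap.ext fun ξ => ?_
  have h1 : HasSum (fun i => S (f i ξ)) (S (T ξ)) := (h ξ).mapL S
  have h2 : HasSum (fun i => f i (S ξ)) (T (S ξ)) := h (S ξ)
  have h3 : (fun i => S (f i ξ)) = fun i => f i (S ξ) := by
    funext i
    exact congrArg (fun A : Op G m => A ξ) (mem_crossedProduct_iff.1 (hf i) S hS)
  rw [h3] at h1
  exact h1.unique h2

theorem Implements.mem_crossedProduct [MeasurableEq Z] {T : Op G m} {E : Set Z} {f : Z → Z}
    (hT : Implements T E f) (hE : MeasurableSet E) (hf : Measurable f)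
    (hfree : ∀ᵐ z ∂m, ∀ a : G, a • z = z → a = 1)
    (ho : ∀ᵐ z ∂m, z ∈ E → ∃ a : G, f z = a • z) : T ∈ crossedProduct G m :=
  (hT.strongHasSum hE hf hfree ho).mem_crossedProduct fun a =>
    mul_mem (mulOp_mem_crossedProduct (memLp_indicator_one (measurableSet_canonical hE hf a)))
      (canU_mem_crossedProduct a)

end Membership

/-! ### Actions by partially defined maps with graph in the orbit relation -/

section PartialActions

variable {Z : Type*} [MeasurableSpace Z]

/-- `Z₀` is a conull `G`-invariant set on which `G` acts freely. -/
structure IsGoodSet (G : Type*) [Group G] [MulAction G Z] (m : Measure Z) (Z₀ : Set Z) :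
    Prop where
  ae : ∀ᵐ z ∂m, z ∈ Z₀
  smul_mem : ∀ (g : G), ∀ z ∈ Z₀, g • z ∈ Z₀
  free : ∀ z ∈ Z₀, ∀ g : G, g • z = z → g = 1

/-- The maps `s h` restrict to a free action of `H` on `Z₀ ∩ D`, with orbits contained in those of
`G`. -/
structure IsPartialAction (G : Type*) [Group G] [MulAction G Z] (Z₀ : Set Z) {H : Type*} [Group H]
    (D : Set Z) (s : H → Z → Z) : Prop where
  measurable : ∀ h, Measurable (s h)
  measurableSet : MeasurableSet D
  mem : ∀ h, ∀ z ∈ Z₀, z ∈ D → s h z ∈ D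
  orbit : ∀ h, ∀ z ∈ Z₀, z ∈ D → ∃ a : G, s h z = a • z
  one : ∀ z ∈ Z₀, z ∈ D → s 1 z = z
  mul : ∀ h k, ∀ z ∈ Z₀, z ∈ D → s (h * k) z = s h (s k z)
  free : ∀ h, ∀ z ∈ Z₀, z ∈ D → s h z = z → h = 1

variable {G : Type*} [Group G] [MulAction G Z] {m : Measure Z} {Z₀ : Set Z}

theorem IsGoodSet.ae_free (hZ : IsGoodSet G m Z₀) : ∀ᵐ z ∂m, ∀ a : G, a • z = z → a = 1 := by
  filter_upwards [hZ.ae] with z hz using hZ.free z hz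

theorem IsGoodSet.smul_left_cancel (hZ : IsGoodSet G m Z₀) {z : Z} (hz : z ∈ Z₀) {a b : G}
    (h : a • z = b • z) : a = b := by
  have : b⁻¹ * a = 1 := hZ.free z hz _ (by rw [mul_smul, h, inv_smul_smul])
  rw [inv_mul_eq_one] at this
  exact this.symm

/-- On a free orbit `a ↦ a • z` is injective, so counting group elements is counting points. -/
theorem IsGoodSet.multiplicity_eq (hZ : IsGoodSet G m Z₀) {E : Set Z} {f : Z → Z} {z : Z}
    (hz : z ∈ Z₀) :
    multiplicity G E f z = {x | x ∈ MulAction.orbit G z ∧ x ∈ E ∧ f x = z}.encard := by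
  have : {x | x ∈ MulAction.orbit G z ∧ x ∈ E ∧ f x = z}
      = (fun a : G => a • z) '' {a : G | a • z ∈ E ∧ f (a • z) = z} := by
    ext x
    constructor
    · rintro ⟨⟨a, rfl⟩, h1, h2⟩
      exact ⟨a, ⟨h1, h2⟩, rfl⟩
    · rintro ⟨a, ⟨h1, h2⟩, rfl⟩
      exact ⟨⟨a, rfl⟩, h1, h2⟩
  rw [this, InjOn.encard_image fun a _ b _ h => hZ.smul_left_cancel hz h]
  rfl

section

variable {H : Type*} [Group H] {D : Set Z} {s : H → Z → Z}

theorem IsPartialAction.mem_good (hs : IsPartialAction G Z₀ D s) (hZ : IsGoodSet G m Z₀) (h : H)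
    {z : Z} (hz : z ∈ Z₀) (hD : z ∈ D) : s h z ∈ Z₀ := by
  obtain ⟨a, ha⟩ := hs.orbit h z hz hD
  exact ha ▸ hZ.smul_mem a z hz

theorem IsPartialAction.inv_apply (hs : IsPartialAction G Z₀ D s) (h : H)
    {z : Z} (hz : z ∈ Z₀) (hD : z ∈ D) : s h⁻¹ (s h z) = z := by
  rw [← hs.mul _ _ z hz hD, inv_mul_cancel, hs.one z hz hD]

theorem IsPartialAction.apply_inv (hs : IsPartialAction G Z₀ D s) (h : H)
    {z : Z} (hz : z ∈ Z₀) (hD : z ∈ D) : s h (s h⁻¹ z) = z := by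
  rw [← hs.mul _ _ z hz hD, mul_inv_cancel, hs.one z hz hD]

theorem IsPartialAction.cancel (hs : IsPartialAction G Z₀ D s) {h k : H}
    {z : Z} (hz : z ∈ Z₀) (hD : z ∈ D) (hk : s h z = s k z) : h = k := by
  have : k⁻¹ * h = 1 := hs.free _ z hz hD (by
    rw [hs.mul _ _ z hz hD, hk, hs.inv_apply k hz hD])
  rw [inv_mul_eq_one] at this
  exact this.symm

theorem IsPartialAction.ae_orbit (hs : IsPartialAction G Z₀ D s) (hZ : IsGoodSet G m Z₀) (h : H) :
    ∀ᵐ z ∂m, z ∈ D → ∃ a : G, s h z = a • z := by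
  filter_upwards [hZ.ae] with z hz hD using hs.orbit h z hz hD

theorem IsPartialAction.multiplicity_eq (hs : IsPartialAction G Z₀ D s) (hZ : IsGoodSet G m Z₀)
    (h : H) {z : Z} (hz : z ∈ Z₀) :
    multiplicity G D (s h) z = D.indicator (fun _ => ((1 : ℕ) : ℕ∞)) z := by
  rw [hZ.multiplicity_eq hz]
  by_cases hD : z ∈ D
  · rw [indicator_of_mem hD, Nat.cast_one, encard_eq_one]
    refine ⟨s h⁻¹ z, ?_⟩
    ext x
    constructor
    · rintro ⟨⟨a, rfl⟩, h1, h2⟩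
      have := hs.inv_apply h (hZ.smul_mem a z hz) h1
      simp only at h2 this
      rw [h2] at this
      exact this.symm
    · rintro rfl
      refine ⟨?_, hs.mem _ z hz hD, hs.apply_inv h hz hD⟩
      obtain ⟨a, ha⟩ := hs.orbit h⁻¹ z hz hD
      exact ⟨a, ha.symm⟩
  · rw [indicator_of_notMem hD, encard_eq_zero]
    ext x
    simp only [mem_ofPred_eq, mem_empty_iff_false, iff_false, not_and]
    rintro ⟨a, rfl⟩ h1 h2
    exact hD (h2 ▸ hs.mem h _ (hZ.smul_mem a z hz) h1)

theorem IsPartialAction.mono (hs : IsPartialAction G Z₀ D s) {Z₁ : Set Z} (h : Z₁ ⊆ Z₀) :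
    IsPartialAction G Z₁ D s where
  measurable := hs.measurable
  measurableSet := hs.measurableSet
  mem k z hz := hs.mem k z (h hz)
  orbit k z hz := hs.orbit k z (h hz)
  one z hz := hs.one z (h hz)
  mul k l z hz := hs.mul k l z (h hz)
  free k z hz := hs.free k z (h hz)

end

theorem isPartialAction_smul [MeasurableSpace G] [MeasurableConstSMul G Z]
    (hZ : IsGoodSet G m Z₀) : IsPartialAction G Z₀ univ (fun (g : G) (z : Z) => g • z) where
  measurable h := measurable_const_smul h
  measurableSet := MeasurableSet.univ
  mem _ _ _ _ := trivial
  orbit h _ _ _ := ⟨h, rfl⟩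
  one z _ _ := one_smul G z
  mul h k z _ _ := mul_smul h k z
  free h z hz _ := hZ.free z hz h

variable [Countable G] [MeasurableSpace G] [DiscreteMeasurableSpace G]
  [MeasurableConstSMul G Z] [SFinite m] [SMulInvariantMeasure G Z m] [MeasurableEq Z]

variable (G) in
-- The preimage of a null set under `f` lies in its `G`-saturation, which is null because `G` is
-- countable. So composition with `f` respects a.e. classes and essential bounds, although `f` need
-- not be injective.
theorem memLp_top_comp {E : Set Z} {f : Z → Z} (hE : MeasurableSet E) (hf : Measurable f)
    (ho : ∀ᵐ z ∂m, z ∈ E → ∃ a : G, f z = a • z) {a : Z → ℂ} (ha : MemLp a ⊤ m) :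
    MemLp (E.indicator fun z => a (f z)) ⊤ m := by
  have hq : Measure.QuasiMeasurePreserving f (m.restrict E) m := by
    refine ⟨hf, Measure.AbsolutelyContinuous.mk fun N hN hN0 => ?_⟩
    rw [Measure.map_apply hf hN]
    have h1 : ∀ᵐ z ∂m, z ∉ N := measure_eq_zero_iff_ae_notMem.1 hN0
    rw [measure_eq_zero_iff_ae_notMem, ae_restrict_iff' hE]
    filter_upwards [ae_all_smul G h1, ho] with z hz hz' hzE hzN
    obtain ⟨b, hb⟩ := hz' hzE
    exact hz b (hb ▸ hzN)
  rw [memLp_indicator_iff_restrict hE]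
  refine ⟨ha.1.comp_quasiMeasurePreserving hq, lt_of_le_of_lt ?_ ha.2⟩
  rw [eLpNorm_exponent_top, eLpNorm_exponent_top]
  exact essSup_le_of_ae_le _ (hq.ae (ae_le_eLpNormEssSup (f := a) (μ := m)))

section

variable {H : Type*} [Group H] {D : Set Z} {s : H → Z → Z}

theorem IsPartialAction.exists_implements (hs : IsPartialAction G Z₀ D s)
    (hZ : IsGoodSet G m Z₀) (h : H) : ∃ T : Op G m, Implements T D (s h) := by
  refine OE.exists_implements hs.measurableSet (hs.measurable h) hZ.ae_free (hs.ae_orbit hZ h)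
    (n := 1) ?_
  filter_upwards [hZ.ae] with z hz
  rw [hs.multiplicity_eq hZ h hz]
  by_cases hD : z ∈ D <;> simp [hD]

variable {u : H → Op G m}

theorem IsPartialAction.op_mul (hs : IsPartialAction G Z₀ D s) (hZ : IsGoodSet G m Z₀)
    (hu : ∀ h, Implements (u h) D (s h⁻¹)) (h k : H) : u h * u k = u (h * k) := by
  refine ((hu h).mul (hu k) (hs.ae_orbit hZ _)).eq (hu (h * k)) ?_ ?_ ?_
  · filter_upwards [hZ.ae] with z hz
    exact ⟨fun h => h.1, fun h => ⟨h, hs.mem _ z hz h⟩⟩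
  · filter_upwards [hZ.ae] with z hz hD
    rw [mul_inv_rev, hs.mul _ _ z hz hD.1]
  · filter_upwards [hZ.ae] with z hz hD
    rw [← hs.mul _ _ z hz hD.1]
    exact hs.orbit _ z hz hD.1

theorem IsPartialAction.op_one (hs : IsPartialAction G Z₀ D s) (hZ : IsGoodSet G m Z₀)
    (hu : ∀ h, Implements (u h) D (s h⁻¹)) : u 1 = proj G m D := by
  refine (hu 1).eq (implements_proj hs.measurableSet hZ.ae_free) (by simp) ?_ (hs.ae_orbit hZ _)
  filter_upwards [hZ.ae] with z hz hD
  rw [inv_one, hs.one z hz hD]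
  rfl

/-- Each `s h` is a bijection of `D`, so all multiplicities are `1` and `u_h^* u_h = χ_D = u_h
u_{h⁻¹}`; cancelling gives `u_h^* = u_{h⁻¹}`. -/
theorem IsPartialAction.op_star (hs : IsPartialAction G Z₀ D s) (hZ : IsGoodSet G m Z₀)
    (hu : ∀ h, Implements (u h) D (s h⁻¹)) (h : H) : star (u h) = u h⁻¹ := by
  have h1 : star (u h) * u h = proj G m D := by
    rw [(hu h).star_mul_self hs.measurableSet (hs.measurable _) hZ.ae_free (hs.ae_orbit hZ _)
      hs.measurableSet (n := 1), Nat.cast_one, one_smul]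
    filter_upwards [hZ.ae] with z hz using hs.multiplicity_eq hZ _ hz
  have h2 : proj G m D * u h = u h := (hu h).proj_mul hs.measurableSet subset_rfl
  have h3 : u h * u h⁻¹ = proj G m D := by
    rw [hs.op_mul hZ hu, mul_inv_cancel, hs.op_one hZ hu]
  calc star (u h) = star (proj G m D * u h) := by rw [h2]
    _ = star (u h) * proj G m D := by rw [star_mul, star_proj hs.measurableSet]
    _ = star (u h) * u h * u h⁻¹ := by rw [← h3, mul_assoc]
    _ = u h⁻¹ := by rw [h1, (hu h⁻¹).proj_mul hs.measurableSet subset_rfl]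

theorem IsPartialAction.op_mul_star (hs : IsPartialAction G Z₀ D s) (hZ : IsGoodSet G m Z₀)
    (hu : ∀ h, Implements (u h) D (s h⁻¹)) (h : H) : u h * star (u h) = proj G m D := by
  rw [hs.op_star hZ hu, hs.op_mul hZ hu, mul_inv_cancel, hs.op_one hZ hu]

/-- `Ad(u_h)` is composition with `s h⁻¹`. -/
theorem IsPartialAction.op_conj (hs : IsPartialAction G Z₀ D s) (hZ : IsGoodSet G m Z₀)
    (hu : ∀ h, Implements (u h) D (s h⁻¹)) (h : H) {a : Z → ℂ} (ha : MemLp a ⊤ m) :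
    u h * mulOp G m a * star (u h) = mulOp G m (D.indicator fun z => a (s h⁻¹ z)) := by
  have hm := memLp_top_comp G hs.measurableSet (hs.measurable _) (hs.ae_orbit hZ h⁻¹) ha
  rw [← (hu h).mulOp_mul (hs.ae_orbit hZ _) hm ha, mul_assoc, hs.op_mul_star hZ hu,
    mulOp_mul_proj hs.measurableSet hm fun z hz => indicator_of_notMem hz _]
  exact Filter.Eventually.of_forall fun z hz => indicator_of_mem hz _

theorem IsPartialAction.op_mem_corner (hs : IsPartialAction G Z₀ D s) (hZ : IsGoodSet G m Z₀)
    (hu : ∀ h, Implements (u h) D (s h⁻¹)) (h : H) :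
    u h ∈ corner (crossedProduct G m) (proj G m D) := by
  refine ⟨(hu h).mem_crossedProduct hs.measurableSet (hs.measurable _) hZ.ae_free
    (hs.ae_orbit hZ _), (hu h).proj_mul hs.measurableSet subset_rfl,
    (hu h).mul_proj hs.measurableSet hs.measurableSet (hs.ae_orbit hZ _) ?_⟩
  filter_upwards [hZ.ae] with z hz hD using hs.mem _ z hz hD

end

end PartialActions

/-! ### Untwisted cocycles -/

section Untwisting

variable {Z : Type*} [MeasurableSpace Z]

/-- The map `z ↦ t (v z)⁻¹ z`. -/
def twist {Λ : Type*} [Group Λ] (t : Λ → Z → Z) (v : Z → Λ) (z : Z) : Z := t (v z)⁻¹ z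

/-- An ergodic action `s` of `Γ` on `D` and an action `t` of `Λ` on `C ⊇ D`, both with orbits
contained in those of `G`, and a map `z ↦ t (v z)⁻¹ z` from `D` to `C`, equivariant with respect to
`δ : Γ → Λ`. All its nonempty fibres have `n` elements. -/
structure IsUntwisting {Γ Λ : Type*} [Group Γ] [Group Λ] [MeasurableSpace Λ] (G : Type*) [Group G]
    [MulAction G Z] (m : Measure Z) (Z₀ D C : Set Z) (s : Γ → Z → Z) (t : Λ → Z → Z)
    (δ : Γ →* Λ) (v : Z → Λ) (n : ℕ) : Prop where
  good : IsGoodSet G m Z₀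
  actD : IsPartialAction G Z₀ D s
  actC : IsPartialAction G Z₀ C t
  subset : D ⊆ C
  measure_ne_zero : m D ≠ 0
  measurable_v : Measurable v
  equivariant : ∀ g, ∀ z ∈ Z₀, z ∈ D → twist t v (s g z) = t (δ g) (twist t v z)
  pos : 0 < n
  multiplicity_twist : ∀ z ∈ Z₀, z ∈ D → multiplicity G D (twist t v) (twist t v z) = n

/-- The image of `D` under the map `twist t v`, modulo a null set. -/
def twistRange {Λ : Type*} [Group Λ] (G : Type*) [Group G] [MulAction G Z] (D C : Set Z)
    (t : Λ → Z → Z) (v : Z → Λ) (n : ℕ) : Set Z :=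
  {z | z ∈ C ∧ multiplicity G D (twist t v) z = n}

section Basic

variable {Γ Λ : Type*} [Group Γ] [Group Λ] [Countable Λ] [MeasurableSpace Λ]
  [DiscreteMeasurableSpace Λ]
  {G : Type*} [Group G] [MulAction G Z] {m : Measure Z} {Z₀ D C : Set Z} {s : Γ → Z → Z}
  {t : Λ → Z → Z} {δ : Γ →* Λ} {v : Z → Λ}

theorem IsPartialAction.measurable_twist (ht : IsPartialAction G Z₀ C t) (hv : Measurable v) :
    Measurable (twist t v) :=
  measurable_select_apply (F := fun h z => t h⁻¹ z) (fun h => ht.measurable h⁻¹) hv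

theorem IsPartialAction.twist_mem (ht : IsPartialAction G Z₀ C t) (v : Z → Λ) {z : Z}
    (hz : z ∈ Z₀) (hC : z ∈ C) : twist t v z ∈ C :=
  ht.mem _ z hz hC

theorem IsPartialAction.twist_orbit (ht : IsPartialAction G Z₀ C t) (v : Z → Λ) {z : Z}
    (hz : z ∈ Z₀) (hC : z ∈ C) : ∃ a : G, twist t v z = a • z :=
  ht.orbit _ z hz hC

theorem IsPartialAction.twist_good (ht : IsPartialAction G Z₀ C t) (hZ : IsGoodSet G m Z₀)
    (v : Z → Λ) {z : Z} (hz : z ∈ Z₀) (hC : z ∈ C) : twist t v z ∈ Z₀ :=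
  ht.mem_good hZ _ hz hC

/-- The fibre over `y` is mapped injectively into the fibre over `t (δ g) y`. -/
theorem multiplicity_twist_equivariant (hZ : IsGoodSet G m Z₀) (hs : IsPartialAction G Z₀ D s)
    (ht : IsPartialAction G Z₀ C t)
    (he : ∀ g, ∀ z ∈ Z₀, z ∈ D → twist t v (s g z) = t (δ g) (twist t v z))
    (g : Γ) {y : Z} (hy : y ∈ Z₀) (hyC : y ∈ C) :
    multiplicity G D (twist t v) (t (δ g) y) = multiplicity G D (twist t v) y := by
  have key : ∀ (g : Γ) (y : Z), y ∈ Z₀ → y ∈ C →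
      multiplicity G D (twist t v) y ≤ multiplicity G D (twist t v) (t (δ g) y) := by
    intro g y hy hyC
    rw [hZ.multiplicity_eq hy, hZ.multiplicity_eq (ht.mem_good hZ _ hy hyC)]
    refine encard_le_encard_of_injOn (f := s g) ?_ ?_
    · rintro x ⟨⟨a, rfl⟩, h1, h2⟩
      have hx := hZ.smul_mem a y hy
      refine ⟨?_, hs.mem g _ hx h1, ?_⟩
      · obtain ⟨b, hb⟩ := hs.orbit g _ hx h1
        obtain ⟨c, hc⟩ := ht.orbit (δ g) y hy hyC
        rw [hb, hc]
        exact ⟨b * a * c⁻¹, by simp [mul_smul]⟩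
      · rw [he g _ hx h1]
        exact congrArg _ h2
    · rintro x ⟨⟨a, rfl⟩, h1, h2⟩ x' ⟨⟨a', rfl⟩, h1', h2'⟩ h
      have := congrArg (s g⁻¹) h
      rwa [hs.inv_apply g (hZ.smul_mem a y hy) h1, hs.inv_apply g (hZ.smul_mem a' y hy) h1'] at this
  refine le_antisymm ?_ (key g y hy hyC)
  have := key g⁻¹ (t (δ g) y) (ht.mem_good hZ _ hy hyC) (ht.mem _ y hy hyC)
  rwa [map_inv, ht.inv_apply _ hy hyC] at this

theorem IsGoodSet.multiplicity_ne_zero (hZ : IsGoodSet G m Z₀) (ht : IsPartialAction G Z₀ C t)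
    (hDC : D ⊆ C) {z : Z} (hz : z ∈ Z₀) (hD : z ∈ D) :
    multiplicity G D (twist t v) (twist t v z) ≠ 0 := by
  rw [hZ.multiplicity_eq (ht.twist_good hZ v hz (hDC hD)), encard_ne_zero]
  refine ⟨z, ?_, hD, rfl⟩
  obtain ⟨a, ha⟩ := ht.twist_orbit v hz (hDC hD)
  exact ⟨a⁻¹, by simp [ha]⟩

variable [Countable G] [MeasurableSpace G] [DiscreteMeasurableSpace G]
  [MeasurableConstSMul G Z] [SFinite m] [SMulInvariantMeasure G Z m] [MeasurableEq Z]

theorem measurable_multiplicity {E : Set Z} {f : Z → Z} (hE : MeasurableSet E)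
    (hf : Measurable f) : Measurable fun z => (multiplicity G E f z : ℝ≥0∞) := by
  have : (fun z => (multiplicity G E f z : ℝ≥0∞))
      = fun z => ∑' a : G, {z | a • z ∈ E ∧ f (a • z) = z}.indicator (1 : Z → ℝ≥0∞) z := by
    funext z
    rw [multiplicity, ← ENNReal.tsum_set_one,
      tsum_subtype {a : G | a • z ∈ E ∧ f (a • z) = z} fun _ => (1 : ℝ≥0∞)]
    rfl
  rw [this]
  refine Measurable.tsum fun a => measurable_one.indicator ?_
  have ha : Measurable fun z : Z => a • z := measurable_const_smul a
  exact (ha hE).inter (measurableSet_eq_fun (hf.comp ha) measurable_id)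

theorem measurableSet_multiplicity_eq {E : Set Z} {f : Z → Z} (hE : MeasurableSet E)
    (hf : Measurable f) (n : ℕ) : MeasurableSet {z | multiplicity G E f z = n} := by
  have : {z | multiplicity G E f z = n} = {z | (multiplicity G E f z : ℝ≥0∞) = n} := by
    ext z
    change multiplicity G E f z = n ↔ (multiplicity G E f z : ℝ≥0∞) = n
    rw [← ENat.toENNReal_coe, ENat.toENNReal_inj]
  rw [this]
  exact measurable_multiplicity hE hf (measurableSet_singleton _)

/-- By ergodicity all nonempty fibres have the same finite number of points. -/
theorem exists_isUntwisting (hZ : IsGoodSet G m Z₀) (hs : IsPartialAction G Z₀ D s)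
    (ht : IsPartialAction G Z₀ C t) (hDC : D ⊆ C) (hD0 : m D ≠ 0) (hD : m D ≠ ⊤)
    (hv : Measurable v)
    (he : ∀ g, ∀ z ∈ Z₀, z ∈ D → twist t v (s g z) = t (δ g) (twist t v z))
    (herg : ∀ A, MeasurableSet A → (∀ g, ∀ z ∈ Z₀, z ∈ D → (s g z ∈ A ↔ z ∈ A)) →
      m (D ∩ A) = 0 ∨ m (D \ A) = 0) :
    ∃ (n : ℕ) (Z₁ : Set Z), Z₁ ⊆ Z₀ ∧ IsUntwisting G m Z₁ D C s t δ v n := by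
  set N := multiplicity G D (twist t v) with hN
  have htw := ht.measurable_twist hv
  have hDm := hs.measurableSet
  have ho : ∀ᵐ z ∂m, z ∈ D → ∃ a : G, twist t v z = a • z := by
    filter_upwards [hZ.ae] with z hz hzD using ht.twist_orbit v hz (hDC hzD)
  -- The change of variables with `F = 1` shows that `N` has integral `m D`, which is finite.
  have hfin : ∀ᵐ z ∂m, (N z : ℝ≥0∞) < ⊤ := by
    refine ae_lt_top (measurable_multiplicity hDm htw) ?_
    have := setLIntegral_comp_eq (m := m) hDm htw hZ.ae_free ho (F := 1) measurable_one
    simp only [Pi.one_apply, mul_one, setLIntegral_one] at this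
    rw [← this]
    exact hD
  have hfin' : ∀ᵐ z ∂m, z ∈ D → ∃ k : ℕ, N (twist t v z) = k := by
    filter_upwards [ae_all_smul G hfin, ho] with z h1 h2 hzD
    obtain ⟨a, ha⟩ := h2 hzD
    have := h1 a
    rw [← ha] at this
    have h3 : N (twist t v z) ≠ ⊤ := fun h => by simp [h] at this
    exact ⟨_, (ENat.natCast_toNat h3).symm⟩
  let A : ℕ → Set Z := fun k => twist t v ⁻¹' {z | N z = k}
  have hA : ∀ k, MeasurableSet (A k) := fun k => htw (measurableSet_multiplicity_eq hDm htw k)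
  have hAinv : ∀ k g, ∀ z ∈ Z₀, z ∈ D → (s g z ∈ A k ↔ z ∈ A k) := by
    intro k g z hz hzD
    change N (twist t v (s g z)) = k ↔ N (twist t v z) = k
    rw [he g z hz hzD, hN, multiplicity_twist_equivariant hZ hs ht he g
      (ht.twist_good hZ v hz (hDC hzD)) (ht.twist_mem v hz (hDC hzD))]
  -- The invariant sets `A k` cover `D` up to a null set, so one of them has positive measure; by
  -- ergodicity it is conull in `D`.
  have hex : ∃ k, m (D ∩ A k) ≠ 0 := by
    by_contra! h
    refine hD0 (measure_mono_null_ae (t := ⋃ k, D ∩ A k) ?_ (measure_iUnion_null h))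
    filter_upwards [hfin'] with z hz hzD
    obtain ⟨k, hk⟩ := hz hzD
    exact mem_iUnion.2 ⟨k, hzD, hk⟩
  obtain ⟨k, hk⟩ := hex
  have hk' := (herg (A k) (hA k) (hAinv k)).resolve_left hk
  have hk1 : ∀ᵐ z ∂m, z ∈ D → N (twist t v z) = k := by
    filter_upwards [measure_eq_zero_iff_ae_notMem.1 hk'] with z hz hzD
    by_contra h
    exact hz ⟨hzD, h⟩
  -- The new good set asks for the constant fibre size along the entire `G`-orbit, which makes it
  -- invariant.
  have hsub : {z | z ∈ Z₀ ∧ ∀ g : G, g • z ∈ D → N (twist t v (g • z)) = k} ⊆ Z₀ :=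
    fun z hz => hz.1
  have hmult : ∀ z ∈ {z | z ∈ Z₀ ∧ ∀ g : G, g • z ∈ D → N (twist t v (g • z)) = k}, z ∈ D →
      N (twist t v z) = k := fun z hz hzD => by simpa using hz.2 1 (by simpa using hzD)
  have hae : ∀ᵐ z ∂m, z ∈ {z | z ∈ Z₀ ∧ ∀ g : G, g • z ∈ D → N (twist t v (g • z)) = k} := by
    filter_upwards [hZ.ae, ae_all_smul G hk1] with z h1 h2 using ⟨h1, h2⟩
  refine ⟨k, _, hsub, ⟨hae, ?_, fun z hz => hZ.free z hz.1⟩, hs.mono hsub, ht.mono hsub, hDC, hD0,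
    hv, fun g z hz => he g z hz.1, ?_, hmult⟩
  · rintro g z ⟨hz, hz'⟩
    refine ⟨hZ.smul_mem g z hz, fun g' h => ?_⟩
    have := hz' (g' * g)
    rw [mul_smul] at this
    exact this h
  -- The constant cannot be `0`: the fibre over `twist t v z` contains `z`.
  · rw [Nat.pos_iff_ne_zero]
    rintro rfl
    refine hD0 (measure_eq_zero_iff_ae_notMem.2 ?_)
    filter_upwards [hae] with z hz hzD
    exact hZ.multiplicity_ne_zero (v := v) ht hDC hz.1 hzD (by simpa using hmult z hz hzD)

end Basic

namespace IsUntwisting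

variable {Γ Λ : Type*} [Group Γ] [Group Λ] [Countable Λ] [MeasurableSpace Λ]
  [DiscreteMeasurableSpace Λ]
  {G : Type*} [Group G] [MulAction G Z] {m : Measure Z} {Z₀ D C : Set Z} {s : Γ → Z → Z}
  {t : Λ → Z → Z} {δ : Γ →* Λ} {v : Z → Λ} {n : ℕ} (U : IsUntwisting G m Z₀ D C s t δ v n)

include U

theorem measurable_twist : Measurable (twist t v) := U.actC.measurable_twist U.measurable_v

theorem twist_orbit {z : Z} (hz : z ∈ Z₀) (hD : z ∈ D) : ∃ a : G, twist t v z = a • z :=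
  U.actC.twist_orbit v hz (U.subset hD)

theorem twist_good {z : Z} (hz : z ∈ Z₀) (hD : z ∈ D) : twist t v z ∈ Z₀ :=
  U.actC.twist_good U.good v hz (U.subset hD)

theorem ae_orbit : ∀ᵐ z ∂m, z ∈ D → ∃ a : G, twist t v z = a • z := by
  filter_upwards [U.good.ae] with z hz hD using U.twist_orbit hz hD

theorem twist_mem_range {z : Z} (hz : z ∈ Z₀) (hD : z ∈ D) :
    twist t v z ∈ twistRange G D C t v n :=
  ⟨U.actC.twist_mem v hz (U.subset hD), U.multiplicity_twist z hz hD⟩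

theorem exists_of_mem_range {z : Z} (hz : z ∈ twistRange G D C t v n) :
    ∃ a : G, a • z ∈ D ∧ twist t v (a • z) = z := by
  have : {a : G | a • z ∈ D ∧ twist t v (a • z) = z}.Nonempty := by
    rw [← encard_ne_zero]
    change multiplicity G D (twist t v) z ≠ 0
    rw [hz.2]
    exact_mod_cast U.pos.ne'
  exact this

/-- A nonempty fibre over a good point contains a good point of `D`, so it has `n` elements; no
sizes other than `0` and `n` occur. -/
theorem multiplicity_eq {z : Z} (hz : z ∈ Z₀) : multiplicity G D (twist t v) z
    = (twistRange G D C t v n).indicator (fun _ => (n : ℕ∞)) z := by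
  by_cases h : z ∈ twistRange G D C t v n
  · rw [indicator_of_mem h, h.2]
  · rw [indicator_of_notMem h]
    by_contra h0
    have : {a : G | a • z ∈ D ∧ twist t v (a • z) = z}.Nonempty := encard_ne_zero.1 h0
    obtain ⟨a, ha, ha'⟩ := this
    exact h (ha' ▸ U.twist_mem_range (U.good.smul_mem a z hz) ha)

theorem smul_mem_range (g : Γ) {z : Z} (hz : z ∈ Z₀) (h : z ∈ twistRange G D C t v n) :
    t (δ g) z ∈ twistRange G D C t v n :=
  ⟨U.actC.mem _ z hz h.1, by
    rw [multiplicity_twist_equivariant U.good U.actD U.actC U.equivariant g hz h.1, h.2]⟩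

theorem twist_ker {k : Γ} (hk : k ∈ δ.ker) {z : Z} (hz : z ∈ Z₀) (hD : z ∈ D) :
    twist t v (s k z) = twist t v z := by
  rw [U.equivariant k z hz hD, (MonoidHom.mem_ker).1 hk,
    U.actC.one _ (U.twist_good hz hD) (U.actC.twist_mem v hz (U.subset hD))]

theorem exists_good : ∃ z ∈ Z₀, z ∈ D := by
  by_contra! h
  refine U.measure_ne_zero (measure_eq_zero_iff_ae_notMem.2 ?_)
  filter_upwards [U.good.ae] with z hz using h z hz

theorem fibre_encard {z : Z} (hz : z ∈ Z₀) (hD : z ∈ D) :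
    {x | x ∈ MulAction.orbit G z ∧ x ∈ D ∧ twist t v x = twist t v z}.encard = n := by
  rw [← U.multiplicity_twist z hz hD, U.good.multiplicity_eq (U.twist_good hz hD)]
  obtain ⟨a, ha⟩ := U.twist_orbit hz hD
  have : MulAction.orbit G (twist t v z) = MulAction.orbit G z := by
    rw [ha, MulAction.orbit_smul]
  rw [this]

theorem ker_image_subset {z : Z} (hz : z ∈ Z₀) (hD : z ∈ D) :
    range (fun k : δ.ker => s k z)
      ⊆ {x | x ∈ MulAction.orbit G z ∧ x ∈ D ∧ twist t v x = twist t v z} := by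
  rintro _ ⟨k, rfl⟩
  refine ⟨?_, U.actD.mem _ z hz hD, U.twist_ker k.2 hz hD⟩
  obtain ⟨a, ha⟩ := U.actD.orbit (k : Γ) z hz hD
  exact ⟨a, ha.symm⟩

/-- The kernel acts freely and preserves the fibre through a good point, which has only `n`
elements. -/
theorem finite_ker : Finite δ.ker := by
  obtain ⟨z, hz, hD⟩ := U.exists_good
  have hfin : {x | x ∈ MulAction.orbit G z ∧ x ∈ D ∧ twist t v x = twist t v z}.Finite := by
    rw [← encard_ne_top_iff, U.fibre_encard hz hD]
    exact ENat.natCast_ne_top n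
  have := (hfin.subset (U.ker_image_subset hz hD)).to_subtype
  refine Finite.of_injective (rangeFactorization fun k : δ.ker => s k z) fun k k' h => ?_
  exact Subtype.ext (U.actD.cancel hz hD (congrArg Subtype.val h))

/-- If the fibres are contained in the orbits of the kernel of `δ`, then `n = |ker δ|`. -/
theorem eq_card_ker (hK : ∀ z ∈ Z₀, z ∈ D → ∀ x ∈ MulAction.orbit G z, x ∈ D →
    twist t v x = twist t v z → ∃ k ∈ δ.ker, x = s k z) : n = Nat.card δ.ker := by
  have := U.finite_ker
  obtain ⟨z, hz, hD⟩ := U.exists_good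
  have h1 : range (fun k : δ.ker => s k z)
      = {x | x ∈ MulAction.orbit G z ∧ x ∈ D ∧ twist t v x = twist t v z} := by
    refine (U.ker_image_subset hz hD).antisymm ?_
    rintro x ⟨h1, h2, h3⟩
    obtain ⟨k, hk, rfl⟩ := hK z hz hD x h1 h2 h3
    exact ⟨⟨k, hk⟩, rfl⟩
  have h2 := U.fibre_encard hz hD
  rw [← h1, ← image_univ, InjOn.encard_image fun k _ k' _ h =>
    Subtype.ext (U.actD.cancel hz hD h), encard_univ, ENat.card_eq_coe_natCard] at h2
  exact_mod_cast h2.symm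

variable [Countable G] [MeasurableSpace G] [DiscreteMeasurableSpace G]
  [MeasurableConstSMul G Z] [SFinite m] [SMulInvariantMeasure G Z m] [MeasurableEq Z]

theorem measurableSet_range : MeasurableSet (twistRange G D C t v n) :=
  U.actC.measurableSet.inter
    (measurableSet_multiplicity_eq U.actD.measurableSet U.measurable_twist n)

theorem exists_implements : ∃ b : Op G m, Implements b D (twist t v) := by
  refine OE.exists_implements U.actD.measurableSet U.measurable_twist U.good.ae_free U.ae_orbit
    (n := n) ?_
  filter_upwards [U.good.ae] with z hz
  rw [U.multiplicity_eq hz]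
  by_cases h : z ∈ twistRange G D C t v n <;> simp [h]

/-- A measurable section of `twist t v`. -/
theorem exists_section : ∃ r : Z → Z, Measurable r ∧ ∀ z ∈ twistRange G D C t v n,
    (∃ a : G, r z = a • z) ∧ r z ∈ D ∧ twist t v (r z) = z := by
  have hm : ∀ a : G, MeasurableSet {z | a • z ∈ D ∧ twist t v (a • z) = z} := fun a => by
    have ha : Measurable fun z : Z => a • z := measurable_const_smul a
    exact (ha U.actD.measurableSet).inter
      (measurableSet_eq_fun (U.measurable_twist.comp ha) measurable_id)
  obtain ⟨c, hc, h⟩ := exists_measurable_select hm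
  refine ⟨fun z => c z • z, measurable_select_apply (F := fun (a : G) (z : Z) => a • z)
    (fun a => measurable_const_smul a) hc, fun z hz => ⟨⟨_, rfl⟩, ?_⟩⟩
  obtain ⟨a, ha⟩ := U.exists_of_mem_range hz
  exact h z a ha

theorem memLp_comp_twist {α : Z → ℂ} (hα : MemLp α ⊤ m) :
    MemLp (D.indicator fun z => α (twist t v z)) ⊤ m :=
  memLp_top_comp G U.actD.measurableSet U.measurable_twist U.ae_orbit hα

/-- Functions constant on the fibres factor through `twist t v`. -/
theorem exists_factor {a : Z → ℂ} (ha : MemLp a ⊤ m)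
    (hinv : ∀ᵐ z ∂m, z ∈ D → ∀ x ∈ MulAction.orbit G z, x ∈ D → twist t v x = twist t v z →
      a z = a x) :
    ∃ α : Z → ℂ, MemLp α ⊤ m ∧ (∀ z ∉ twistRange G D C t v n, α z = 0) ∧
      ∀ᵐ z ∂m, z ∈ D → a z = α (twist t v z) := by
  obtain ⟨r, hr, h⟩ := U.exists_section
  -- The factor is `a ∘ r` on the range, extended by `0`. A section suffices because `a` does not
  -- distinguish points of a fibre.
  refine ⟨_, memLp_top_comp G (E := twistRange G D C t v n) (f := r) U.measurableSet_range hr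
    (Filter.Eventually.of_forall fun z hz => (h z hz).1) ha,
    fun z hz => indicator_of_notMem hz _, ?_⟩
  filter_upwards [hinv, U.good.ae] with z hz hz0 hD
  have hW := U.twist_mem_range hz0 hD
  rw [indicator_of_mem hW]
  obtain ⟨⟨a, ha⟩, h2, h3⟩ := h _ hW
  refine hz hD _ ?_ h2 h3
  obtain ⟨a', ha'⟩ := U.twist_orbit hz0 hD
  exact ⟨a * a', show (a * a') • z = _ by rw [ha, ha', mul_smul]⟩

variable {u : Γ → Op G m} {V : Λ → Op G m} {b : Op G m}
  (hu : ∀ g, Implements (u g) D (s g⁻¹)) (hV : ∀ h, Implements (V h) C (t h⁻¹))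
  (hb : Implements b D (twist t v))

include hb

theorem proj_mul : proj G m D * b = b := hb.proj_mul U.actD.measurableSet subset_rfl

theorem mul_proj_range : b * proj G m (twistRange G D C t v n) = b := by
  refine hb.mul_proj U.actD.measurableSet U.measurableSet_range U.ae_orbit ?_
  filter_upwards [U.good.ae] with z hz hD using U.twist_mem_range hz hD

theorem star_mul_self :
    star b * b = (n : ℂ) • proj G m (twistRange G D C t v n) := by
  refine hb.star_mul_self U.actD.measurableSet U.measurable_twist U.good.ae_free U.ae_orbit
    U.measurableSet_range ?_
  filter_upwards [U.good.ae] with z hz using U.multiplicity_eq hz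

theorem mem_corner : b ∈ corner (crossedProduct G m) (proj G m C) := by
  refine ⟨hb.mem_crossedProduct U.actD.measurableSet U.measurable_twist U.good.ae_free U.ae_orbit,
    hb.proj_mul U.actC.measurableSet U.subset,
    hb.mul_proj U.actD.measurableSet U.actC.measurableSet U.ae_orbit ?_⟩
  filter_upwards [U.good.ae] with z hz hD using (U.twist_mem_range hz hD).1

/-- From `b^* b = n χ_W` and `b χ_W = b` one gets `b b^* b = n b`, so `b / √n` is a partial
isometry. -/
theorem isScalarMulPartialIsometry : IsScalarMulPartialIsometry b := by
  have hn : (0 : ℝ) < n := by exact_mod_cast U.pos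
  have hsq : ((Real.sqrt n : ℝ) : ℂ) * (Real.sqrt n : ℝ) = n := by
    rw [← Complex.ofReal_mul, Real.mul_self_sqrt hn.le]; simp
  have hne : ((Real.sqrt n : ℝ) : ℂ) ≠ 0 := by
    simpa using (Real.sqrt_pos.2 hn).ne'
  have hbbb : b * star b * b = (n : ℂ) • b := by
    rw [mul_assoc, U.star_mul_self hb, mul_smul_comm, U.mul_proj_range hb]
  refine ⟨(Real.sqrt n : ℝ), ((Real.sqrt n : ℝ) : ℂ)⁻¹ • b, ?_, ?_⟩
  · rw [star_smul, smul_mul_smul_comm, smul_mul_smul_comm, hbbb, smul_smul]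
    congr 1
    simp only [star_inv₀, Complex.star_def, Complex.conj_ofReal]
    rw [← hsq]
    field_simp
  · rw [smul_smul, mul_inv_cancel₀ hne, one_smul]

include hV in
-- On `{v = h}` the maps of `b` and of `V h` coincide, so cutting `b` along this partition gives the
-- defining series.
theorem strongHasSum :
    StrongHasSum (fun h => proj G m {z | z ∈ D ∧ v z = h} * V h) b := by
  have hm : ∀ h, MeasurableSet {z | z ∈ D ∧ v z = h} := fun h =>
    U.actD.measurableSet.inter (U.measurable_v (measurableSet_singleton h))
  have h1 : StrongHasSum (fun h => proj G m {z | z ∈ D ∧ v z = h}) (proj G m D) := by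
    refine strongHasSum_proj_of_ae hm ?_ ?_
    · refine Filter.Eventually.of_forall fun z => ⟨fun h => ⟨v z, h, rfl⟩, fun ⟨h, hz⟩ => hz.1⟩
    · exact Filter.Eventually.of_forall fun z h k hh hk => hh.2.symm.trans hk.2
  have h2 := h1.mul_right b
  rw [U.proj_mul hb] at h2
  have h3 : ∀ h, proj G m {z | z ∈ D ∧ v z = h} * b = proj G m {z | z ∈ D ∧ v z = h} * V h := by
    intro h
    have hp := implements_proj (G := G) (hm h) U.good.ae_free
    have hid : ∀ᵐ z ∂m, z ∈ {z | z ∈ D ∧ v z = h} → ∃ a : G, id z = a • z :=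
      Filter.Eventually.of_forall fun z _ => ⟨1, by simp⟩
    refine (hp.mul hb hid).eq (hp.mul (hV h) hid) ?_ ?_ ?_
    · exact Filter.Eventually.of_forall fun z => ⟨fun h => ⟨h.1, U.subset h.2⟩,
        fun h => ⟨h.1, h.1.1⟩⟩
    · refine Filter.Eventually.of_forall fun z hz => ?_
      simp only [id, twist]
      rw [hz.1.2]
    · filter_upwards [U.ae_orbit] with z hz hz' using hz hz'.2
  simpa only [h3] using h2

include hu hV in
-- The two products implement `z ↦ twist t v (s g⁻¹ z)` and `z ↦ t (δ g)⁻¹ (twist t v z)`, which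
-- agree by equivariance.
theorem intertwine (g : Γ) : u g * b = b * V (δ g) := by
  refine ((hu g).mul hb (U.actD.ae_orbit U.good _)).eq (hb.mul (hV (δ g)) U.ae_orbit) ?_ ?_ ?_
  · filter_upwards [U.good.ae] with z hz
    exact ⟨fun h => ⟨h.1, (U.twist_mem_range hz h.1).1⟩, fun h => ⟨h.1, U.actD.mem _ z hz h.1⟩⟩
  · filter_upwards [U.good.ae] with z hz hD
    rw [U.equivariant _ z hz hD.1, map_inv]
  · filter_upwards [U.good.ae] with z hz hD
    obtain ⟨a, ha⟩ := U.actD.orbit g⁻¹ z hz hD.1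
    obtain ⟨c, hc⟩ := U.twist_orbit (U.actD.mem_good U.good g⁻¹ hz hD.1) hD.2
    exact ⟨c * a, by rw [hc, ha, mul_smul]⟩

omit hb in
include hV in
-- Fibre sizes are invariant under `δ(Γ)`, hence so is the set where they equal `n`.
theorem conj_proj_range {h : Λ} (hh : h ∈ δ.range) :
    V h * proj G m (twistRange G D C t v n) * star (V h)
      = proj G m (twistRange G D C t v n) := by
  obtain ⟨g, rfl⟩ := hh
  rw [proj, U.actC.op_conj U.good hV _ (memLp_indicator_one U.measurableSet_range)]
  refine mulOp_congr ?_
  filter_upwards [U.good.ae] with z hz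
  by_cases hC : z ∈ C
  · rw [indicator_of_mem hC]
    have : t (δ g)⁻¹ z ∈ twistRange G D C t v n ↔ z ∈ twistRange G D C t v n := by
      refine ⟨fun h => ?_, fun h => ?_⟩
      · have := U.smul_mem_range g (U.actC.mem_good U.good _ hz hC) h
        rwa [U.actC.apply_inv _ hz hC] at this
      · rw [← map_inv]
        exact U.smul_mem_range g⁻¹ hz h
    by_cases hW : z ∈ twistRange G D C t v n
    · rw [indicator_of_mem hW, indicator_of_mem (this.2 hW)]; rfl
    · rw [indicator_of_notMem hW, indicator_of_notMem fun h => hW (this.1 h)]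
  · rw [indicator_of_notMem hC, indicator_of_notMem fun h => hC h.1]

/-- `b^* x b = b^* b y = n χ_W y = n y`. So evaluating `n⁻¹ Ad(b^*)` at `x` amounts to moving `x`
across `b`. -/
theorem scaledAd_eq {x y : Op G m} (h : x * b = b * y)
    (hy : proj G m (twistRange G D C t v n) * y = y) : scaledAd n b x = y := by
  have hn : (n : ℂ) ≠ 0 := by exact_mod_cast U.pos.ne'
  rw [scaledAd, mul_assoc, h, ← mul_assoc, U.star_mul_self hb, smul_mul_assoc, hy, smul_smul,
    inv_mul_cancel₀ hn, one_smul]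

include hu hV in
/-- `n⁻¹ Ad(b^*)` conjugates the actions of `Γ` and `δ(Γ)`. -/
theorem conjugatesVia [SigmaFinite m] {S : Set (Op G m)}
    (hS : ∀ x, x ∈ S ↔ ∃ a : Z → ℂ, MemLp a ⊤ m ∧ (∀ z ∉ D, a z = 0) ∧
      (∀ᵐ z ∂m, z ∈ D → ∀ x ∈ MulAction.orbit G z, x ∈ D → twist t v x = twist t v z →
        a z = a x) ∧ x = mulOp G m a) :
    ConjugatesVia δ u V (scaledAd n b) S (linf G m (twistRange G D C t v n)) := by
  set W := twistRange G D C t v n with hW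
  -- A function constant on fibres is `α ∘ twist t v`, and composition operators satisfy `(α ∘ f) b
  -- = b α`; this `α` is the image of `x`.
  have hfac : ∀ x ∈ S, ∃ y ∈ linf G m W, x * b = b * y ∧ proj G m W * y = y := by
    intro x hx
    obtain ⟨a, ha, ha0, hinv, rfl⟩ := (hS x).1 hx
    obtain ⟨α, hα, hα0, h⟩ := U.exists_factor ha hinv
    exact ⟨_, ⟨α, hα, hα0, rfl⟩, hb.mulOp_mul U.ae_orbit ha hα h,
      proj_mul_mulOp U.measurableSet_range hα hα0⟩
  have hα : ∀ x ∈ S, scaledAd n b x ∈ linf G m W ∧ x * b = b * scaledAd n b x ∧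
      proj G m W * scaledAd n b x = scaledAd n b x := by
    intro x hx
    obtain ⟨y, hy, h1, h2⟩ := hfac x hx
    rw [U.scaledAd_eq hb h1 h2]
    exact ⟨hy, h1, h2⟩
  have hstar : star (b) * b = (n : ℂ) • proj G m W := U.star_mul_self hb
  have hustar : ∀ g, star (u g) * b = b * star (V (δ g)) := by
    intro g
    rw [U.actD.op_star U.good hu, U.intertwine hu hV hb, map_inv, U.actC.op_star U.good hV]
  have hustar' : ∀ g, star b * u g = V (δ g) * star b := by
    intro g
    have := congrArg star (hustar g)
    simpa [star_mul] using this
  refine ⟨⟨⟨fun x hx => (hα x hx).1, ?_, ?_⟩, ?_, ?_⟩, ?_, ?_, ?_, ?_⟩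
  · intro x hx x' hx' h
    obtain ⟨a, ha, ha0, hinv, rfl⟩ := (hS x).1 hx
    obtain ⟨a', ha', ha0', hinv', rfl⟩ := (hS x').1 hx'
    obtain ⟨α, hα, hα0, h1⟩ := U.exists_factor ha hinv
    obtain ⟨α', hα', hα0', h1'⟩ := U.exists_factor ha' hinv'
    change scaledAd n b _ = scaledAd n b _ at h
    rw [U.scaledAd_eq hb (hb.mulOp_mul U.ae_orbit ha hα h1)
      (proj_mul_mulOp U.measurableSet_range hα hα0),
      U.scaledAd_eq hb (hb.mulOp_mul U.ae_orbit ha' hα' h1')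
      (proj_mul_mulOp U.measurableSet_range hα' hα0')] at h
    have : Inhabited G := ⟨1⟩
    -- The factors agree a.e., hence at all points of almost every orbit, in particular at `twist t
    -- v z`; the original functions are recovered by composing.
    refine mulOp_congr ?_
    filter_upwards [ae_all_smul G (mulOp_injective hα hα' h), h1, h1', U.ae_orbit]
      with z h2 h3 h4 h5
    by_cases hD : z ∈ D
    · obtain ⟨g, hg⟩ := h5 hD
      rw [h3 hD, h4 hD, hg, h2]
    · rw [ha0 z hD, ha0' z hD]
  · rintro y ⟨α, hα, hα0, rfl⟩
    have hm := U.memLp_comp_twist hα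
    have hmem : mulOp G m (D.indicator fun z => α (twist t v z)) ∈ S := by
      refine (hS _).2 ⟨_, hm, fun z hz => indicator_of_notMem hz _, ?_, rfl⟩
      refine Filter.Eventually.of_forall fun z hD x _ hx h => ?_
      rw [indicator_of_mem hD, indicator_of_mem hx, h]
    refine ⟨_, hmem, U.scaledAd_eq hb (hb.mulOp_mul U.ae_orbit hm hα ?_)
      (proj_mul_mulOp U.measurableSet_range hα hα0)⟩
    exact Filter.Eventually.of_forall fun z hD => indicator_of_mem hD _
  · intro x hx y hy
    refine ⟨by simp only [scaledAd, mul_add, add_mul, smul_add], ?_⟩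
    refine U.scaledAd_eq hb ?_ ?_
    · rw [mul_assoc, (hα y hy).2.1, ← mul_assoc, (hα x hx).2.1, mul_assoc]
    · rw [← mul_assoc, (hα x hx).2.2]
  · intro x hx
    refine ⟨?_, fun c => ?_⟩
    · simp only [scaledAd, star_smul, star_mul, star_star, mul_assoc]
      congr 1
      simp
    · simp only [scaledAd, mul_smul_comm, smul_mul_assoc]
      rw [smul_comm]
  · intro g x hx
    obtain ⟨a, ha, ha0, hinv, rfl⟩ := (hS x).1 hx
    rw [U.actD.op_conj U.good hu g ha]
    refine (hS _).2 ⟨_, memLp_top_comp G U.actD.measurableSet (U.actD.measurable _)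
      (U.actD.ae_orbit U.good _) ha, fun z hz => indicator_of_notMem hz _, ?_, rfl⟩
    -- By equivariance `s g⁻¹` takes points of a common fibre to points of a common fibre, so
    -- constancy on fibres survives the action.
    filter_upwards [ae_all_smul G hinv, U.good.ae] with z h1 hz hD x hx hxD hxz
    obtain ⟨c, rfl⟩ := hx
    have hx0 := U.good.smul_mem c z hz
    simp only at hxz hxD ⊢
    rw [indicator_of_mem hD, indicator_of_mem hxD]
    obtain ⟨e, he⟩ := U.actD.orbit g⁻¹ z hz hD
    obtain ⟨f, hf⟩ := U.actD.orbit g⁻¹ _ hx0 hxD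
    rw [he]
    refine h1 e (he ▸ U.actD.mem _ z hz hD) _ ?_ (U.actD.mem _ _ hx0 hxD) ?_
    · rw [hf]
      exact ⟨f * c * e⁻¹, by simp [mul_smul]⟩
    · rw [← he, U.equivariant _ _ hx0 hxD, U.equivariant _ _ hz hD, hxz]
  · intro k hk x hx
    obtain ⟨a, ha, ha0, hinv, rfl⟩ := (hS x).1 hx
    rw [U.actD.op_conj U.good hu k ha]
    refine mulOp_congr ?_
    filter_upwards [hinv, U.good.ae] with z h1 hz
    by_cases hD : z ∈ D
    · rw [indicator_of_mem hD]
      obtain ⟨e, he⟩ := U.actD.orbit k⁻¹ z hz hD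
      exact (h1 hD _ ⟨e, he.symm⟩ (U.actD.mem _ z hz hD)
        (U.twist_ker (inv_mem hk) hz hD)).symm
    · rw [indicator_of_notMem hD, ha0 z hD]
  · rintro h ⟨g, rfl⟩ y ⟨α, hα, hα0, rfl⟩
    rw [U.actC.op_conj U.good hV _ hα]
    have hm := memLp_top_comp G U.actC.measurableSet (U.actC.measurable (δ g)⁻¹)
      (U.actC.ae_orbit U.good _) hα
    refine ⟨W.indicator (C.indicator fun z => α (t (δ g)⁻¹ z)), hm.indicator U.measurableSet_range,
      fun z hz => indicator_of_notMem hz _, mulOp_congr ?_⟩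
    filter_upwards [U.good.ae] with z hz
    by_cases hzW : z ∈ W
    · rw [indicator_of_mem hzW]
    · rw [indicator_of_notMem hzW]
      by_cases hC : z ∈ C
      · rw [indicator_of_mem hC]
        refine hα0 _ fun h => hzW ?_
        have := U.smul_mem_range g (U.actC.mem_good U.good _ hz hC) h
        rwa [U.actC.apply_inv _ hz hC] at this
      · rw [indicator_of_notMem hC]
  · intro g x hx
    simp only [scaledAd, mul_smul_comm, smul_mul_assoc]
    congr 1
    rw [mul_assoc, mul_assoc, mul_assoc, hustar g, ← mul_assoc, hustar' g]
    simp only [mul_assoc]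

include hu in
/-- If the fibres are the orbits of the kernel `K` of `δ`, then `b b^* = Σ_{k ∈ K} u_k`. -/
theorem mul_star_self (hK : ∀ z ∈ Z₀, z ∈ D → ∀ x ∈ MulAction.orbit G z, x ∈ D →
    twist t v x = twist t v z → ∃ k ∈ δ.ker, x = s k z) :
    b * star b = ∑ᶠ k : δ.ker, u k := by
  have := U.finite_ker
  have : Fintype δ.ker := Fintype.ofFinite _
  rw [finsum_eq_sum_of_fintype]
  have hDm := U.actD.measurableSet
  -- On `D' a` the map is translation by `a⁻¹`, so `b^* χ_{D' a}` is a canonical unitary times a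
  -- projection. It suffices to compare both sides after cutting by each `D' a`.
  let D' : G → Set Z := fun a => {z | z ∈ D ∧ twist t v z = a⁻¹ • z}
  have hD' : ∀ a, MeasurableSet (D' a) := measurableSet_canonical hDm U.measurable_twist
  have hact := isPartialAction_smul U.good
  have hcan : ∀ g : G, Implements (canU m g) univ (fun z => g⁻¹ • z) :=
    implements_canU U.good.ae_free
  have hstar : ∀ a, star b * proj G m (D' a) = canU m a⁻¹ * proj G m (D' a) := by
    intro a
    have h := congrArg star (hb.proj_mul_eq hDm U.measurable_twist a)
    rw [star_mul, star_mul, star_proj (hD' a), hact.op_star U.good hcan] at h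
    exact h
  have key : ∀ a, b * star b * proj G m (D' a) = (∑ k : δ.ker, u k) * proj G m (D' a) := by
    intro a
    rw [mul_assoc, hstar a, ← mul_assoc, Finset.sum_mul]
    have hL : Implements (b * canU m a⁻¹ * proj G m (D' a))
        {z | z ∈ {z | z ∈ D ∧ twist t v z ∈ univ} ∧ (a⁻¹)⁻¹ • twist t v z ∈ D' a}
        (fun z => id ((a⁻¹)⁻¹ • twist t v z)) := by
      refine ((hb.mul (hcan a⁻¹) U.ae_orbit).mul (implements_proj (hD' a) U.good.ae_free) ?_)
      filter_upwards [U.ae_orbit] with z hz hz'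
      obtain ⟨c, hc⟩ := hz hz'.1
      exact ⟨a⁻¹⁻¹ * c, by rw [hc, mul_smul]⟩
    have hR : ∀ k : δ.ker, Implements (u k * proj G m (D' a))
        {z | z ∈ D ∧ s (k : Γ)⁻¹ z ∈ D' a} (fun z => id (s (k : Γ)⁻¹ z)) := fun k =>
      (hu k).mul (implements_proj (hD' a) U.good.ae_free) (U.actD.ae_orbit U.good _)
    refine op_ext fun ξ => ?_
    have hRξ := ae_all_iff.2 fun k => hR k ξ
    rw [sum_apply]
    filter_upwards [hL ξ, hRξ, ae_fst U.good.ae,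
      Lp.coeFn_finsetSum Finset.univ fun k : δ.ker => (u k * proj G m (D' a)) ξ] with w h1 h2 hz h3
    rw [h3, Finset.sum_apply]
    -- The only point of the fibre of `w.1` that can lie in `D' a` is `a • twist t v w.1`.
    have hfib : ∀ k : δ.ker, w.1 ∈ {z | z ∈ D ∧ s (k : Γ)⁻¹ z ∈ D' a} →
        s (k : Γ)⁻¹ w.1 = a • twist t v w.1 := by
      rintro k ⟨hD, hk⟩
      rw [← U.twist_ker (inv_mem k.2) hz hD, hk.2, smul_inv_smul]
    by_cases hw : w.1 ∈ {z | z ∈ {z | z ∈ D ∧ twist t v z ∈ univ} ∧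
        (a⁻¹)⁻¹ • twist t v z ∈ D' a}
    · obtain ⟨⟨hD, -⟩, hDa⟩ := hw
      rw [inv_inv] at hDa
      obtain ⟨c, hc⟩ := U.twist_orbit hz hD
      obtain ⟨k, hk, hkx⟩ := hK w.1 hz hD (a • twist t v w.1) ⟨a * c, by simp [hc, mul_smul]⟩
        hDa.1 (by rw [hDa.2, inv_smul_smul])
      have hac : a • twist t v w.1 = ((a * c)⁻¹)⁻¹ • w.1 := by rw [inv_inv, hc, mul_smul]
      rw [h1.2 ⟨⟨hD, trivial⟩, by rwa [inv_inv]⟩ (a * c)⁻¹ (by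
        rw [inv_inv]; exact hac)]
      -- Exactly one summand survives, by freeness of `s`. Its index is `k⁻¹`, since `u k`
      -- implements the inverse of `s k`.
      rw [Finset.sum_eq_single ⟨k⁻¹, inv_mem hk⟩]
      · rw [(h2 ⟨k⁻¹, inv_mem hk⟩).2 ⟨hD, by simpa [← hkx] using hDa⟩ (a * c)⁻¹ (by
          simp only [inv_inv] at hac ⊢
          rw [id, ← hkx, hac])]
      · intro k' _ hk'
        refine (h2 k').1 fun h => hk' ?_
        have := hfib k' h
        rw [hkx] at this
        have := U.actD.cancel hz hD this
        exact Subtype.ext (inv_eq_iff_eq_inv.1 this)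
      · exact fun h => absurd (Finset.mem_univ _) h
    · rw [h1.1 hw, Finset.sum_eq_zero]
      intro k _
      refine (h2 k).1 fun h => hw ⟨⟨h.1, trivial⟩, ?_⟩
      rw [inv_inv, ← hfib k h]
      exact h.2
  -- The pieces `D' a` resolve `χ_D`, and both operators are unchanged by `χ_D` on the right.
  have hsum : StrongHasSum (fun a => proj G m (D' a)) (proj G m D) := by
    refine strongHasSum_proj_of_ae hD' ?_ ?_
    · filter_upwards [U.ae_orbit] with z hz
      refine ⟨fun h => ?_, fun ⟨a, ha⟩ => ha.1⟩
      obtain ⟨a, ha⟩ := hz h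
      exact ⟨a⁻¹, h, by rw [inv_inv, ha]⟩
    · filter_upwards [U.good.ae] with z hz a c ha hc
      have := U.good.smul_left_cancel hz (ha.2.symm.trans hc.2)
      exact inv_injective this
  have hp1 : b * star b * proj G m D = b * star b := by
    have := congrArg star (U.proj_mul hb)
    rw [star_mul, star_proj hDm] at this
    rw [mul_assoc, this]
  have hp2 : (∑ k : δ.ker, u k) * proj G m D = ∑ k : δ.ker, u k := by
    rw [Finset.sum_mul]
    exact Finset.sum_congr rfl fun k _ => (U.actD.op_mem_corner U.good hu k).2.2
  rw [← hp1, ← hp2]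
  refine ContinuousLinearMap.ext fun ξ => ?_
  have h1 := (hsum ξ).mapL (b * star b)
  have h2 := (hsum ξ).mapL (∑ k : δ.ker, u k)
  have h3 : (fun a => (b * star b) (proj G m (D' a) ξ))
      = fun a => (∑ k : δ.ker, u k) (proj G m (D' a) ξ) := by
    funext a
    exact congrArg (fun A : Op G m => A ξ) (key a)
  rw [h3] at h1
  exact h1.unique h2

omit hb in
include hu in
/-- The fixed point algebra of `ker δ`. -/
theorem mem_fixedAlg_iff [SigmaFinite m] (hK : ∀ z ∈ Z₀, z ∈ D → ∀ x ∈ MulAction.orbit G z, x ∈ D →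
    twist t v x = twist t v z → ∃ k ∈ δ.ker, x = s k z) (x : Op G m) :
    x ∈ fixedAlg δ.ker u (linf G m D) ↔ ∃ a : Z → ℂ, MemLp a ⊤ m ∧ (∀ z ∉ D, a z = 0) ∧
      (∀ᵐ z ∂m, z ∈ D → ∀ x ∈ MulAction.orbit G z, x ∈ D → twist t v x = twist t v z →
        a z = a x) ∧ x = mulOp G m a := by
  constructor
  · rintro ⟨⟨a, ha, ha0, rfl⟩, h⟩
    refine ⟨a, ha, ha0, ?_, rfl⟩
    have := U.finite_ker
    have : Inhabited G := ⟨1⟩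
    have h1 : ∀ k : δ.ker, ∀ᵐ z ∂m, z ∈ D → a (s (k : Γ)⁻¹ z) = a z := by
      intro k
      have h2 := h k k.2
      rw [U.actD.op_conj U.good hu _ ha] at h2
      have h3 := mulOp_injective (memLp_top_comp G U.actD.measurableSet (U.actD.measurable _)
        (U.actD.ae_orbit U.good _) ha) ha h2
      filter_upwards [h3] with z hz hD
      rw [← hz, indicator_of_mem hD]
    filter_upwards [ae_all_iff.2 h1, U.good.ae] with z hz hz0 hD x hx hxD hxz
    obtain ⟨k, hk, rfl⟩ := hK z hz0 hD x hx hxD hxz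
    have := hz ⟨k⁻¹, inv_mem hk⟩ hD
    simpa using this.symm
  · rintro ⟨a, ha, ha0, hinv, rfl⟩
    refine ⟨⟨a, ha, ha0, rfl⟩, fun k hk => ?_⟩
    rw [U.actD.op_conj U.good hu k ha]
    refine mulOp_congr ?_
    filter_upwards [hinv, U.good.ae] with z h1 hz
    by_cases hD : z ∈ D
    · rw [indicator_of_mem hD]
      obtain ⟨e, he⟩ := U.actD.orbit k⁻¹ z hz hD
      exact (h1 hD _ ⟨e, he.symm⟩ (U.actD.mem _ z hz hD)
        (U.twist_ker (inv_mem hk) hz hD)).symm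
    · rw [indicator_of_notMem hD, ha0 z hD]

end IsUntwisting

end Untwisting

/-! ### Extension of partial isomorphisms to elements of the full group -/

section Extension

variable {Z : Type*} [MeasurableSpace Z]

/-- On `Z₀`, `ψ` is a bijection of `D` onto `W`, with inverse `χ` and with graph in the orbit
relation of `G`. -/
structure IsPartialIso (G : Type*) [Group G] [MulAction G Z] (Z₀ D W : Set Z) (ψ χ : Z → Z) :
    Prop where
  measurable : Measurable ψ
  measurable_inv : Measurable χ
  measurableSet : MeasurableSet D
  measurableSet_range : MeasurableSet W
  orbit : ∀ z ∈ Z₀, z ∈ D → ∃ a : G, ψ z = a • z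
  mem : ∀ z ∈ Z₀, z ∈ D → ψ z ∈ W
  left_inv : ∀ z ∈ Z₀, z ∈ D → χ (ψ z) = z
  orbit_inv : ∀ z ∈ Z₀, z ∈ W → ∃ a : G, χ z = a • z
  mem_inv : ∀ z ∈ Z₀, z ∈ W → χ z ∈ D
  right_inv : ∀ z ∈ Z₀, z ∈ W → ψ (χ z) = z

variable {G : Type*} [Group G] [MulAction G Z] {m : Measure Z} {Z₀ D W C : Set Z} {ψ χ : Z → Z}

theorem IsPartialIso.symm (h : IsPartialIso G Z₀ D W ψ χ) : IsPartialIso G Z₀ W D χ ψ where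
  measurable := h.measurable_inv
  measurable_inv := h.measurable
  measurableSet := h.measurableSet_range
  measurableSet_range := h.measurableSet
  orbit := h.orbit_inv
  mem := h.mem_inv
  left_inv := h.right_inv
  orbit_inv := h.orbit
  mem_inv := h.mem
  right_inv := h.left_inv

open scoped Classical in
/-- The first point of `z, χ z, χ² z, …` which is not in `W`, if there is one. -/
noncomputable def chainEnd (W : Set Z) (χ : Z → Z) (z : Z) : Z :=
  if h : ∃ n, χ^[n] z ∉ W then χ^[Nat.find h] z else z

theorem measurable_chainEnd (hW : MeasurableSet W) (hχ : Measurable χ) :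
    Measurable (chainEnd W χ) := by
  classical
  -- As the search must be total, chains that never leave `W` stop at `0`, in accordance with the
  -- default value in `chainEnd`.
  let p : ℕ → Z → Prop := fun n z => χ^[n] z ∉ W ∨ ∀ k, χ^[k] z ∈ W
  have hp : ∀ z, ∃ n, p n z := fun z => by
    by_cases h : ∃ n, χ^[n] z ∉ W
    · exact ⟨h.choose, Or.inl h.choose_spec⟩
    · push Not at h
      exact ⟨0, Or.inr h⟩
  have hm : ∀ n, MeasurableSet {z | χ^[n] z ∈ W} := fun n => hχ.iterate n hW
  have h1 : Measurable fun z => χ^[Nat.find (hp z)] z := by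
    refine Measurable.find (f := fun n z => χ^[n] z) (fun n => hχ.iterate n) (p := p)
      (fun n => ?_) hp
    have h2 : MeasurableSet {z : Z | ∀ k, χ^[k] z ∈ W} := by
      have : {z : Z | ∀ k, χ^[k] z ∈ W} = ⋂ k, {z | χ^[k] z ∈ W} := by
        ext z
        simp
      exact this ▸ MeasurableSet.iInter hm
    exact (hm n).compl.union h2
  convert h1 using 1
  funext z
  rw [chainEnd]
  split_ifs with h
  · congr 2
    have h3 : ∀ n, χ^[n] z ∉ W ↔ p n z := fun n => by
      refine ⟨Or.inl, fun h' => h'.resolve_right fun h'' => ?_⟩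
      obtain ⟨k, hk⟩ := h
      exact hk (h'' k)
    simp only [h3]
  · push Not at h
    have : Nat.find (hp z) = 0 := by
      rw [Nat.find_eq_zero]
      exact Or.inr h
    rw [this]; rfl

theorem chainEnd_eq {z : Z} {n : ℕ} (hn : χ^[n] z ∉ W) (hlt : ∀ j < n, χ^[j] z ∈ W) :
    chainEnd W χ z = χ^[n] z := by
  classical
  have h : ∃ n, χ^[n] z ∉ W := ⟨n, hn⟩
  rw [chainEnd, dif_pos h]
  congr 1
  exact (Nat.find_eq_iff h).2 ⟨hn, fun j hj => not_not.2 (hlt j hj)⟩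

theorem IsPartialIso.iterate_inv_mem (h : IsPartialIso G Z₀ D W ψ χ) (hZ : IsGoodSet G m Z₀)
    (hDC : D ⊆ C) {z : Z} (hz : z ∈ Z₀) (hzC : z ∈ C) {n : ℕ} (hn : ∀ j < n, χ^[j] z ∈ W) :
    (∃ a : G, χ^[n] z = a • z) ∧ χ^[n] z ∈ Z₀ ∧ χ^[n] z ∈ C := by
  induction n with
  | zero => exact ⟨⟨1, (one_smul G z).symm⟩, hz, hzC⟩
  | succ n ih =>
    obtain ⟨⟨a, ha⟩, h1, -⟩ := ih fun j hj => hn j (hj.trans n.lt_succ_self)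
    have hW := hn n n.lt_succ_self
    obtain ⟨c, hc⟩ := h.orbit_inv _ h1 hW
    rw [Function.iterate_succ_apply']
    exact ⟨⟨c * a, by rw [hc, ha, mul_smul]⟩, hc ▸ hZ.smul_mem c _ h1,
      hDC (h.mem_inv _ h1 hW)⟩

theorem IsPartialIso.iterate_iterate_inv (h : IsPartialIso G Z₀ D W ψ χ) (hZ : IsGoodSet G m Z₀)
    {z : Z} (hz : z ∈ Z₀) {n : ℕ} (hn : ∀ j < n, χ^[j] z ∈ W) {j : ℕ} (hj : j ≤ n) :
    ψ^[j] (χ^[n] z) = χ^[n - j] z := by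
  induction j with
  | zero => rfl
  | succ j ih =>
    have hlt : n - (j + 1) < n := by omega
    obtain ⟨-, h1, -⟩ := h.iterate_inv_mem hZ (subset_univ D) hz trivial (n := n - (j + 1))
      fun i hi => hn i (hi.trans hlt)
    rw [Function.iterate_succ_apply', ih (by omega), show n - j = n - (j + 1) + 1 by omega,
      Function.iterate_succ_apply', h.right_inv _ h1 (hn _ hlt)]

/-- Going back along a chain. -/
theorem IsPartialIso.chainEnd_chainEnd (h : IsPartialIso G Z₀ D W ψ χ) (hZ : IsGoodSet G m Z₀)
    (hDC : D ⊆ C) {z : Z} (hz : z ∈ Z₀) (hzC : z ∈ C) (hzD : z ∉ D)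
    (hfin : ∃ n, χ^[n] z ∉ W) :
    (∃ a : G, chainEnd W χ z = a • z) ∧ chainEnd W χ z ∈ C ∧ chainEnd W χ z ∉ W ∧
      chainEnd D ψ (chainEnd W χ z) = z := by
  classical
  have hn : ∀ j < Nat.find hfin, χ^[j] z ∈ W := fun j hj => not_not.1 (Nat.find_min hfin hj)
  have hs := Nat.find_spec hfin
  set n := Nat.find hfin
  obtain ⟨h1, h2, h3⟩ := h.iterate_inv_mem hZ hDC hz hzC hn
  rw [chainEnd_eq hs hn]
  refine ⟨h1, h3, hs, ?_⟩
  have h4 : ψ^[n] (χ^[n] z) = z := by rw [h.iterate_iterate_inv hZ hz hn le_rfl, Nat.sub_self]; rfl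
  rw [chainEnd_eq (n := n) (by rwa [h4]), h4]
  -- Before step `n` the point `χ^[n - j] z` is a value of `χ`, hence in `D`; the point `z` reached
  -- at step `n` is not. So the reversed chain stops exactly at `z`.
  intro j hj
  rw [h.iterate_iterate_inv hZ hz hn hj.le, show n - j = n - j - 1 + 1 by omega,
    Function.iterate_succ_apply']
  have hlt : n - j - 1 < n := by omega
  obtain ⟨-, h5, -⟩ := h.iterate_inv_mem hZ (subset_univ D) hz trivial (n := n - j - 1)
    fun i hi => hn i (hi.trans hlt)
  exact h.mem_inv _ h5 (hn _ hlt)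

variable [Countable G] [MeasurableSpace G] [DiscreteMeasurableSpace G]
  [MeasurableConstSMul G Z] [SFinite m] [SMulInvariantMeasure G Z m] [MeasurableEq Z]

/-- The multiplicity of `ψ` is the indicator of `W`, so the change of variables applied to the
indicator of `R` gives the equality. -/
theorem IsPartialIso.measure_preimage (h : IsPartialIso G Z₀ D W ψ χ) (hZ : IsGoodSet G m Z₀)
    {R : Set Z} (hR : MeasurableSet R) : m (D ∩ ψ ⁻¹' R) = m (W ∩ R) := by
  have ho : ∀ᵐ z ∂m, z ∈ D → ∃ a : G, ψ z = a • z := by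
    filter_upwards [hZ.ae] with z hz hD using h.orbit z hz hD
  have h1 := setLIntegral_comp_eq (m := m) (F := R.indicator 1) h.measurableSet h.measurable
    hZ.ae_free ho (measurable_one.indicator hR)
  have h2 : ∫⁻ z in D, R.indicator 1 (ψ z) ∂m = m (D ∩ ψ ⁻¹' R) := by
    have : (fun z => R.indicator (1 : Z → ℝ≥0∞) (ψ z)) = (ψ ⁻¹' R).indicator 1 := by
      funext z
      by_cases hz : ψ z ∈ R
      · rw [indicator_of_mem hz, indicator_of_mem (by exact hz)]; rfl
      · rw [indicator_of_notMem hz, indicator_of_notMem (by exact hz)]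
    rw [this, lintegral_indicator_one (h.measurable hR),
      Measure.restrict_apply (h.measurable hR), inter_comm]
  have h3 : ∫⁻ z, (multiplicity G D ψ z : ℝ≥0∞) * R.indicator 1 z ∂m = m (W ∩ R) := by
    rw [← lintegral_indicator_one (h.measurableSet_range.inter hR)]
    refine lintegral_congr_ae ?_
    filter_upwards [hZ.ae] with z hz
    have hmult : multiplicity G D ψ z = W.indicator (fun _ => ((1 : ℕ) : ℕ∞)) z := by
      rw [hZ.multiplicity_eq hz]
      by_cases hW : z ∈ W
      · rw [indicator_of_mem hW, Nat.cast_one, encard_eq_one]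
        refine ⟨χ z, ?_⟩
        ext x
        constructor
        · rintro ⟨⟨a, rfl⟩, h1, h2⟩
          have := h.left_inv _ (hZ.smul_mem a z hz) h1
          simp only at h2 this
          rw [h2] at this
          exact this.symm
        · rintro rfl
          refine ⟨?_, h.mem_inv z hz hW, h.right_inv z hz hW⟩
          obtain ⟨a, ha⟩ := h.orbit_inv z hz hW
          exact ⟨a, ha.symm⟩
      · rw [indicator_of_notMem hW, encard_eq_zero]
        ext x
        simp only [mem_ofPred_eq, mem_empty_iff_false, iff_false, not_and]
        rintro ⟨a, rfl⟩ h1 h2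
        exact hW (h2 ▸ h.mem _ (hZ.smul_mem a z hz) h1)
    rw [hmult]
    by_cases hW : z ∈ W <;> by_cases hR : z ∈ R <;> simp [hW, hR]
  rw [← h2, h1, h3]

/-- Since the measure of `C` is finite, almost every chain which starts outside of `D` leaves
`W`. -/
theorem IsPartialIso.ae_exists_notMem (h : IsPartialIso G Z₀ D W ψ χ) (hZ : IsGoodSet G m Z₀)
    (hC : MeasurableSet C) (hDC : D ⊆ C) (hfin : m C ≠ ⊤) :
    ∀ᵐ z ∂m, z ∈ C → z ∉ D → ∃ n, χ^[n] z ∉ W := by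
  -- `B` is the set of bad starting points and `R n` its `n`-th preimage under `ψ`. The `R n` are
  -- disjoint, lie in `C` and all have the measure of `B`, so `B` is null.
  let B : Set Z := {z | (z ∈ C ∧ z ∉ D) ∧ ∀ k, χ^[k] z ∈ W}
  have hB : MeasurableSet B := by
    have : B = (C \ D) ∩ ⋂ k, χ^[k] ⁻¹' W := by
      ext z
      simp [B]
    rw [this]
    exact (hC.diff h.measurableSet).inter (MeasurableSet.iInter fun k =>
      h.measurable_inv.iterate k h.measurableSet_range)
  let R : ℕ → Set Z := fun n => {z | (∀ j < n, ψ^[j] z ∈ D) ∧ ψ^[n] z ∈ B}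
  have hR0 : R 0 = B := by ext z; simp [R]
  have hRsucc : ∀ n, R (n + 1) = D ∩ ψ ⁻¹' R n := by
    intro n
    ext z
    constructor
    · rintro ⟨h1, h2⟩
      exact ⟨h1 0 n.succ_pos, fun j hj => h1 (j + 1) (by omega), h2⟩
    · rintro ⟨h0, h1, h2⟩
      refine ⟨fun j hj => ?_, h2⟩
      cases j with
      | zero => exact h0
      | succ j => exact h1 j (by omega)
  have hRm : ∀ n, MeasurableSet (R n) := by
    intro n
    induction n with
    | zero => rwa [hR0]
    | succ n ih =>
      rw [hRsucc]
      exact h.measurableSet.inter (h.measurable ih)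
  have hRC : ∀ n, R n ⊆ C := by
    intro n
    cases n with
    | zero => rw [hR0]; exact fun z hz => hz.1.1
    | succ n => rw [hRsucc]; exact fun z hz => hDC hz.1
  -- Backward chains from `R n` stay in `W` as well. Hence `R n` lies in the range of `ψ` up to a
  -- null set, and taking the preimage loses no measure.
  have hRW : ∀ n, ∀ z ∈ Z₀, z ∈ R n → ∀ k, χ^[k] z ∈ W := by
    intro n
    induction n with
    | zero =>
      intro z _ hz
      rw [hR0] at hz
      exact hz.2
    | succ n ih =>
      intro z hz0 hz k
      rw [hRsucc] at hz
      obtain ⟨a, ha⟩ := h.orbit z hz0 hz.1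
      have := ih (ψ z) (ha ▸ hZ.smul_mem a z hz0) hz.2 (k + 1)
      rwa [Function.iterate_succ_apply, h.left_inv z hz0 hz.1] at this
  have hmeas : ∀ n, m (R n) = m B := by
    intro n
    induction n with
    | zero => rw [hR0]
    | succ n ih =>
      rw [hRsucc, h.measure_preimage hZ (hRm n), ← ih]
      refine measure_congr ?_
      filter_upwards [hZ.ae] with z hz
      exact propext ⟨fun hz' => hz'.2, fun hz' => ⟨hRW n z hz hz' 0, hz'⟩⟩
  -- For `i < j`, points of `R j` have `ψ^[i] z` in `D`, while points of `R i` have it in `B`,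
  -- outside `D`.
  have hdisj : Pairwise (Function.onFun Disjoint R) := by
    have key : ∀ i j, i < j → Disjoint (R i) (R j) := fun i j hij =>
      disjoint_left.2 fun z hz hz' => hz.2.1.2 (hz'.1 i hij)
    intro i j hij
    rcases lt_or_gt_of_ne hij with h | h
    · exact key i j h
    · exact (key j i h).symm
  have hB0 : m B = 0 := by
    by_contra hne
    refine hfin (top_le_iff.1 ?_)
    calc ⊤ = ∑' _ : ℕ, m B := (ENNReal.tsum_const_eq_top_of_ne_zero hne).symm
      _ = ∑' n, m (R n) := by simp_rw [hmeas]
      _ = m (⋃ n, R n) := (measure_iUnion hdisj hRm).symm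
      _ ≤ m C := measure_mono (iUnion_subset hRC)
  filter_upwards [measure_eq_zero_iff_ae_notMem.1 hB0] with z hz hzC hzD
  by_contra! hcon
  exact hz ⟨⟨hzC, hzD⟩, hcon⟩

open scoped Classical in
/-- A partial isomorphism with graph in the orbit relation extends to an element of the full
group. -/
theorem IsPartialIso.exists_extension (h : IsPartialIso G Z₀ D W ψ χ) (hZ : IsGoodSet G m Z₀)
    (hC : MeasurableSet C) (hDC : D ⊆ C) (hWC : W ⊆ C) (hfin : m C ≠ ⊤) :
    ∃ φ : Z → Z, Measurable φ ∧ IsInFullGroup (orbitRelOn G C) (m.restrict C) φ ∧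
      (∀ᵐ z ∂m, z ∈ C → ∃ a : G, φ z = a • z) ∧
      (∀ z ∈ D, φ z = ψ z) ∧ ∀ᵐ z ∂m.restrict C, z ∈ D ↔ φ z ∈ W := by
  have h' := h.symm
  -- `ψ` takes `D` to `W`, and chain ends take the complement of `D` in `C` to the complement of
  -- `W`. Exchanging the roles of `ψ` and `χ` gives the inverse.
  set φ : Z → Z := D.piecewise ψ (chainEnd W χ) with hφ
  set φ' : Z → Z := W.piecewise χ (chainEnd D ψ) with hφ'
  let Z₁ : Set Z := {z | z ∈ Z₀ ∧ ∀ g : G, (g • z ∈ C → g • z ∉ D → ∃ n, χ^[n] (g • z) ∉ W) ∧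
    (g • z ∈ C → g • z ∉ W → ∃ n, ψ^[n] (g • z) ∉ D)}
  have hZ₁ : IsGoodSet G m Z₁ := by
    refine ⟨?_, ?_, fun z hz => hZ.free z hz.1⟩
    · filter_upwards [hZ.ae, ae_all_smul G (h.ae_exists_notMem hZ hC hDC hfin),
        ae_all_smul G (h'.ae_exists_notMem hZ hC hWC hfin)] with z h1 h2 h3
      exact ⟨h1, fun g => ⟨h2 g, h3 g⟩⟩
    · rintro g z ⟨h1, h2⟩
      refine ⟨hZ.smul_mem g z h1, fun g' => ?_⟩
      rw [← mul_smul]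
      exact h2 (g' * g)
  have hφC : ∀ z ∈ Z₁, z ∈ C → (∃ a : G, φ z = a • z) ∧ φ z ∈ C ∧ φ' (φ z) = z ∧
      (z ∈ D ↔ φ z ∈ W) := by
    rintro z ⟨hz, hz'⟩ hzC
    by_cases hD : z ∈ D
    · have h1 : φ z = ψ z := piecewise_eq_of_mem _ _ _ hD
      have hW := h.mem z hz hD
      rw [h1, hφ', piecewise_eq_of_mem _ _ _ hW]
      exact ⟨h.orbit z hz hD, hWC hW, h.left_inv z hz hD, fun _ => hW, fun _ => hD⟩
    · have h1 : φ z = chainEnd W χ z := piecewise_eq_of_notMem _ _ _ hD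
      have h2 := (hz' 1).1
      rw [one_smul] at h2
      obtain ⟨h3, h4, h5, h6⟩ := h.chainEnd_chainEnd hZ hDC hz hzC hD (h2 hzC hD)
      rw [h1, hφ', piecewise_eq_of_notMem _ _ _ h5]
      exact ⟨h3, h4, h6, fun h => absurd h hD, fun h => absurd h h5⟩
  have hφC' : ∀ z ∈ Z₁, z ∈ C → (∃ a : G, φ' z = a • z) ∧ φ' z ∈ C ∧ φ (φ' z) = z := by
    rintro z ⟨hz, hz'⟩ hzC
    by_cases hW : z ∈ W
    · have h1 : φ' z = χ z := piecewise_eq_of_mem _ _ _ hW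
      have hD := h.mem_inv z hz hW
      rw [h1, hφ, piecewise_eq_of_mem _ _ _ hD]
      exact ⟨h.orbit_inv z hz hW, hDC hD, h.right_inv z hz hW⟩
    · have h1 : φ' z = chainEnd D ψ z := piecewise_eq_of_notMem _ _ _ hW
      have h2 := (hz' 1).2
      rw [one_smul] at h2
      obtain ⟨h3, h4, h5, h6⟩ := h'.chainEnd_chainEnd hZ hWC hz hzC hW (h2 hzC hW)
      rw [h1, hφ, piecewise_eq_of_notMem _ _ _ h5]
      exact ⟨h3, h4, h6⟩
  have hiso : IsPartialIso G Z₁ C C φ φ' :=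
    { measurable := h.measurable.piecewise h.measurableSet
        (measurable_chainEnd h.measurableSet_range h.measurable_inv)
      measurable_inv := h.measurable_inv.piecewise h.measurableSet_range
        (measurable_chainEnd h.measurableSet h.measurable)
      measurableSet := hC
      measurableSet_range := hC
      orbit := fun z hz hzC => (hφC z hz hzC).1
      mem := fun z hz hzC => (hφC z hz hzC).2.1
      left_inv := fun z hz hzC => (hφC z hz hzC).2.2.1
      orbit_inv := fun z hz hzC => (hφC' z hz hzC).1
      mem_inv := fun z hz hzC => (hφC' z hz hzC).2.1
      right_inv := fun z hz hzC => (hφC' z hz hzC).2.2 }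
  have hmp : ∀ {f f' : Z → Z}, IsPartialIso G Z₁ C C f f' →
      MeasurePreserving f (m.restrict C) (m.restrict C) := by
    intro f f' hf
    refine ⟨hf.measurable, Measure.ext fun R hR => ?_⟩
    rw [Measure.map_apply hf.measurable hR, Measure.restrict_apply (hf.measurable hR),
      Measure.restrict_apply hR, inter_comm, hf.measure_preimage hZ₁ hR, inter_comm]
  refine ⟨φ, hiso.measurable, ⟨hmp hiso, ⟨φ', hmp hiso.symm, ?_, ?_⟩, ?_⟩, ?_,
    fun z hz => piecewise_eq_of_mem _ _ _ hz, ?_⟩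
  · rw [ae_restrict_iff' hC]
    filter_upwards [hZ₁.ae] with z hz hzC using (hφC z hz hzC).2.2.1
  · rw [ae_restrict_iff' hC]
    filter_upwards [hZ₁.ae] with z hz hzC using (hφC' z hz hzC).2.2
  · rw [ae_restrict_iff' hC]
    filter_upwards [hZ₁.ae] with z hz hzC
    obtain ⟨a, ha⟩ := (hφC z hz hzC).1
    exact ⟨hzC, (hφC z hz hzC).2.1, ⟨a, ha.symm⟩⟩
  · filter_upwards [hZ₁.ae] with z hz hzC using (hφC z hz hzC).1
  · rw [ae_restrict_iff' hC]
    filter_upwards [hZ₁.ae] with z hz hzC using (hφC z hz hzC).2.2.2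

end Extension

/-! ### ### Injective untwistings and the full group -/

section InjectiveCase

variable {Z : Type*} [MeasurableSpace Z] {Γ Λ : Type*} [Group Γ] [Group Λ] [Countable Λ]
  [MeasurableSpace Λ] [DiscreteMeasurableSpace Λ]
  {G : Type*} [Group G] [MulAction G Z] {m : Measure Z} {Z₀ D C : Set Z} {s : Γ → Z → Z}
  {t : Λ → Z → Z} {δ : Γ →* Λ} {v : Z → Λ}
  [Countable G] [MeasurableSpace G] [DiscreteMeasurableSpace G]
  [MeasurableConstSMul G Z] [SFinite m] [SMulInvariantMeasure G Z m] [MeasurableEq Z]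

/-- If `twist t v` is injective, it extends to an element of the full group. -/
theorem IsUntwisting.exists_fullGroup (U : IsUntwisting G m Z₀ D C s t δ v 1) (hfin : m C ≠ ⊤)
    {b : Op G m} (hb : Implements b D (twist t v)) :
    ∃ φ : Z → Z, IsInFullGroup (orbitRelOn G C) (m.restrict C) φ ∧
      (∀ᵐ z ∂m.restrict C, z ∈ D ↔ φ z ∈ twistRange G D C t v 1) ∧
      (∀ a : Z → ℂ, MemLp a ⊤ m → star b * mulOp G m (D.indicator fun z => a (φ z)) * b =
        mulOp G m ((twistRange G D C t v 1).indicator a)) ∧ ∀ z ∈ D, φ z = twist t v z := by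
  obtain ⟨r, hr, hsec⟩ := U.exists_section
  have hiso : IsPartialIso G Z₀ D (twistRange G D C t v 1) (twist t v) r :=
    { measurable := U.measurable_twist
      measurable_inv := hr
      measurableSet := U.actD.measurableSet
      measurableSet_range := U.measurableSet_range
      orbit := fun z hz hD => U.twist_orbit hz hD
      mem := fun z hz hD => U.twist_mem_range hz hD
      -- For `n = 1` the fibre through `z` is a singleton, so the section returns `z`.
      left_inv := fun z hz hD => by
        obtain ⟨x, hx⟩ := encard_eq_one.1 ((U.fibre_encard hz hD).trans Nat.cast_one)
        obtain ⟨⟨a, ha⟩, h2, h3⟩ := hsec _ (U.twist_mem_range hz hD)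
        obtain ⟨c, hc⟩ := U.twist_orbit hz hD
        have h4 : r (twist t v z) ∈ ({x} : Set Z) :=
          hx ▸ ⟨⟨a * c, show (a * c) • z = _ by rw [ha, hc, mul_smul]⟩, h2, h3⟩
        have h5 : z ∈ ({x} : Set Z) := hx ▸ ⟨⟨1, one_smul G z⟩, hD, rfl⟩
        exact h4.trans h5.symm
      orbit_inv := fun z _ hW => (hsec z hW).1
      mem_inv := fun z _ hW => (hsec z hW).2.1
      right_inv := fun z _ hW => (hsec z hW).2.2 }
  obtain ⟨φ, -, h1, -, h3, h4⟩ := hiso.exists_extension U.good U.actC.measurableSet U.subset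
    (fun z hz => hz.1) hfin
  refine ⟨φ, h1, h4, fun a ha => ?_, h3⟩
  have hm : MemLp (D.indicator fun z => a (φ z)) ⊤ m := by
    have : (D.indicator fun z => a (φ z)) = D.indicator fun z => a (twist t v z) := by
      funext z
      by_cases hz : z ∈ D
      · rw [indicator_of_mem hz, indicator_of_mem hz, h3 z hz]
      · rw [indicator_of_notMem hz, indicator_of_notMem hz]
    rw [this]
    exact U.memLp_comp_twist ha
  have ha' := ha.indicator U.measurableSet_range
  have := U.scaledAd_eq hb (hb.mulOp_mul U.ae_orbit hm ha' (by
      filter_upwards [U.good.ae] with z hz hD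
      rw [indicator_of_mem hD, indicator_of_mem (U.twist_mem_range hz hD), h3 z hD]))
    (proj_mul_mulOp U.measurableSet_range ha' fun z hz => indicator_of_notMem hz _)
  simpa [scaledAd] using this

end InjectiveCase

/-! ### Ergodicity of weakly mixing actions -/

/-- Weak mixing is applied to the single function `χ_A - μ(A)`. Invariance makes its correlation
with its translates independent of `g`, equal to `c - c²` with `c = μ(A)`; as it is arbitrarily
small, `c` is `0` or `1`. -/
theorem WeakMixing.measure_eq_zero_or {Γ X : Type*} [MeasurableSpace X] [Group Γ] [MulAction Γ X]
    {μ : Measure X} [IsProbabilityMeasure μ] (hwm : WeakMixing Γ μ) {A : Set X}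
    (hA : MeasurableSet A) (hinv : ∀ g : Γ, ∀ᵐ t ∂μ, g • t ∈ A ↔ t ∈ A) :
    μ A = 0 ∨ μ Aᶜ = 0 := by
  set c : ℝ := μ.real A with hc
  let f : X → ℂ := fun x => A.indicator 1 x - c
  have hind : Integrable (A.indicator (1 : X → ℂ)) μ :=
    (integrable_const (1 : ℂ)).indicator hA
  have hint : ∫ x, A.indicator (1 : X → ℂ) x ∂μ = c := by
    have : ∫ x, A.indicator (fun _ => (1 : ℂ)) x ∂μ = c := by
      rw [integral_indicator_const _ hA]; simp [hc]
    exact this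
  have hf0 : ∫ x, f x ∂μ = 0 := by
    simp only [f]
    rw [integral_sub hind (integrable_const _), hint]
    simp
  have hfm : MemLp f ⊤ μ := (memLp_indicator_one hA).sub (memLp_top_const _)
  have hval : ∀ g : Γ, ∫ z, conj (f z) * f (g⁻¹ • z) ∂μ = ((c - c ^ 2 : ℝ) : ℂ) := by
    intro g
    have h1 : ∫ z, conj (f z) * f (g⁻¹ • z) ∂μ
        = ∫ z, ((1 - 2 * c : ℂ) * A.indicator (1 : X → ℂ) z + c ^ 2) ∂μ := by
      refine integral_congr_ae ?_
      filter_upwards [hinv g⁻¹] with z hz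
      have : f (g⁻¹ • z) = f z := by
        by_cases h : z ∈ A
        · simp [f, h, hz.2 h]
        · simp [f, h, mt hz.1 h]
      rw [this]
      by_cases h : z ∈ A
      · simp only [f, h, indicator_of_mem, Pi.one_apply, map_sub, map_one, Complex.conj_ofReal]
        ring
      · simp only [f, h, not_false_eq_true, indicator_of_notMem, map_sub, map_zero,
          Complex.conj_ofReal]
        ring
    rw [h1, integral_add (hind.const_mul _) (integrable_const _), integral_const_mul, hint]
    simp
    ring
  have hle : ∀ ε : ℝ, 0 < ε → |c - c ^ 2| ≤ ε := by
    intro ε hε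
    obtain ⟨g, hg⟩ := hwm {f} (by simpa using ⟨hfm, hf0⟩) ε hε
    have := hg f (by simp) f (by simp)
    rwa [hval, Complex.norm_real, Real.norm_eq_abs] at this
  have hzero : c - c ^ 2 = 0 := by
    rw [← abs_eq_zero]
    exact le_antisymm (le_of_forall_pos_le_add fun ε hε => by simpa using hle ε hε) (abs_nonneg _)
  have : c * (1 - c) = 0 := by rw [← hzero]; ring
  rcases mul_eq_zero.1 this with h | h
  · left
    rwa [hc, measureReal_eq_zero_iff] at h
  · right
    rw [prob_compl_eq_zero_iff hA]
    have h1 : μ.real A = 1 := by linarith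
    rw [measureReal_def, ENNReal.toReal_eq_one_iff] at h1
    exact h1

/-! ### Existence of amplifications -/

theorem prod_count_apply {X ι : Type*} [MeasurableSpace X] [MeasurableSpace ι] [Countable ι]
    [DiscreteMeasurableSpace ι] (μ : Measure X) [SFinite μ] {S : Set (X × ι)}
    (hS : MeasurableSet S) :
    (μ.prod (Measure.count : Measure ι)) S = ∑' j, μ {t | (t, j) ∈ S} := by
  rw [Measure.prod_apply_symm hS, lintegral_count]
  rfl

theorem ae_cond_iff {Ω : Type*} [MeasurableSpace Ω] {ρ : Measure Ω} {E : Set Ω}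
    (hE : MeasurableSet E) (hfin : ρ E ≠ ⊤) {P : Ω → Prop} :
    (∀ᵐ z ∂ρ[|E], P z) ↔ ∀ᵐ z ∂ρ, z ∈ E → P z := by
  rw [ProbabilityTheory.cond, Measure.ae_ennreal_smul_measure_iff (ENNReal.inv_ne_zero.2 hfin),
    ae_restrict_iff' hE]

/-- By ergodicity almost every `Λ`-orbit meets `Y₀`, so `Y` is cut into countably many pieces, each
moved into `Y₀` by one group element. Pulling the `j`-th piece back along `Δ` to level `j` of `X ×
ℤ` builds `X^n` and `Δ^n`. -/
theorem exists_amplification {Γ Λ X Y : Type*} [Group Γ] [Group Λ] [Countable Λ]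
    [MeasurableSpace X] [MeasurableSpace Y]
    [MulAction Γ X] [MulAction Λ Y] [MeasurableConstSMul Λ Y]
    {μ : Measure X} [IsProbabilityMeasure μ] {ν : Measure Y} [IsProbabilityMeasure ν]
    (hθ : ErgodicSMul Λ Y ν) {Y₀ : Set Y} (hY₀ : MeasurableSet Y₀)
    (hY₀pos : ν Y₀ ≠ 0) {Δ : X → Y}
    (hΔ : IsLocalOE (orbitRelOn Γ univ) (orbitRelOn Λ Y₀) μ (ν[|Y₀]) Δ) :
    Nonempty (Amplification Γ Λ μ ν Y₀ Δ) := by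
  classical
  obtain ⟨hmp, hbij⟩ := hΔ
  have hΔm := hmp.measurable
  have hsm : ∀ h : Λ, Measurable fun y : Y => h • y := fun h => measurable_const_smul h
  have htop : ν Y₀ ≠ ⊤ := measure_ne_top ν Y₀
  have hmeet : ∀ᵐ y ∂ν, ∃ h : Λ, h • y ∈ Y₀ := by
    let S : Set Y := ⋃ h : Λ, (fun y => h • y) ⁻¹' Y₀
    have hS : MeasurableSet S := MeasurableSet.iUnion fun h => hsm h hY₀
    have hinv : ∀ g : Λ, (g • ·) ⁻¹' S =ᵐ[ν] S := by
      intro g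
      refine Filter.Eventually.of_forall fun y => propext ?_
      change g • y ∈ S ↔ y ∈ S
      simp only [S, mem_iUnion, mem_preimage]
      exact ⟨fun ⟨h, hh⟩ => ⟨h * g, by rwa [mul_smul]⟩,
        fun ⟨h, hh⟩ => ⟨h * g⁻¹, by rwa [mul_smul, inv_smul_smul]⟩⟩
    rcases Filter.eventuallyConst_set'.1 (hθ.aeconst_of_forall_preimage_smul_ae_eq hS hinv)
      with h | h
    · refine absurd (measure_mono_null ?_ (ae_eq_empty.1 h)) hY₀pos
      exact fun y hy => mem_iUnion.2 ⟨1, by simpa using hy⟩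
    · filter_upwards [h] with y hy
      have : y ∈ S := hy.mpr trivial
      exact mem_iUnion.1 this
  obtain ⟨e, he⟩ := exists_surjective_nat Λ
  -- An enumeration of `Λ` by `ℤ` with value `1` at `0`. Positive indices already exhaust `Λ`; by
  -- truncated subtraction negative ones all give `e 0`, a harmless repetition.
  let η : ℤ → Λ := fun j => if j = 0 then 1 else e (j.toNat - 1)
  have hη0 : η 0 = 1 := if_pos rfl
  have hη : ∀ h, ∃ j, η j = h := fun h => by
    obtain ⟨i, rfl⟩ := he h
    refine ⟨i + 1, ?_⟩
    have h1 : ((i : ℤ) + 1) ≠ 0 := by omega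
    have h2 : ((i : ℤ) + 1).toNat - 1 = i := by omega
    simp only [η, if_neg h1, h2]
  obtain ⟨c, hc, hcS⟩ := exists_measurable_select (S := fun j : ℤ => {y | η j • y ∈ Y₀})
    fun j => hsm (η j) hY₀
  let i : Y → ℤ := Y₀.piecewise (fun _ => 0) c
  have him : Measurable i := measurable_const.piecewise hY₀ hc
  have hi0 : ∀ y ∈ Y₀, i y = 0 := fun y hy => piecewise_eq_of_mem _ _ _ hy
  have hi : ∀ y, (∃ h : Λ, h • y ∈ Y₀) → η (i y) • y ∈ Y₀ := by
    rintro y ⟨h, hh⟩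
    by_cases hy : y ∈ Y₀
    · rwa [hi0 y hy, hη0, one_smul]
    · obtain ⟨j, rfl⟩ := hη h
      rw [show i y = c y from piecewise_eq_of_notMem _ _ _ hy]
      exact hcS y j hh
  let T : X × ℤ → Y := fun z => (η z.2)⁻¹ • Δ z.1
  have hT : Measurable T :=
    measurable_select_apply (F := fun (j : ℤ) (z : X × ℤ) => (η j)⁻¹ • Δ z.1)
      (fun j => (hsm _).comp (hΔm.comp measurable_fst)) measurable_snd
  have hz0 : MeasurableSet {z : X × ℤ | z.2 = 0} := measurable_snd (measurableSet_singleton 0)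
  -- A point is kept if its level is the index selected for its image. The second alternative
  -- includes all of `X × {0}`; it only adds a null set, since `Δ` takes values in `Y₀` a.e. and `i`
  -- vanishes there.
  let E : Set (X × ℤ) := {z | i (T z) = z.2 ∨ z.2 = 0}
  have hE : MeasurableSet E :=
    (measurableSet_eq_fun (him.comp hT) measurable_snd).union hz0
  have hΔY : ∀ᵐ t ∂μ, Δ t ∈ Y₀ := by
    have : ∀ᵐ y ∂(ν[|Y₀]), y ∈ Y₀ := ae_cond_mem hY₀
    exact hmp.quasiMeasurePreserving.ae this
  -- Level `j` of `E` corresponds to the piece `{i = j}` of `Y`, with measures scaled by `(ν Y₀)⁻¹`;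
  -- summing over `j` recovers `B`.
  have hmeasure : ∀ B, MeasurableSet B →
      stabMeasure μ (E ∩ T ⁻¹' B) = (ν Y₀)⁻¹ * ν B := by
    intro B hB
    rw [prod_count_apply μ (hE.inter (hT hB))]
    have h1 : ∀ j : ℤ, μ {t | (t, j) ∈ E ∩ T ⁻¹' B} = (ν Y₀)⁻¹ * ν (B ∩ i ⁻¹' {j}) := by
      intro j
      let S : Set Y := {y | i ((η j)⁻¹ • y) = j ∧ (η j)⁻¹ • y ∈ B}
      have hS : MeasurableSet S :=
        ((him.comp (hsm _)) (measurableSet_singleton j)).inter ((hsm _) hB)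
      have h2 : μ {t | (t, j) ∈ E ∩ T ⁻¹' B} = μ (Δ ⁻¹' S) := by
        refine measure_congr ?_
        filter_upwards [hΔY] with t ht
        refine propext ⟨?_, ?_⟩
        · rintro ⟨h | h, hB⟩
          · exact ⟨h, hB⟩
          · obtain rfl : j = 0 := h
            refine ⟨?_, hB⟩
            rw [hη0, inv_one, one_smul]
            exact hi0 _ ht
        · rintro ⟨h, hB⟩
          exact ⟨Or.inl h, hB⟩
      rw [h2, hmp.measure_preimage hS.nullMeasurableSet, cond_apply hY₀]
      congr 1
      rw [← measure_preimage_smul ν (η j)]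
      refine measure_congr ?_
      filter_upwards [hmeet] with y hy
      refine propext ⟨?_, ?_⟩
      · rintro ⟨-, h3, h4⟩
        simp only [inv_smul_smul] at h3 h4
        exact ⟨h4, h3⟩
      · rintro ⟨h4, h3⟩
        obtain rfl : i y = j := h3
        refine ⟨hi y hy, ?_, ?_⟩
        · simp only [inv_smul_smul]
        · simpa only [inv_smul_smul] using h4
    simp_rw [h1]
    rw [ENNReal.tsum_mul_left, ← measure_iUnion]
    · congr 2
      ext y
      simp
    · exact fun j k hjk => disjoint_left.2 fun y hy hy' => hjk (hy.2.symm.trans hy'.2)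
    · exact fun j => hB.inter (him (measurableSet_singleton j))
  have hEm : stabMeasure μ E = (ν Y₀)⁻¹ := by
    have := hmeasure univ MeasurableSet.univ
    rwa [preimage_univ, inter_univ, measure_univ, mul_one] at this
  have hTmp : MeasurePreserving T ((stabMeasure μ)[|E]) ν := by
    refine ⟨hT, Measure.ext fun B hB => ?_⟩
    rw [Measure.map_apply hT hB, cond_apply hE, hmeasure B hB, hEm, inv_inv, ← mul_assoc,
      ENNReal.mul_inv_cancel hY₀pos htop, one_mul]
  have hmeet' : ∀ᵐ t ∂μ, ∀ k : Λ, ∃ h : Λ, h • k • Δ t ∈ Y₀ := by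
    have h1 : ∀ᵐ y ∂ν, ∀ k : Λ, ∃ h : Λ, h • k • y ∈ Y₀ := by
      filter_upwards [hmeet] with y ⟨h, hh⟩ k
      exact ⟨h * k⁻¹, by rwa [mul_smul, inv_smul_smul]⟩
    exact hmp.quasiMeasurePreserving.ae (cond_absolutelyContinuous.ae_le h1)
  refine ⟨⟨E, hE, fun z hz => Or.inr hz, hEm, T, ?_, hTmp, ?_⟩⟩
  · exact Filter.Eventually.of_forall fun t => by simp [T, hη0]
  · have h1 : ∀ᵐ z ∂stabMeasure μ, z ∈ E → BijOn T {z' | orbitRelOn (Stab Γ) E z z'}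
        {y | orbitRelOn Λ univ (T z) y} := by
      filter_upwards [ae_fst (G := ℤ) hbij, ae_fst (G := ℤ) hmeet'] with z h1 h2 hzE
      have hmem : ∀ g : Γ, Δ (g • z.1) ∈ Y₀ ∧ Δ (g • z.1) ∈ MulAction.orbit Λ (Δ z.1) :=
        fun g => (h1.mapsTo ⟨trivial, trivial, ⟨g, rfl⟩⟩).2
      have hind : ∀ (g : Γ) (j : ℤ), (g • z.1, j) ∈ E → i (T (g • z.1, j)) = j := by
        rintro g j (h | h)
        · exact h
        · obtain rfl : j = 0 := h
          have : T (g • z.1, 0) = Δ (g • z.1) := by simp [T, hη0]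
          rw [this]
          exact hi0 _ (hmem g).1
      refine ⟨?_, ?_, ?_⟩
      · rintro _ ⟨-, -, ⟨⟨g, k⟩, rfl⟩⟩
        refine ⟨trivial, trivial, ?_⟩
        obtain ⟨l, hl⟩ := (hmem g).2
        refine ⟨(η (k.toAdd + z.2))⁻¹ * l * η z.2, ?_⟩
        change ((η (k.toAdd + z.2))⁻¹ * l * η z.2) • (η z.2)⁻¹ • Δ z.1
          = (η (k.toAdd + z.2))⁻¹ • Δ (g • z.1)
        rw [mul_smul, mul_smul, smul_inv_smul, ← hl]
      · rintro _ ⟨-, h3, ⟨⟨g, k⟩, rfl⟩⟩ _ ⟨-, h4, ⟨⟨g', k'⟩, rfl⟩⟩ h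
        have h5 := hind g _ h3
        have h6 := hind g' _ h4
        change T (g • z.1, k.toAdd + z.2) = T (g' • z.1, k'.toAdd + z.2) at h
        change (g • z.1, k.toAdd + z.2) = (g' • z.1, k'.toAdd + z.2)
        -- The level of a point of `E` is recovered from its image as the selected index; after
        -- that, injectivity of `Δ` on classes applies.
        have h7 : k.toAdd + z.2 = k'.toAdd + z.2 := by rw [← h5, ← h6, h]
        rw [h7] at h ⊢
        have h8 : Δ (g • z.1) = Δ (g' • z.1) := MulAction.injective _ h
        have h9 : g • z.1 = g' • z.1 :=
          h1.injOn ⟨trivial, trivial, ⟨g, rfl⟩⟩ ⟨trivial, trivial, ⟨g', rfl⟩⟩ h8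
        rw [h9]
      · rintro y ⟨-, -, ⟨l, rfl⟩⟩
        -- To hit `l • T z`, move it into `Y₀` by its selected element, lift it through `Δ`, and
        -- place the lift on the selected level.
        have h3 : η (i (l • T z)) • l • T z ∈ Y₀ := by
          refine hi _ ?_
          obtain ⟨h, hh⟩ := h2 (l * (η z.2)⁻¹)
          refine ⟨h, ?_⟩
          rwa [mul_smul] at hh
        have h0 : Δ z.1 ∈ Y₀ := by simpa using (hmem 1).1
        obtain ⟨t', ⟨-, -, ⟨g, rfl⟩⟩, ht'⟩ := h1.surjOn (a := η (i (l • T z)) • l • T z)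
          ⟨h0, h3, ⟨η (i (l • T z)) * l * (η z.2)⁻¹, by simp [T, mul_smul]⟩⟩
        have h4 : T (g • z.1, i (l • T z)) = l • T z := by
          change (η (i (l • T z)))⁻¹ • Δ (g • z.1) = _
          rw [show Δ (g • z.1) = _ from ht', inv_smul_smul]
        refine ⟨(g • z.1, i (l • T z)), ⟨hzE, Or.inl ?_, ?_⟩, h4⟩
        · change i (T (g • z.1, i (l • T z))) = i (l • T z)
          rw [h4]
        · refine ⟨(g, Multiplicative.ofAdd (i (l • T z) - z.2)), ?_⟩
          refine Prod.ext rfl ?_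
          change (i (l • T z) - z.2) + z.2 = i (l • T z)
          ring
    exact (ae_cond_iff hE (by rw [hEm]; exact ENNReal.inv_ne_top.2 hY₀pos)).2 h1

/-! ### ### The measure of the image and the index of the range of the morphism -/

section Consequences

variable {Z : Type*} [MeasurableSpace Z] {G : Type*} [Group G] [MulAction G Z] {m : Measure Z}
  {Z₀ D C : Set Z} [Countable G] [MeasurableSpace G] [DiscreteMeasurableSpace G]
  [MeasurableConstSMul G Z] [SFinite m] [SMulInvariantMeasure G Z m] [MeasurableEq Z]

theorem Implements.congr {T : Op G m} {E E' : Set Z} {f f' : Z → Z} (hT : Implements T E f)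
    (hE : ∀ z, z ∈ E ↔ z ∈ E') (hf : ∀ z ∈ E', f z = f' z) : Implements T E' f' := by
  intro ξ
  filter_upwards [hT ξ] with w h
  rw [← hE]
  exact ⟨h.1, fun hw a ha => h.2 hw a (by rw [hf _ ((hE _).1 hw), ha])⟩

theorem IsPartialAction.isPartialIso {H : Type*} [Group H] {s : H → Z → Z}
    (hs : IsPartialAction G Z₀ D s) (h : H) : IsPartialIso G Z₀ D D (s h) (s h⁻¹) where
  measurable := hs.measurable _
  measurable_inv := hs.measurable _
  measurableSet := hs.measurableSet
  measurableSet_range := hs.measurableSet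
  orbit := hs.orbit _
  mem := hs.mem _
  left_inv _ hz hD := hs.inv_apply h hz hD
  orbit_inv := hs.orbit _
  mem_inv := hs.mem _
  right_inv _ hz hD := hs.apply_inv h hz hD

namespace IsUntwisting

variable {Γ Λ : Type*} [Group Γ] [Group Λ] [Countable Λ]
  [MeasurableSpace Λ] [DiscreteMeasurableSpace Λ] {s : Γ → Z → Z}
  {t : Λ → Z → Z} {δ : Γ →* Λ} {v : Z → Λ} {n : ℕ}

theorem measure_range (U : IsUntwisting G m Z₀ D C s t δ v n) :
    m D = n * m (twistRange G D C t v n) := by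
  have h := setLIntegral_comp_eq (m := m) U.actD.measurableSet U.measurable_twist U.good.ae_free
    U.ae_orbit (F := 1) measurable_one
  simp only [Pi.one_apply, mul_one, setLIntegral_one] at h
  rw [h, ← lintegral_indicator_one U.measurableSet_range,
    ← lintegral_const_mul' _ _ (ENNReal.natCast_ne_top n)]
  refine lintegral_congr_ae ?_
  filter_upwards [U.good.ae] with z hz
  rw [U.multiplicity_eq hz]
  by_cases hW : z ∈ twistRange G D C t v n <;> simp [hW]

/-- If the orbits of `Γ` and `Λ` in `D` and `C` are the traces of the orbits of `G`, then the
translates of the image of `D` by `Λ / δ(Γ)` form a partition of `C`. -/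
theorem card_quotient_mul (U : IsUntwisting G m Z₀ D C s t δ v n)
    (hsD : ∀ z ∈ Z₀, z ∈ D → ∀ x ∈ MulAction.orbit G z, x ∈ D → ∃ g, x = s g z)
    (hmeet : ∀ z ∈ Z₀, z ∈ C → ∃ a : G, a • z ∈ D)
    (htC : ∀ z ∈ Z₀, z ∈ C → ∀ x ∈ MulAction.orbit G z, x ∈ C → ∃ h, x = t h z) :
    (ENat.card (Λ ⧸ δ.range) : ℝ≥0∞) * m (twistRange G D C t v n) = m C := by
  have : Countable (Λ ⧸ δ.range) := QuotientGroup.mk_surjective.countable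
  set W := twistRange G D C t v n with hW
  -- The translate of `W` by a representative of the coset; it does not depend on the
  -- representative, up to a null set, because `W` is `δ(Γ)`-invariant on good points.
  let S : Λ ⧸ δ.range → Set Z := fun q => C ∩ t (q.out)⁻¹ ⁻¹' W
  have hSm : ∀ q, MeasurableSet (S q) := fun q =>
    U.actC.measurableSet.inter (U.actC.measurable _ U.measurableSet_range)
  have hSmeas : ∀ q, m (S q) = m W := by
    intro q
    rw [(U.actC.isPartialIso _).measure_preimage U.good U.measurableSet_range]
    congr 1
    exact inter_eq_self_of_subset_right fun z hz => hz.1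
  have hcover : m (⋃ q, S q) = m C := by
    refine measure_congr ?_
    filter_upwards [U.good.ae] with z hz
    refine propext ⟨fun h => ?_, fun hC => ?_⟩
    · obtain ⟨q, hq⟩ := mem_iUnion.1 h
      exact hq.1
    · obtain ⟨a, ha⟩ := hmeet z hz hC
      have hxW := U.twist_mem_range (U.good.smul_mem a z hz) ha
      obtain ⟨c, hc⟩ := U.twist_orbit (U.good.smul_mem a z hz) ha
      obtain ⟨h, hh⟩ := htC z hz hC (twist t v (a • z))
        ⟨c * a, show (c * a) • z = _ by rw [hc, mul_smul]⟩ hxW.1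
      refine mem_iUnion.2 ⟨QuotientGroup.mk h⁻¹, hC, ?_⟩
      obtain ⟨⟨l, g, rfl⟩, hl⟩ := QuotientGroup.mk_out_eq_mul δ.range h⁻¹
      change t (Quotient.out (QuotientGroup.mk h⁻¹ : Λ ⧸ δ.range))⁻¹ z ∈ W
      rw [hl]
      simp only [mul_inv_rev, inv_inv]
      rw [U.actC.mul _ _ z hz hC, ← map_inv, ← hh]
      exact U.smul_mem_range _ (U.twist_good (U.good.smul_mem a z hz) ha) hxW
  have hdisj : Pairwise (Function.onFun (AEDisjoint m) S) := by
    intro q q' hq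
    refine measure_eq_zero_iff_ae_notMem.2 ?_
    filter_upwards [U.good.ae] with z hz hzS
    refine hq ?_
    obtain ⟨⟨hC, h1⟩, -, h2⟩ := hzS
    obtain ⟨a, ha, ha'⟩ := U.exists_of_mem_range h1
    obtain ⟨c, hc, hc'⟩ := U.exists_of_mem_range h2
    obtain ⟨e, he⟩ := U.actC.orbit (q.out)⁻¹ z hz hC
    obtain ⟨f, hf⟩ := U.actC.orbit (q'.out)⁻¹ z hz hC
    have hx := U.good.smul_mem a _ (he ▸ U.good.smul_mem e z hz)
    -- A point in two translates yields two points of `D` in one orbit, hence related by some `g`.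
    -- Equivariance and freeness of `t` then give `q.out = q'.out * δ g`, so the cosets coincide.
    obtain ⟨g, hg⟩ := hsD _ hx ha (c • t (q'.out)⁻¹ z)
      ⟨c * f * e⁻¹ * a⁻¹, by rw [he, hf]; simp [mul_smul]⟩ hc
    rw [hg, U.equivariant g _ hx ha, ha', ← U.actC.mul _ _ z hz hC] at hc'
    have := U.actC.cancel hz hC hc'
    rw [← QuotientGroup.out_eq' q, ← QuotientGroup.out_eq' q']
    refine QuotientGroup.eq.2 ⟨g⁻¹, ?_⟩
    rw [map_inv, inv_eq_iff_eq_inv, mul_inv_rev, inv_inv]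
    rw [eq_mul_inv_iff_mul_eq.symm] at this
    rw [this, inv_inv]
  rw [← hcover, measure_iUnion₀ hdisj fun q => (hSm q).nullMeasurableSet]
  simp_rw [hSmeas]
  rw [ENNReal.tsum_const]

end IsUntwisting

end Consequences

theorem ker_eq_bot_of_noFiniteNormalSubgroup {Γ Λ : Type*} [Group Γ] [Group Λ] {δ : Γ →* Λ}
    (h : NoFiniteNormalSubgroup Γ) (hfin : Finite δ.ker) : δ.ker = ⊥ :=
  h _ inferInstance hfin

theorem EssFree.ae_free {G Z : Type*} [MeasurableSpace Z] [Group G] [Countable G] [MulAction G Z]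
    {m : Measure Z} (h : EssFree G m) : ∀ᵐ z ∂m, ∀ g : G, g • z = z → g = 1 := by
  refine ae_all_iff.2 fun g => ?_
  by_cases hg : g = 1
  · exact Filter.Eventually.of_forall fun _ _ => hg
  · filter_upwards [h g hg] with z hz h0 using absurd h0 hz

/-! ### ### The case of a trivial kernel -/

section TrivialKernel

variable {Z : Type*} [MeasurableSpace Z] {G : Type*} [Group G] [MulAction G Z] {m : Measure Z}
  {Z₀ D C : Set Z} [Countable G] [MeasurableSpace G] [DiscreteMeasurableSpace G]
  [MeasurableConstSMul G Z] [SFinite m] [SMulInvariantMeasure G Z m] [MeasurableEq Z]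
  {Γ Λ : Type*} [Group Γ] [Group Λ] [Countable Λ]
  [MeasurableSpace Λ] [DiscreteMeasurableSpace Λ] {s : Γ → Z → Z}
  {t : Λ → Z → Z} {δ : Γ →* Λ} {v : Z → Λ} {n : ℕ}

theorem finsum_ker_eq {A : Type*} [AddCommMonoid A] (f : Γ → A) (hker : δ.ker = ⊥) :
    ∑ᶠ k : δ.ker, f k = f 1 := by
  have : Subsingleton δ.ker := by
    rw [hker]
    infer_instance
  rw [finsum_eq_single _ (1 : δ.ker) fun k hk => absurd (Subsingleton.elim k 1) hk]
  rfl

/-- With one-point fibres, constancy on fibres is no condition, so the general conjugacy is defined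
on all of `L^∞(D)`. -/
theorem IsUntwisting.conjugatesVia_of_ker_eq_bot [SigmaFinite m]
    (U : IsUntwisting G m Z₀ D C s t δ v 1) (hker : δ.ker = ⊥)
    (hK : ∀ z ∈ Z₀, z ∈ D → ∀ x ∈ MulAction.orbit G z, x ∈ D →
      twist t v x = twist t v z → ∃ k ∈ δ.ker, x = s k z)
    {u : Γ → Op G m} {V : Λ → Op G m} {b : Op G m}
    (hu : ∀ g, Implements (u g) D (s g⁻¹)) (hV : ∀ h, Implements (V h) C (t h⁻¹))
    (hb : Implements b D (twist t v)) :
    ConjugatesVia δ u V (fun x => star b * x * b) (linf G m D)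
      (linf G m (twistRange G D C t v 1)) := by
  have h : (fun x => star b * x * b) = scaledAd 1 b := by
    funext x
    simp [scaledAd]
  rw [h]
  refine U.conjugatesVia hu hV hb fun x => ⟨?_, ?_⟩
  · rintro ⟨a, ha, ha0, rfl⟩
    refine ⟨a, ha, ha0, ?_, rfl⟩
    filter_upwards [U.good.ae] with z hz hD x hx hxD hxz
    obtain ⟨k, hk, rfl⟩ := hK z hz hD x hx hxD hxz
    rw [hker, Subgroup.mem_bot] at hk
    rw [hk, U.actD.one z hz hD]
  · rintro ⟨a, ha, ha0, -, rfl⟩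
    exact ⟨a, ha, ha0, rfl⟩

end TrivialKernel

/-! ### Local orbit equivalences -/

section LocalOE

variable {Γ Λ X Y : Type*}
    [Group Γ] [Countable Γ] [MeasurableSpace Γ] [DiscreteMeasurableSpace Γ]
    [Group Λ] [Countable Λ] [MeasurableSpace Λ] [DiscreteMeasurableSpace Λ]
    [MeasurableSpace X] [StandardBorelSpace X] [MeasurableSpace Y] [StandardBorelSpace Y]
    [MulAction Γ X] [MeasurableConstSMul Γ X] [MulAction Λ Y] [MeasurableConstSMul Λ Y]
    {μ : Measure X} [IsProbabilityMeasure μ] [SMulInvariantMeasure Γ X μ]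
    {ν : Measure Y} [IsProbabilityMeasure ν]
    {Y₀ : Set Y} {Δ : X → Y} {δ : Γ →* Λ} {v : X → Λ}

theorem ae_stabMeasure_apply {P : X × ℤ → Prop} (h : ∀ᵐ z ∂stabMeasure μ, P z) :
    ∀ᵐ t ∂μ, ∀ j, P (t, j) := by
  filter_upwards [Measure.ae_ae_of_ae_prod h] with t ht
  exact Measure.ae_count_iff.1 ht

theorem measurableSet_zeroCopy : MeasurableSet (zeroCopy X) :=
  measurable_snd (measurableSet_singleton (0 : ℤ))

theorem stabMeasure_zeroCopy : stabMeasure μ (zeroCopy X) = 1 := by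
  have : zeroCopy X = univ ×ˢ ({0} : Set ℤ) := by
    ext z
    simp [zeroCopy]
  rw [this, Measure.prod_prod, measure_univ, Measure.count_singleton, one_mul]

/-- An amplification gives rise to an action `θ'` of `Λ`, and `Δ^n` to an untwisting of it. -/
theorem Amplification.exists_isUntwisting (hσ : EssFree Γ μ) (hθ : EssFree Λ ν)
    (hwm : WeakMixing Γ μ) (hY₀pos : ν Y₀ ≠ 0) (hv : Measurable v)
    (hδ : ∀ g : Γ, ∀ᵐ t ∂μ, (v t)⁻¹ * zimmerCocycle Δ t g * v (g⁻¹ • t) = δ g)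
    (E : Amplification Γ Λ μ ν Y₀ Δ) :
    ∃ (t : Λ → X × ℤ → X × ℤ) (n : ℕ) (Z₁ : Set (X × ℤ)),
      IsUntwisting (Stab Γ) (stabMeasure μ) Z₁ (zeroCopy X) E.carrier
        (fun g z => (g • z.1, z.2)) t δ (fun z => v z.1) n ∧
      (∀ z ∈ Z₁, z ∈ E.carrier → ∀ h z', E.pullback h z z' ↔ t h z = z') ∧
      ∀ z ∈ Z₁, z ∈ E.carrier → ∀ x ∈ MulAction.orbit (Stab Γ) z, x ∈ E.carrier →
        ∃ h, x = t h z := by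
  set C := E.carrier with hC
  set T := E.toFun with hT
  set m := stabMeasure μ with hm
  obtain ⟨hTmp, hTbij⟩ := E.isLocalOE
  have hTm : Measurable T := hTmp.measurable
  have hCm : MeasurableSet C := E.measurableSet_carrier
  have hfin : m C ≠ ⊤ := by
    rw [E.measure_carrier]
    exact ENNReal.inv_ne_top.2 hY₀pos
  let P : X × ℤ → Prop := fun z => (∀ g : Γ, g ≠ 1 → g • z.1 ≠ z.1) ∧
    (z ∈ C → BijOn T {z' | orbitRelOn (Stab Γ) C z z'} {y | orbitRelOn Λ univ (T z) y}) ∧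
    (z ∈ C → ∀ h : Λ, h ≠ 1 → h • T z ≠ T z) ∧ T (z.1, 0) = Δ z.1 ∧
    ∀ g : Γ, (v z.1)⁻¹ * zimmerCocycle Δ z.1 g * v (g⁻¹ • z.1) = δ g
  have hP : ∀ᵐ z ∂m, P z := by
    have h1 : ∀ᵐ t ∂μ, ∀ g : Γ, g ≠ 1 → g • t ≠ t :=
      hσ.ae_free.mono fun t h g hg h' => hg (h g h')
    have h2 : ∀ᵐ y ∂ν, ∀ h : Λ, h ≠ 1 → h • y ≠ y :=
      hθ.ae_free.mono fun y h g hg h' => hg (h g h')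
    have h3 := (ae_cond_iff hCm hfin).1 (hTmp.quasiMeasurePreserving.ae h2)
    filter_upwards [ae_fst h1, (ae_cond_iff hCm hfin).1 hTbij, h3, ae_fst E.extends_map,
      ae_fst (ae_all_iff.2 hδ)] with z h1 h2 h3 h4 h5
    exact ⟨h1, h2, h3, h4, h5⟩
  -- Requiring `P` along whole orbits gives an invariant set, still conull because the group is
  -- countable.
  let Z₀ : Set (X × ℤ) := {z | ∀ a : Stab Γ, P (a • z)}
  have hPZ : ∀ z ∈ Z₀, P z := fun z hz => by simpa using hz 1
  have hZ : IsGoodSet (Stab Γ) m Z₀ := by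
    refine ⟨ae_all_smul (Stab Γ) hP, fun g z hz a => ?_, fun z hz g hg => ?_⟩
    · rw [← mul_smul]
      exact hz _
    · have h1 : g.1 • z.1 = z.1 := congrArg Prod.fst hg
      have h2 : g.2.toAdd + z.2 = z.2 := congrArg Prod.snd hg
      refine Prod.ext ?_ ?_
      · by_contra hne
        exact (hPZ z hz).1 _ hne h1
      · have : g.2.toAdd = 0 := by linarith
        exact this
  -- The points that `a` moves to the candidate for `θ'_h(z)`. Selecting `a` measurably defines `t
  -- h`.
  let S : Λ → Stab Γ → Set (X × ℤ) := fun h a => {z | z ∈ C ∧ a • z ∈ C ∧ T (a • z) = h • T z}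
  have hS : ∀ h a, MeasurableSet (S h a) := fun h a => by
    have ha : Measurable fun z : X × ℤ => a • z := measurable_const_smul a
    have hh : Measurable fun y : Y => h • y := measurable_const_smul h
    exact hCm.inter ((ha hCm).inter (measurableSet_eq_fun (hTm.comp ha) (hh.comp hTm)))
  choose c hcm hcS using fun h => exists_measurable_select (hS h)
  let t : Λ → X × ℤ → X × ℤ := fun h z => c h z • z
  have ht : ∀ z ∈ Z₀, z ∈ C → ∀ h, t h z ∈ C ∧ T (t h z) = h • T z := by
    intro z hz hzC h
    obtain ⟨x, ⟨-, hxC, ⟨a, rfl⟩⟩, hx⟩ :=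
      ((hPZ z hz).2.1 hzC).surjOn (a := h • T z) ⟨trivial, trivial, ⟨h, rfl⟩⟩
    exact (hcS h z a ⟨hzC, hxC, hx⟩).2
  -- Injectivity of `Δ^n` on classes: a point of the class is determined by its image. The axioms of
  -- an action for `t` thereby reduce to those for `θ`.
  have hunique : ∀ z ∈ Z₀, z ∈ C → ∀ h, ∀ x ∈ MulAction.orbit (Stab Γ) z, x ∈ C →
      T x = h • T z → t h z = x := by
    intro z hz hzC h x hx hxC hxT
    refine ((hPZ z hz).2.1 hzC).injOn ⟨hzC, (ht z hz hzC h).1, ⟨_, rfl⟩⟩ ⟨hzC, hxC, hx⟩ ?_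
    rw [(ht z hz hzC h).2, hxT]
  have hact : IsPartialAction (Stab Γ) Z₀ C t :=
    { measurable := fun h => measurable_select_apply (F := fun (a : Stab Γ) (z : X × ℤ) => a • z)
        (fun a => measurable_const_smul a) (hcm h)
      measurableSet := hCm
      mem := fun h z hz hzC => (ht z hz hzC h).1
      orbit := fun h z hz hzC => ⟨_, rfl⟩
      one := fun z hz hzC => hunique z hz hzC 1 z ⟨1, one_smul _ z⟩ hzC (one_smul Λ _).symm
      mul := fun h k z hz hzC => by
        have hk := hZ.smul_mem (c k z) z hz
        refine hunique z hz hzC (h * k) _ ⟨c h (t k z) * c k z, ?_⟩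
          (ht _ hk (ht z hz hzC k).1 h).1 ?_
        · exact mul_smul _ _ z
        · rw [(ht _ hk (ht z hz hzC k).1 h).2, (ht z hz hzC k).2, mul_smul]
      free := fun h z hz hzC hh => by
        have h1 := (ht z hz hzC h).2
        rw [hh] at h1
        by_contra hne
        exact (hPZ z hz).2.2.1 hzC h hne h1.symm }
  have hDC : zeroCopy X ⊆ C := E.zeroCopy_subset
  have hseq : ∀ (g : Γ) (z : X × ℤ), (g • z.1, z.2) = ((g, 1) : Stab Γ) • z := fun g z =>
    Prod.ext rfl (zero_add z.2).symm
  have hactD : IsPartialAction (Stab Γ) Z₀ (zeroCopy X)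
      (fun (g : Γ) (z : X × ℤ) => (g • z.1, z.2)) :=
    { measurable := fun g => by
        simp only [hseq]
        exact measurable_const_smul _
      measurableSet := measurableSet_zeroCopy
      mem := fun g z _ hz => hz
      orbit := fun g z _ _ => ⟨_, hseq g z⟩
      one := fun z _ _ => Prod.ext (one_smul Γ z.1) rfl
      mul := fun g h z _ _ => Prod.ext (mul_smul g h z.1) rfl
      free := fun g z hz _ h => by
        by_contra hne
        exact (hPZ z hz).1 g hne (congrArg Prod.fst h) }
  have hequi : ∀ g, ∀ z ∈ Z₀, z ∈ zeroCopy X → twist t (fun z => v z.1) (g • z.1, z.2)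
      = t (δ g) (twist t (fun z => v z.1) z) := by
    rintro g ⟨x, j⟩ hz hzD
    obtain rfl : j = 0 := hzD
    have hz' : (g • x, (0 : ℤ)) ∈ Z₀ := by
      have := hZ.smul_mem ((g, 1) : Stab Γ) _ hz
      rwa [← hseq] at this
    have hzC : (x, (0 : ℤ)) ∈ C := hDC rfl
    have hzC' : (g • x, (0 : ℤ)) ∈ C := hDC rfl
    have hT0 : T (x, 0) = Δ x := (hPZ _ hz).2.2.2.1
    have hT0' : T (g • x, 0) = Δ (g • x) := (hPZ _ hz').2.2.2.1
    -- The Zimmer cocycle is a choice by `Classical.epsilon`; its defining equation is available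
    -- because `Δ^n` maps the class of `g • x` into a `Λ`-orbit.
    have hw : Δ x = (zimmerCocycle Δ (g • x) g : Λ)⁻¹ • Δ (g • x) := by
      have hex : ∃ h : Λ, Δ (g⁻¹ • g • x) = h⁻¹ • Δ (g • x) := by
        obtain ⟨-, -, ⟨l, hl⟩⟩ := ((hPZ _ hz').2.1 hzC').mapsTo (x := (x, 0))
          ⟨hzC', hzC, ⟨((g⁻¹, 1) : Stab Γ),
            (hseq g⁻¹ (g • x, 0)).symm.trans (Prod.ext (inv_smul_smul g x) rfl)⟩⟩
        refine ⟨l⁻¹, ?_⟩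
        rw [inv_inv, inv_smul_smul, ← hT0, ← hT0', ← hl]
      calc Δ x = Δ (g⁻¹ • g • x) := by rw [inv_smul_smul]
        _ = _ := Classical.epsilon_spec hex
    have hd := (hPZ _ hz').2.2.2.2 g
    simp only [inv_smul_smul] at hd
    have htw := hact.twist_mem (fun z => v z.1) hz hzC
    have htw0 := hact.twist_good hZ (fun z => v z.1) hz hzC
    have htw' := hact.twist_mem (fun z => v z.1) hz' hzC'
    refine (hunique _ htw0 htw (δ g) _ ?_ htw' ?_).symm
    · obtain ⟨a, ha⟩ := hact.twist_orbit (fun z => v z.1) hz hzC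
      obtain ⟨e, he⟩ := hact.twist_orbit (fun z => v z.1) hz' hzC'
      rw [ha, he]
      refine ⟨e * (g, 1) * a⁻¹, ?_⟩
      have := hseq g (x, 0)
      simp only at this
      simp [mul_smul, this]
    -- The images under `Δ^n` agree: with `δ g = v(gx)⁻¹ w v(x)` and `Δ x = w⁻¹ Δ(gx)`, both equal
    -- `v(gx)⁻¹ Δ(gx)`.
    · simp only [twist]
      rw [(ht _ hz hzC _).2, (ht _ hz' hzC' _).2, hT0, hT0', ← hd, hw, smul_smul, smul_smul]
      congr 1
      group
  have herg : ∀ A, MeasurableSet A →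
      (∀ g : Γ, ∀ z ∈ Z₀, z ∈ zeroCopy X → ((g • z.1, z.2) ∈ A ↔ z ∈ A)) →
      m (zeroCopy X ∩ A) = 0 ∨ m (zeroCopy X \ A) = 0 := by
    intro A hA hinv
    have hA0 : MeasurableSet {x : X | (x, (0 : ℤ)) ∈ A} :=
      (measurable_id.prodMk measurable_const) hA
    have h1 : ∀ g : Γ, ∀ᵐ x ∂μ, g • x ∈ {x : X | (x, (0 : ℤ)) ∈ A} ↔
        x ∈ {x : X | (x, (0 : ℤ)) ∈ A} := by
      intro g
      filter_upwards [ae_stabMeasure_apply hZ.ae] with x hx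
      exact hinv g (x, 0) (hx 0) rfl
    rcases hwm.measure_eq_zero_or hA0 h1 with h | h
    · left
      rw [measure_eq_zero_iff_ae_notMem] at h ⊢
      filter_upwards [ae_fst h] with z hz hzA
      refine hz ?_
      have h2 : z = (z.1, 0) := Prod.ext rfl hzA.1
      exact h2 ▸ hzA.2
    · right
      rw [measure_eq_zero_iff_ae_notMem] at h ⊢
      filter_upwards [ae_fst h] with z hz hzA
      refine hz fun h3 => hzA.2 ?_
      have h2 : z = (z.1, 0) := Prod.ext rfl hzA.1
      rw [h2]
      exact h3
  obtain ⟨n, Z₁, hsub, U⟩ := OE.exists_isUntwisting hZ hactD hact hDC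
    (by rw [stabMeasure_zeroCopy]; exact one_ne_zero)
    (by rw [stabMeasure_zeroCopy]; exact ENNReal.one_ne_top) (hv.comp measurable_fst) hequi herg
  refine ⟨t, n, Z₁, U, ?_, ?_⟩
  · intro z hz hzC h z'
    constructor
    · rintro ⟨⟨-, hz'C, hz'⟩, hT'⟩
      exact hunique z (hsub hz) hzC h z' hz' hz'C hT'
    · rintro rfl
      exact ⟨⟨hzC, (ht z (hsub hz) hzC h).1, ⟨_, rfl⟩⟩, (ht z (hsub hz) hzC h).2⟩
  · intro z hz hzC x hx hxC
    obtain ⟨-, -, ⟨l, hl⟩⟩ := ((hPZ z (hsub hz)).2.1 hzC).mapsTo (x := x) ⟨hzC, hxC, hx⟩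
    exact ⟨l, (hunique z (hsub hz) hzC l x hx hxC hl.symm).symm⟩

theorem Amplification.conclusion (hσ : EssFree Γ μ) (hθ : EssFree Λ ν)
    (hwm : WeakMixing Γ μ) (hY₀pos : ν Y₀ ≠ 0) (hv : Measurable v)
    (hδ : ∀ g : Γ, ∀ᵐ t ∂μ, (v t)⁻¹ * zimmerCocycle Δ t g * v (g⁻¹ • t) = δ g)
    (E : Amplification Γ Λ μ ν Y₀ Δ) :
      ∃ (u : Γ → Op (Stab Γ) (stabMeasure μ)) (vΛ : Λ → Op (Stab Γ) (stabMeasure μ))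
        (p : Op (Stab Γ) (stabMeasure μ)) (b : Op (Stab Γ) (stabMeasure μ))
        (W : Set (X × ℤ)) (q : Op (Stab Γ) (stabMeasure μ)),
        p = proj (Stab Γ) (stabMeasure μ) (zeroCopy X) ∧
        (∀ g, u g = p * canU (stabMeasure μ) ((g, 1) : Stab Γ)) ∧
        (∀ h, IsCanonicalFor (G := Stab Γ) (stabMeasure μ) (E.pullback h⁻¹) (vΛ h)) ∧
        (∀ h, vΛ h ∈ corner (crossedProduct (Stab Γ) (stabMeasure μ))
          (proj (Stab Γ) (stabMeasure μ) E.carrier)) ∧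
        StrongHasSum (fun h => proj (Stab Γ) (stabMeasure μ)
          {z | z ∈ zeroCopy X ∧ v z.1 = h} * vΛ h) b ∧
        b ∈ corner (crossedProduct (Stab Γ) (stabMeasure μ))
          (proj (Stab Γ) (stabMeasure μ) E.carrier) ∧
        (∀ g, u g * b = b * vΛ (δ g)) ∧
        IsScalarMulPartialIsometry b ∧
        Finite δ.ker ∧ δ.ker.Normal ∧
        MeasurableSet W ∧ W ⊆ E.carrier ∧ q = proj (Stab Γ) (stabMeasure μ) W ∧
        b * star b = ∑ᶠ k : δ.ker, u k ∧
        star b * b = (Nat.card δ.ker : ℂ) • q ∧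
        (∀ h ∈ δ.range, vΛ h * q * star (vΛ h) = q) ∧
        (δ.range.index : ℝ) = Nat.card δ.ker * (ν.real Y₀)⁻¹ ∧
        ConjugatesVia δ u vΛ (scaledAd (Nat.card δ.ker) b)
          (fixedAlg δ.ker u (linf (Stab Γ) (stabMeasure μ) (zeroCopy X)))
          (linf (Stab Γ) (stabMeasure μ) W) ∧
        (NoFiniteNormalSubgroup Γ →
          Function.Injective δ ∧
          (δ.range.index : ℝ) = (ν.real Y₀)⁻¹ ∧
          star b * b = q ∧ b * star b = p ∧
          ConjugatesVia δ u vΛ (fun x => star b * x * b)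
            (linf (Stab Γ) (stabMeasure μ) (zeroCopy X))
            (linf (Stab Γ) (stabMeasure μ) W) ∧
          ∃ φ : X × ℤ → X × ℤ,
            IsInFullGroup (orbitRelOn (Stab Γ) E.carrier)
              ((stabMeasure μ).restrict E.carrier) φ ∧
            (∀ᵐ z ∂((stabMeasure μ).restrict E.carrier), z ∈ zeroCopy X ↔ φ z ∈ W) ∧
            (∀ a : X × ℤ → ℂ, MemLp a ⊤ (stabMeasure μ) →
              star b * mulOp (Stab Γ) (stabMeasure μ)
                  ((zeroCopy X).indicator fun z => a (φ z)) * b =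
                mulOp (Stab Γ) (stabMeasure μ) (W.indicator a)) ∧
            ∀ g : Γ, ∀ᵐ t ∂μ, E.pullback (δ g) (φ (t, 0)) (φ (g • t, 0))) := by
  obtain ⟨t, n, Z₁, U, hpull, htC⟩ := E.exists_isUntwisting hσ hθ hwm hY₀pos hv hδ
  set m := stabMeasure μ with hm
  set D := zeroCopy X with hD
  set C := E.carrier with hC
  have hfin : m C ≠ ⊤ := by
    rw [E.measure_carrier]
    exact ENNReal.inv_ne_top.2 hY₀pos
  let s : Γ → X × ℤ → X × ℤ := fun g z => (g • z.1, z.2)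
  have hsD : ∀ z ∈ Z₁, z ∈ D → ∀ x ∈ MulAction.orbit (Stab Γ) z, x ∈ D → ∃ g, x = s g z := by
    rintro z - hz _ ⟨a, rfl⟩ ha
    exact ⟨a.1, Prod.ext rfl (Eq.trans ha (Eq.symm hz))⟩
  -- Fibres lie in `Γ`-orbits, and `f (s g z) = f z` says that `δ g` fixes `f z`; freeness puts `g`
  -- in the kernel.
  have hK : ∀ z ∈ Z₁, z ∈ D → ∀ x ∈ MulAction.orbit (Stab Γ) z, x ∈ D →
      twist t (fun z => v z.1) x = twist t (fun z => v z.1) z → ∃ k ∈ δ.ker, x = s k z := by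
    intro z hz hzD x hx hxD hxz
    obtain ⟨g, rfl⟩ := hsD z hz hzD x hx hxD
    refine ⟨g, ?_, rfl⟩
    rw [U.equivariant g z hz hzD] at hxz
    exact U.actC.free _ _ (U.twist_good hz hzD) (U.twist_mem_range hz hzD).1 hxz
  have hn : n = Nat.card δ.ker := U.eq_card_ker hK
  choose V hV using fun h : Λ => U.actC.exists_implements U.good h⁻¹
  obtain ⟨b, hb⟩ := U.exists_implements
  let u : Γ → Op (Stab Γ) m := fun g => proj (Stab Γ) m D * canU m ((g, 1) : Stab Γ)
  have hu : ∀ g, Implements (u g) D (s g⁻¹) := by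
    intro g
    refine ((implements_proj U.actD.measurableSet U.good.ae_free).mul
      (implements_canU U.good.ae_free ((g, 1) : Stab Γ))
      (Filter.Eventually.of_forall fun z _ => ⟨1, by simp⟩)).congr (by simp) fun z _ => ?_
    refine Prod.ext rfl ?_
    change (1 : Multiplicative ℤ)⁻¹.toAdd + z.2 = z.2
    simp
  have hindex : (δ.range.index : ℝ) = n * (ν.real Y₀)⁻¹ := by
    have h1 := U.card_quotient_mul hsD
      (fun z _ _ => ⟨((1, Multiplicative.ofAdd (-z.2)) : Stab Γ), neg_add_cancel z.2⟩) htC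
    have h2 := U.measure_range
    rw [stabMeasure_zeroCopy] at h2
    rw [E.measure_carrier] at h1
    have h3 : (ENat.card (Λ ⧸ δ.range) : ℝ≥0∞) = n * (ν Y₀)⁻¹ := by
      rw [← h1, mul_left_comm, ← h2, mul_one]
    have h4 : (ENat.card (Λ ⧸ δ.range) : ℝ≥0∞).toReal = δ.range.index := by
      -- `Subgroup.index` is `0` for an infinite quotient, so finiteness has to be read off from the
      -- measures first.
      have hne : ENat.card (Λ ⧸ δ.range) ≠ ⊤ := by
        intro h
        rw [h, ENat.toENNReal_top] at h3
        exact ENNReal.mul_ne_top (ENNReal.natCast_ne_top n) (ENNReal.inv_ne_top.2 hY₀pos) h3.symm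
      have : Finite (Λ ⧸ δ.range) := ENat.card_lt_top.1 hne.lt_top
      rw [ENat.card_eq_coe_natCard]
      simp [Subgroup.index]
    rw [← h4, h3, ENNReal.toReal_mul, ENNReal.toReal_inv, ENNReal.toReal_natCast, measureReal_def]
  have hone : u 1 = proj (Stab Γ) m D := U.actD.op_one U.good hu
  refine ⟨u, V, proj (Stab Γ) m D, b, _, _, rfl, fun g => rfl, ?_, ?_, U.strongHasSum hV hb,
    U.mem_corner hb, U.intertwine hu hV hb, U.isScalarMulPartialIsometry hb, U.finite_ker,
    inferInstance, U.measurableSet_range, fun z hz => hz.1, rfl, U.mul_star_self hu hb hK, ?_,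
    fun h hh => U.conj_proj_range hV hh, hn ▸ hindex, ?_, ?_⟩
  · intro h
    refine (hV h).isCanonicalFor U.actC.measurableSet (U.actC.measurable _) U.good.ae_free
      (U.actC.ae_orbit U.good _) ?_
    filter_upwards [U.good.ae] with z hz a
    constructor
    · intro hp
      exact ⟨hp.1.1, (hpull z hz hp.1.1 _ _).1 hp⟩
    · rintro ⟨hzC, h1⟩
      exact (hpull z hz hzC _ _).2 h1
  · exact fun h => U.actC.op_mem_corner U.good hV h
  · rw [← hn]
    exact U.star_mul_self hb
  · rw [← hn]
    exact U.conjugatesVia hu hV hb (U.mem_fixedAlg_iff hu hK)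
  · intro hΓ
    have hker := ker_eq_bot_of_noFiniteNormalSubgroup hΓ U.finite_ker
    have hinj : Function.Injective δ := (MonoidHom.ker_eq_bot_iff δ).1 hker
    obtain rfl : n = 1 := by rw [hn, hker]; simp
    obtain ⟨φ, h1, h2, h3, h4⟩ := U.exists_fullGroup hfin hb
    refine ⟨hinj, by rw [hindex]; simp, by rw [U.star_mul_self hb, Nat.cast_one, one_smul],
      by rw [U.mul_star_self hu hb hK, finsum_ker_eq u hker, hone],
      U.conjugatesVia_of_ker_eq_bot hker hK hu hV hb, φ, h1, h2, h3, fun g => ?_⟩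
    filter_upwards [ae_stabMeasure_apply U.good.ae] with x hx
    have hx0 := hx 0
    have hxD : ((x, 0) : X × ℤ) ∈ D := rfl
    rw [h4 _ hxD, h4 (g • x, 0) rfl, hpull _ (U.twist_good hx0 hxD) (U.twist_mem_range hx0 hxD).1]
    exact (U.equivariant g _ hx0 hxD).symm

end LocalOE

/-- Shrinks the good set so that an a.e. property holds at each of its points; asking for it along
whole `G`-orbits keeps the set invariant. -/
theorem IsUntwisting.restrict {Z : Type*} [MeasurableSpace Z] {Γ Λ : Type*} [Group Γ] [Group Λ]
    [MeasurableSpace Λ] {G : Type*} [Group G] [Countable G] [MulAction G Z] [MeasurableSpace G]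
    [DiscreteMeasurableSpace G]
    [MeasurableConstSMul G Z] {m : Measure Z} [SFinite m] [SMulInvariantMeasure G Z m] {Z₀ D C : Set Z}
    {s : Γ → Z → Z} {t : Λ → Z → Z} {δ : Γ →* Λ} {v : Z → Λ} {n : ℕ}
    (U : IsUntwisting G m Z₀ D C s t δ v n) {P : Z → Prop} (hP : ∀ᵐ z ∂m, P z) :
    ∃ Z₁ ⊆ Z₀, IsUntwisting G m Z₁ D C s t δ v n ∧ ∀ z ∈ Z₁, P z := by
  have hsub : {z | z ∈ Z₀ ∧ ∀ g : G, P (g • z)} ⊆ Z₀ := fun z hz => hz.1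
  refine ⟨_, hsub, ⟨⟨?_, fun g z hz => ⟨U.good.smul_mem g z hz.1, fun a => ?_⟩,
    fun z hz => U.good.free z hz.1⟩, U.actD.mono hsub, U.actC.mono hsub, U.subset,
    U.measure_ne_zero, U.measurable_v, fun g z hz => U.equivariant g z hz.1, U.pos,
    fun z hz => U.multiplicity_twist z hz.1⟩, fun z hz => by simpa using hz.2 1⟩
  · filter_upwards [U.good.ae, ae_all_smul G hP] with z h1 h2 using ⟨h1, h2⟩
  · rw [← mul_smul]
    exact hz.2 _

/-! ### Embeddings -/

section Embedding

variable {Γ Λ X Y : Type*}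
    [Group Γ] [Countable Γ] [MeasurableSpace Γ] [DiscreteMeasurableSpace Γ]
    [Group Λ] [Countable Λ] [MeasurableSpace Λ] [DiscreteMeasurableSpace Λ]
    [MeasurableSpace X] [StandardBorelSpace X] [MeasurableSpace Y] [StandardBorelSpace Y]
    [MulAction Γ X] [MeasurableConstSMul Γ X] [MulAction Λ Y] [MeasurableConstSMul Λ Y]
    {μ : Measure X} [IsProbabilityMeasure μ] [SMulInvariantMeasure Γ X μ]
    {ν : Measure Y} [IsProbabilityMeasure ν] [SMulInvariantMeasure Λ Y ν]
    {Y₀ : Set Y} {Δ : X → Y} {Δinv : Y → X} {δ : Γ →* Λ} {v : X → Λ}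

/-- The action of `Γ` transported to `Y₀` by an embedding, and the translations of `Λ`, form an
untwisting. -/
theorem IsEmbedding.exists_isUntwisting
    (hΔ : IsEmbedding (orbitRelOn Γ univ) (orbitRelOn Λ Y₀) μ (ν[|Y₀]) Δ Δinv)
    (hσ : EssFree Γ μ) (hθ : EssFree Λ ν) (hwm : WeakMixing Γ μ) (hY₀ : MeasurableSet Y₀)
    (hY₀pos : ν Y₀ ≠ 0) (hv : Measurable v)
    (hδ : ∀ g : Γ, ∀ᵐ t ∂μ, (v t)⁻¹ * zimmerCocycle Δ t g * v (g⁻¹ • t) = δ g) :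
    ∃ (n : ℕ) (Z₁ : Set Y), IsUntwisting Λ ν Z₁ Y₀ univ (fun g y => Δ (g • Δinv y))
      (fun (h : Λ) (y : Y) => h • y) δ (fun y => v (Δinv y)) n := by
  have htop : ν Y₀ ≠ ⊤ := measure_ne_top ν Y₀
  have hΔm := hΔ.measurePreserving.measurable
  have hΔim := hΔ.measurePreserving_inv.measurable
  let Q : X → Prop := fun x => (∀ g : Γ, g • x = x → g = 1) ∧ Δinv (Δ x) = x ∧
    (∀ x', orbitRelOn Γ univ x x' → orbitRelOn Λ Y₀ (Δ x) (Δ x')) ∧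
    ∀ g : Γ, (v x)⁻¹ * zimmerCocycle Δ x g * v (g⁻¹ • x) = δ g
  have hQ : ∀ᵐ x ∂μ, Q x := by
    filter_upwards [hσ.ae_free, hΔ.left_inv, hΔ.maps_rel, ae_all_iff.2 hδ] with x h1 h2 h3 h4
      using ⟨h1, h2, h3, h4⟩
  -- The conditions on `X` are imposed along the whole `Γ`-orbit of `Δinv y`, since a `Λ`-orbit on
  -- `Y₀` controls only the points `Δ (g • Δinv y)`, not the orbits in `X` themselves.
  let P : Y → Prop := fun y => (∀ h : Λ, h • y = y → h = 1) ∧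
    (y ∈ Y₀ → Δ (Δinv y) = y ∧ ∀ g : Γ, Q (g • Δinv y))
  have hP : ∀ᵐ y ∂ν, P y := by
    filter_upwards [hθ.ae_free, (ae_cond_iff hY₀ htop).1 hΔ.right_inv,
      (ae_cond_iff hY₀ htop).1
        (hΔ.measurePreserving_inv.quasiMeasurePreserving.ae (ae_all_smul Γ hQ))] with y h1 h2 h3
      using ⟨h1, fun h => ⟨h2 h, h3 h⟩⟩
  let Z₀ : Set Y := {y | ∀ h : Λ, P (h • y)}
  have hPZ : ∀ y ∈ Z₀, P y := fun y hy => by simpa using hy 1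
  have hZ : IsGoodSet Λ ν Z₀ := by
    refine ⟨ae_all_smul Λ hP, fun g y hy a => ?_, fun y hy => (hPZ y hy).1⟩
    rw [← mul_smul]
    exact hy _
  have hrel : ∀ y ∈ Z₀, y ∈ Y₀ → ∀ g g' : Γ,
      orbitRelOn Λ Y₀ (Δ (g • Δinv y)) (Δ (g' • Δinv y)) := by
    intro y hy hy0 g g'
    refine (((hPZ y hy).2 hy0).2 g).2.2.1 _ ⟨trivial, trivial, ⟨g' * g⁻¹, ?_⟩⟩
    simp [mul_smul]
  have hrel1 : ∀ y ∈ Z₀, y ∈ Y₀ → ∀ g : Γ, orbitRelOn Λ Y₀ y (Δ (g • Δinv y)) := by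
    intro y hy hy0 g
    have h := hrel y hy hy0 1 g
    rwa [one_smul, ((hPZ y hy).2 hy0).1] at h
  have hleft : ∀ y ∈ Z₀, y ∈ Y₀ → ∀ g : Γ, Δinv (Δ (g • Δinv y)) = g • Δinv y :=
    fun y hy hy0 g => (((hPZ y hy).2 hy0).2 g).2.1
  have hactD : IsPartialAction Λ Z₀ Y₀ (fun (g : Γ) (y : Y) => Δ (g • Δinv y)) :=
    { measurable := fun g => hΔm.comp ((measurable_const_smul g).comp hΔim)
      measurableSet := hY₀
      mem := fun g y hy hy0 => (hrel1 y hy hy0 g).2.1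
      orbit := fun g y hy hy0 => by
        obtain ⟨a, ha⟩ := (hrel1 y hy hy0 g).2.2
        exact ⟨a, ha.symm⟩
      one := fun y hy hy0 => by rw [one_smul, ((hPZ y hy).2 hy0).1]
      mul := fun g h y hy hy0 => by rw [hleft y hy hy0, mul_smul]
      free := fun g y hy hy0 h => by
        have h1 := ((hPZ y hy).2 hy0).2 1
        rw [one_smul] at h1
        refine h1.1 g ?_
        rw [← hleft y hy hy0, h] }
  have hequi : ∀ g, ∀ y ∈ Z₀, y ∈ Y₀ →
      twist (fun (h : Λ) (y : Y) => h • y) (fun y => v (Δinv y)) (Δ (g • Δinv y))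
        = δ g • twist (fun (h : Λ) (y : Y) => h • y) (fun y => v (Δinv y)) y := by
    intro g y hy hy0
    simp only [twist]
    rw [hleft y hy hy0]
    obtain ⟨x, hx⟩ : ∃ x, x = Δinv y := ⟨_, rfl⟩
    have hw : Δ x = (zimmerCocycle Δ (g • x) g : Λ)⁻¹ • Δ (g • x) := by
      have hex : ∃ h : Λ, Δ (g⁻¹ • g • x) = h⁻¹ • Δ (g • x) := by
        obtain ⟨-, -, ⟨l, hl⟩⟩ := hrel y hy hy0 g 1
        refine ⟨l⁻¹, ?_⟩
        rw [inv_inv, inv_smul_smul, hx]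
        simpa using hl.symm
      calc Δ x = Δ (g⁻¹ • g • x) := by rw [inv_smul_smul]
        _ = _ := Classical.epsilon_spec hex
    have hd := (((hPZ y hy).2 hy0).2 g).2.2.2 g
    have hyx : y = Δ x := by rw [hx, ((hPZ y hy).2 hy0).1]
    rw [← hx, inv_smul_smul] at hd
    rw [← hx, ← hd]
    conv_rhs => rw [hyx, hw]
    rw [smul_smul, smul_smul]
    congr 1
    group
  have herg : ∀ A, MeasurableSet A →
      (∀ g : Γ, ∀ y ∈ Z₀, y ∈ Y₀ → (Δ (g • Δinv y) ∈ A ↔ y ∈ A)) →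
      ν (Y₀ ∩ A) = 0 ∨ ν (Y₀ \ A) = 0 := by
    intro A hA hinv
    have h1 : ∀ g : Γ, ∀ᵐ x ∂μ, g • x ∈ Δ ⁻¹' A ↔ x ∈ Δ ⁻¹' A := by
      intro g
      filter_upwards [hΔ.left_inv, hΔ.maps_rel, hΔ.measurePreserving.quasiMeasurePreserving.ae
        ((ae_cond_iff hY₀ htop).2 (hZ.ae.mono fun _ h _ => h))] with x h1 h2 h3
      have h4 := hinv g (Δ x) h3 (h2 x ⟨trivial, trivial, MulAction.mem_orbit_self x⟩).1
      rwa [h1] at h4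
    -- Null sets are transported between `X` and `Y₀` by `Δ`, so ergodicity on `X` gives ergodicity
    -- of the transported action.
    have key : ∀ B, MeasurableSet B → μ (Δ ⁻¹' B) = 0 → ν (Y₀ ∩ B) = 0 := by
      intro B hB h0
      rw [hΔ.measurePreserving.measure_preimage hB.nullMeasurableSet,
        measure_eq_zero_iff_ae_notMem, ae_cond_iff hY₀ htop] at h0
      rw [measure_eq_zero_iff_ae_notMem]
      filter_upwards [h0] with y hy hyB using hy hyB.1 hyB.2
    exact (hwm.measure_eq_zero_or (hΔm hA) h1).imp (key A hA) (key Aᶜ hA.compl)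
  obtain ⟨n, Z₁, -, U⟩ := OE.exists_isUntwisting hZ hactD (isPartialAction_smul hZ)
    (subset_univ Y₀) hY₀pos htop (hv.comp hΔim) hequi herg
  exact ⟨n, Z₁, U⟩

theorem IsEmbedding.conclusion
    (hΔ : IsEmbedding (orbitRelOn Γ univ) (orbitRelOn Λ Y₀) μ (ν[|Y₀]) Δ Δinv)
    (hσ : EssFree Γ μ) (hθ : EssFree Λ ν) (hwm : WeakMixing Γ μ) (hY₀ : MeasurableSet Y₀)
    (hY₀pos : ν Y₀ ≠ 0) (hv : Measurable v)
    (hδ : ∀ g : Γ, ∀ᵐ t ∂μ, (v t)⁻¹ * zimmerCocycle Δ t g * v (g⁻¹ • t) = δ g) :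
      ∃ (u : Γ → Op Λ ν) (p : Op Λ ν) (b : Op Λ ν) (W : Set Y) (q : Op Λ ν) (m : ℕ)
        (κ : Y → Y → Prop),
        p = proj Λ ν Y₀ ∧
        (∀ g, IsCanonicalFor (G := Λ) ν
          (fun y y' => y ∈ Y₀ ∧ y' ∈ Y₀ ∧ y' = Δ (g⁻¹ • Δinv y)) (u g)) ∧
        (∀ g, u g ∈ corner (crossedProduct Λ ν) p) ∧
        StrongHasSum (fun h => proj Λ ν {y | y ∈ Y₀ ∧ v (Δinv y) = h} * canU ν h) b ∧
        b ∈ crossedProduct Λ ν ∧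
        (∀ g, u g * b = b * canU ν (δ g)) ∧
        IsScalarMulPartialIsometry b ∧
        Finite δ.ker ∧ δ.ker.Normal ∧
        IsFiniteInvariantSubrel Γ Λ ν Y₀ Δ Δinv κ ∧
        (∀ k ∈ δ.ker, ∀ᵐ y ∂(ν.restrict Y₀), κ y (Δ (k • Δinv y))) ∧
        0 < m ∧ (∀ᵐ y ∂(ν.restrict Y₀), {y' | κ y y'}.ncard = m) ∧
        MeasurableSet W ∧ q = proj Λ ν W ∧
        star b * b = (m : ℂ) • q ∧
        (∀ h ∈ δ.range, canU ν h * q * star (canU ν h) = q) ∧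
        ConjugatesVia δ u (canU ν) (scaledAd m b) (quotientAlg Λ ν Y₀ κ) (linf Λ ν W) ∧
        ((∀ κ' : Y → Y → Prop, IsFiniteInvariantSubrel Γ Λ ν Y₀ Δ Δinv κ' →
            ∀ᵐ y ∂(ν.restrict Y₀), ∀ y', κ' y y' → ∃ g : Γ, y' = Δ (g • Δinv y)) →
          (∀ᵐ y ∂(ν.restrict Y₀), ∀ y', κ y y' ↔ ∃ k ∈ δ.ker, y' = Δ (k • Δinv y)) ∧
          star b * b = (Nat.card δ.ker : ℂ) • q ∧
          b * star b = ∑ᶠ k : δ.ker, u k ∧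
          ConjugatesVia δ u (canU ν) (scaledAd (Nat.card δ.ker) b)
            (fixedAlg δ.ker u (linf Λ ν Y₀)) (linf Λ ν W) ∧
          (NoFiniteNormalSubgroup Γ →
            Function.Injective δ ∧
            b * star b = p ∧ star b * b = q ∧
            (∀ x ∈ linf Λ ν univ, b * x * star b ∈ linf Λ ν univ ∧
              star b * x * b ∈ linf Λ ν univ) ∧
            ConjugatesVia δ u (canU ν) (fun x => star b * x * b)
              (linf Λ ν Y₀) (linf Λ ν W) ∧
            ∃ φ : Y → Y,
              IsInFullGroup (orbitRelOn Λ univ) ν φ ∧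
              (∀ᵐ y ∂ν, y ∈ Y₀ ↔ φ y ∈ W) ∧
              (∀ a : Y → ℂ, MemLp a ⊤ ν →
                star b * mulOp Λ ν (Y₀.indicator fun y => a (φ y)) * b =
                  mulOp Λ ν (W.indicator a)) ∧
              ∀ g : Γ, ∀ᵐ t ∂μ, φ (Δ (g • t)) = δ g • φ (Δ t))) := by
  obtain ⟨n, Z₁, U⟩ := hΔ.exists_isUntwisting hσ hθ hwm hY₀ hY₀pos hv hδ
  have htop : ν Y₀ ≠ ⊤ := measure_ne_top ν Y₀
  set s : Γ → Y → Y := fun g y => Δ (g • Δinv y) with hs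
  set t : Λ → Y → Y := fun h y => h • y with ht
  set v' : Y → Λ := fun y => v (Δinv y) with hv'
  -- The relation of lying in one fibre. As the map acts by elements of `Λ`, equal values already
  -- imply equal orbits, at every point and not only a.e.
  let κ : Y → Y → Prop := fun y y' => y ∈ Y₀ ∧ y' ∈ Y₀ ∧ twist t v' y' = twist t v' y
  have hκo : ∀ y y', κ y y' → y' ∈ MulAction.orbit Λ y := by
    rintro y y' ⟨-, -, h⟩
    refine ⟨v' y' * (v' y)⁻¹, ?_⟩
    change (v' y' * (v' y)⁻¹) • y = y'
    rw [mul_smul, ← eq_inv_smul_iff]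
    exact h.symm
  have hκset : ∀ y ∈ Y₀, {y' | κ y y'}
      = {x | x ∈ MulAction.orbit Λ y ∧ x ∈ Y₀ ∧ twist t v' x = twist t v' y} := by
    intro y hy
    ext x
    exact ⟨fun h => ⟨hκo _ _ h, h.2⟩, fun h => ⟨hy, h.2⟩⟩
  have hκcard : ∀ᵐ y ∂(ν.restrict Y₀), {y' | κ y y'}.encard = n := by
    rw [ae_restrict_iff' hY₀]
    filter_upwards [U.good.ae] with y hy hy0
    rw [hκset y hy0]
    exact U.fibre_encard hy hy0
  have hκ : IsFiniteInvariantSubrel Γ Λ ν Y₀ Δ Δinv κ :=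
    { measurableSet := by
        have h := U.measurable_twist
        exact (measurable_fst hY₀).inter ((measurable_snd hY₀).inter
          (measurableSet_eq_fun (h.comp measurable_snd) (h.comp measurable_fst)))
      subrel := fun y y' h => ⟨h.1, h.2.1, hκo y y' h⟩
      refl := fun y hy => ⟨hy, hy, rfl⟩
      symm := fun y y' h => ⟨h.2.1, h.1, h.2.2.symm⟩
      trans := fun y y' y'' h h' => ⟨h.1, h'.2.1, h'.2.2.trans h.2.2⟩
      finite := by
        filter_upwards [hκcard] with y hy
        rw [← encard_ne_top_iff, hy]
        exact ENat.natCast_ne_top n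
      invariant := fun g => by
        rw [ae_restrict_iff' hY₀]
        filter_upwards [U.good.ae] with y hy hy0 y' h
        obtain ⟨a, rfl⟩ := hκo y y' h
        have hy' := U.good.smul_mem a y hy
        refine ⟨U.actD.mem g y hy hy0, U.actD.mem g _ hy' h.2.1, ?_⟩
        have h1 := U.equivariant g y hy hy0
        have h2 := U.equivariant g _ hy' h.2.1
        exact h2.trans ((congrArg _ h.2.2).trans h1.symm) }
  have hV : ∀ h : Λ, Implements (canU ν h) univ (t h⁻¹) := implements_canU U.good.ae_free
  choose u hu using fun g : Γ => U.actD.exists_implements U.good g⁻¹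
  obtain ⟨b, hb⟩ := U.exists_implements
  refine ⟨u, proj Λ ν Y₀, b, _, _, n, κ, rfl, ?_, U.actD.op_mem_corner U.good hu,
    U.strongHasSum hV hb, (U.mem_corner hb).1, U.intertwine hu hV hb,
    U.isScalarMulPartialIsometry hb, U.finite_ker, inferInstance, hκ, ?_, U.pos, ?_,
    U.measurableSet_range, rfl, U.star_mul_self hb, fun h hh => U.conj_proj_range hV hh, ?_, ?_⟩
  · intro g
    refine (hu g).isCanonicalFor hY₀ (U.actD.measurable _) U.good.ae_free
      (U.actD.ae_orbit U.good _) ?_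
    filter_upwards [U.good.ae] with y hy a
    constructor
    · exact fun h => ⟨h.1, h.2.2.symm⟩
    · rintro ⟨hy0, h⟩
      exact ⟨hy0, h ▸ U.actD.mem _ y hy hy0, h.symm⟩
  · intro k hk
    rw [ae_restrict_iff' hY₀]
    filter_upwards [U.good.ae] with y hy hy0
    exact ⟨hy0, U.actD.mem k y hy hy0, U.twist_ker hk hy hy0⟩
  · filter_upwards [hκcard] with y hy
    rw [Set.ncard, hy]
    rfl
  · refine U.conjugatesVia hu hV hb fun x => ?_
    refine exists_congr fun a => and_congr_right fun _ => and_congr_right fun _ =>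
      and_congr_left fun _ => ?_
    rw [ae_restrict_iff' hY₀]
    refine Filter.eventually_congr (Filter.Eventually.of_forall fun y => ?_)
    refine forall_congr' fun hy => forall_congr' fun x => ?_
    exact ⟨fun h _ hx hxy => h ⟨hy, hx, hxy⟩, fun h hxy => h (hκo y x hxy) hxy.2.1 hxy.2.2⟩
  · intro hmax
    -- Applied to `κ` itself, the maximality hypothesis puts the fibres into `Γ`-orbits; from here
    -- on the argument is that of the local OE case.
    obtain ⟨Z₂, hZ₂, U₂, hP⟩ := U.restrict ((ae_restrict_iff' hY₀).1 (hmax κ hκ))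
    have hK : ∀ y ∈ Z₂, y ∈ Y₀ → ∀ x ∈ MulAction.orbit Λ y, x ∈ Y₀ →
        twist t v' x = twist t v' y → ∃ k ∈ δ.ker, x = s k y := by
      intro y hy hy0 x _ hx0 hxy
      obtain ⟨g, rfl⟩ := hP y hy hy0 x ⟨hy0, hx0, hxy⟩
      refine ⟨g, ?_, rfl⟩
      exact U₂.actC.free (δ g) _ (U₂.twist_good hy hy0) trivial
        ((U₂.equivariant g y hy hy0).symm.trans hxy)
    have hn : n = Nat.card δ.ker := U₂.eq_card_ker hK
    refine ⟨?_, ?_, U₂.mul_star_self hu hb hK, ?_, ?_⟩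
    · rw [ae_restrict_iff' hY₀]
      filter_upwards [U₂.good.ae] with y hy hy0 x
      constructor
      · exact fun h => hK y hy hy0 x (hκo y x h) h.2.1 h.2.2
      · rintro ⟨k, hk, rfl⟩
        exact ⟨hy0, U₂.actD.mem k y hy hy0, U₂.twist_ker hk hy hy0⟩
    · rw [← hn]
      exact U₂.star_mul_self hb
    · rw [← hn]
      exact U₂.conjugatesVia hu hV hb (U₂.mem_fixedAlg_iff hu hK)
    · intro hΓ
      have hker := ker_eq_bot_of_noFiniteNormalSubgroup hΓ U₂.finite_ker
      obtain rfl : n = 1 := by rw [hn, hker]; simp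
      obtain ⟨φ, h1, h2, h3, h4⟩ := U₂.exists_fullGroup (measure_ne_top ν univ) hb
      rw [Measure.restrict_univ] at h1 h2
      have hbb : b * star b = proj Λ ν Y₀ := by
        rw [U₂.mul_star_self hu hb hK, finsum_ker_eq u hker, U₂.actD.op_one U₂.good hu]
      have hconj := U₂.conjugatesVia_of_ker_eq_bot hker hK hu hV hb
      refine ⟨(MonoidHom.ker_eq_bot_iff δ).1 hker, hbb,
        by rw [U₂.star_mul_self hb, Nat.cast_one, one_smul], ?_, hconj, φ, h1, h2, h3, ?_⟩
      · rintro x ⟨a, ha, -, rfl⟩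
        constructor
        · have hm := U₂.memLp_comp_twist ha
          refine ⟨_, hm, fun z hz => absurd (mem_univ z) hz, ?_⟩
          rw [← hb.mulOp_mul U₂.ae_orbit hm ha
            (Filter.Eventually.of_forall fun z hz => indicator_of_mem hz _), mul_assoc, hbb]
          exact mulOp_mul_proj hY₀ hm fun z hz => indicator_of_notMem hz _
        · have hm := ha.indicator hY₀
          have h5 : mulOp Λ ν a * proj Λ ν Y₀ = mulOp Λ ν (Y₀.indicator a) := by
            rw [proj, mulOp_mul ha (memLp_indicator_one hY₀)]
            congr 1
            funext z
            by_cases hz : z ∈ Y₀ <;> simp [hz]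
          -- Since `χ_{Y₀} b = b`, only the part of `a` on `Y₀` matters, and the conjugacy of
          -- `L^∞(Y₀)` applies to it.
          have h6 : star b * mulOp Λ ν a * b = star b * mulOp Λ ν (Y₀.indicator a) * b := by
            rw [← h5, mul_assoc, mul_assoc, mul_assoc, U₂.proj_mul hb]
          rw [h6]
          obtain ⟨c, hc, -, hc'⟩ := hconj.1.1.mapsTo
            ⟨_, hm, fun z hz => indicator_of_notMem hz _, rfl⟩
          exact ⟨c, hc, fun z hz => absurd (mem_univ z) hz, hc'⟩
      · intro g
        filter_upwards [hΔ.left_inv, hΔ.maps_rel,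
          hΔ.measurePreserving.quasiMeasurePreserving.ae
            ((ae_cond_iff hY₀ htop).2 (U₂.good.ae.mono fun _ h _ => h))] with x h5 h6 h7
        have h8 : Δ x ∈ Y₀ := (h6 x ⟨trivial, trivial, MulAction.mem_orbit_self x⟩).1
        have h9 := U₂.equivariant g (Δ x) h7 h8
        have h10 : s g (Δ x) = Δ (g • x) := by rw [hs]; simp only [h5]
        rw [h4 _ h8, h4 _ (h10 ▸ U₂.actD.mem g _ h7 h8), ← h10]
        exact h9

end Embedding

end OE

open OE in
theorem proposition5p11
    {Γ Λ X Y : Type*}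
    [Group Γ] [Countable Γ] [MeasurableSpace Γ] [DiscreteMeasurableSpace Γ]
    [Group Λ] [Countable Λ] [MeasurableSpace Λ] [DiscreteMeasurableSpace Λ]
    [MeasurableSpace X] [StandardBorelSpace X] [MeasurableSpace Y] [StandardBorelSpace Y]
    [MulAction Γ X] [MeasurableConstSMul Γ X] [MulAction Λ Y] [MeasurableConstSMul Λ Y]
    (μ : Measure X) [IsProbabilityMeasure μ] [SMulInvariantMeasure Γ X μ]
    (ν : Measure Y) [IsProbabilityMeasure ν] [SMulInvariantMeasure Λ Y ν]
    (hσ : EssFree Γ μ) (hθ : EssFree Λ ν) (hwm : WeakMixing Γ μ)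
    (Y₀ : Set Y) (hY₀ : MeasurableSet Y₀) (hY₀pos : ν Y₀ ≠ 0)
    (Δ : X → Y) (δ : Γ →* Λ) (v : X → Λ) (hv : Measurable v)
    (hδ : ∀ g : Γ, ∀ᵐ t ∂μ, (v t)⁻¹ * zimmerCocycle Δ t g * v (g⁻¹ • t) = δ g) :
    -- (i) local orbit equivalences
    (ErgodicSMul Λ Y ν →
      IsLocalOE (orbitRelOn Γ univ) (orbitRelOn Λ Y₀) μ (ν[|Y₀]) Δ →
      Nonempty (Amplification Γ Λ μ ν Y₀ Δ) ∧
      ∀ E : Amplification Γ Λ μ ν Y₀ Δ,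
      ∃ (u : Γ → Op (Stab Γ) (stabMeasure μ)) (vΛ : Λ → Op (Stab Γ) (stabMeasure μ))
        (p : Op (Stab Γ) (stabMeasure μ)) (b : Op (Stab Γ) (stabMeasure μ))
        (W : Set (X × ℤ)) (q : Op (Stab Γ) (stabMeasure μ)),
        -- the unit of `M`, the canonical unitaries of `M` and `P`, all viewed in `M^n`, and `b`
        p = proj (Stab Γ) (stabMeasure μ) (zeroCopy X) ∧
        (∀ g, u g = p * canU (stabMeasure μ) ((g, 1) : Stab Γ)) ∧
        (∀ h, IsCanonicalFor (G := Stab Γ) (stabMeasure μ) (E.pullback h⁻¹) (vΛ h)) ∧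
        (∀ h, vΛ h ∈ corner (crossedProduct (Stab Γ) (stabMeasure μ))
          (proj (Stab Γ) (stabMeasure μ) E.carrier)) ∧
        StrongHasSum (fun h => proj (Stab Γ) (stabMeasure μ)
          {z | z ∈ zeroCopy X ∧ v z.1 = h} * vΛ h) b ∧
        b ∈ corner (crossedProduct (Stab Γ) (stabMeasure μ))
          (proj (Stab Γ) (stabMeasure μ) E.carrier) ∧
        -- intertwining, partial isometry, finite kernel
        (∀ g, u g * b = b * vΛ (δ g)) ∧
        IsScalarMulPartialIsometry b ∧
        Finite δ.ker ∧ δ.ker.Normal ∧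
        -- the projection `q ∈ A^n`, and the index
        MeasurableSet W ∧ W ⊆ E.carrier ∧ q = proj (Stab Γ) (stabMeasure μ) W ∧
        b * star b = ∑ᶠ k : δ.ker, u k ∧
        star b * b = (Nat.card δ.ker : ℂ) • q ∧
        (∀ h ∈ δ.range, vΛ h * q * star (vΛ h) = q) ∧
        (δ.range.index : ℝ) = Nat.card δ.ker * (ν.real Y₀)⁻¹ ∧
        -- the conjugacy of the actions of `Γ / K` and `δ(Γ)`
        ConjugatesVia δ u vΛ (scaledAd (Nat.card δ.ker) b)
          (fixedAlg δ.ker u (linf (Stab Γ) (stabMeasure μ) (zeroCopy X)))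
          (linf (Stab Γ) (stabMeasure μ) W) ∧
        -- the case without finite normal subgroups
        (NoFiniteNormalSubgroup Γ →
          Function.Injective δ ∧
          (δ.range.index : ℝ) = (ν.real Y₀)⁻¹ ∧
          star b * b = q ∧ b * star b = p ∧
          ConjugatesVia δ u vΛ (fun x => star b * x * b)
            (linf (Stab Γ) (stabMeasure μ) (zeroCopy X))
            (linf (Stab Γ) (stabMeasure μ) W) ∧
          ∃ φ : X × ℤ → X × ℤ,
            IsInFullGroup (orbitRelOn (Stab Γ) E.carrier)
              ((stabMeasure μ).restrict E.carrier) φ ∧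
            (∀ᵐ z ∂((stabMeasure μ).restrict E.carrier), z ∈ zeroCopy X ↔ φ z ∈ W) ∧
            (∀ a : X × ℤ → ℂ, MemLp a ⊤ (stabMeasure μ) →
              star b * mulOp (Stab Γ) (stabMeasure μ)
                  ((zeroCopy X).indicator fun z => a (φ z)) * b =
                mulOp (Stab Γ) (stabMeasure μ) (W.indicator a)) ∧
            ∀ g : Γ, ∀ᵐ t ∂μ, E.pullback (δ g) (φ (t, 0)) (φ (g • t, 0)))) ∧
    -- (ii) embeddings
    (∀ Δinv : Y → X,
      IsEmbedding (orbitRelOn Γ univ) (orbitRelOn Λ Y₀) μ (ν[|Y₀]) Δ Δinv →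
      ∃ (u : Γ → Op Λ ν) (p : Op Λ ν) (b : Op Λ ν) (W : Set Y) (q : Op Λ ν) (m : ℕ)
        (κ : Y → Y → Prop),
        -- the unit and the canonical unitaries of `M`, viewed in `P`, and `b`
        p = proj Λ ν Y₀ ∧
        (∀ g, IsCanonicalFor (G := Λ) ν
          (fun y y' => y ∈ Y₀ ∧ y' ∈ Y₀ ∧ y' = Δ (g⁻¹ • Δinv y)) (u g)) ∧
        (∀ g, u g ∈ corner (crossedProduct Λ ν) p) ∧
        StrongHasSum (fun h => proj Λ ν {y | y ∈ Y₀ ∧ v (Δinv y) = h} * canU ν h) b ∧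
        b ∈ crossedProduct Λ ν ∧
        -- intertwining, partial isometry, finite kernel
        (∀ g, u g * b = b * canU ν (δ g)) ∧
        IsScalarMulPartialIsometry b ∧
        Finite δ.ker ∧ δ.ker.Normal ∧
        -- the finite invariant subequivalence relation, with orbits of cardinality `m`
        IsFiniteInvariantSubrel Γ Λ ν Y₀ Δ Δinv κ ∧
        (∀ k ∈ δ.ker, ∀ᵐ y ∂(ν.restrict Y₀), κ y (Δ (k • Δinv y))) ∧
        0 < m ∧ (∀ᵐ y ∂(ν.restrict Y₀), {y' | κ y y'}.ncard = m) ∧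
        -- the projection `q ∈ B`
        MeasurableSet W ∧ q = proj Λ ν W ∧
        star b * b = (m : ℂ) • q ∧
        (∀ h ∈ δ.range, canU ν h * q * star (canU ν h) = q) ∧
        -- the conjugacy of the actions of `Γ / K` and `δ(Γ)`
        ConjugatesVia δ u (canU ν) (scaledAd m b) (quotientAlg Λ ν Y₀ κ) (linf Λ ν W) ∧
        -- the case that finite invariant subequivalence relations are contained in `R_σ`
        ((∀ κ' : Y → Y → Prop, IsFiniteInvariantSubrel Γ Λ ν Y₀ Δ Δinv κ' →
            ∀ᵐ y ∂(ν.restrict Y₀), ∀ y', κ' y y' → ∃ g : Γ, y' = Δ (g • Δinv y)) →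
          (∀ᵐ y ∂(ν.restrict Y₀), ∀ y', κ y y' ↔ ∃ k ∈ δ.ker, y' = Δ (k • Δinv y)) ∧
          star b * b = (Nat.card δ.ker : ℂ) • q ∧
          b * star b = ∑ᶠ k : δ.ker, u k ∧
          ConjugatesVia δ u (canU ν) (scaledAd (Nat.card δ.ker) b)
            (fixedAlg δ.ker u (linf Λ ν Y₀)) (linf Λ ν W) ∧
          (NoFiniteNormalSubgroup Γ →
            Function.Injective δ ∧
            b * star b = p ∧ star b * b = q ∧
            (∀ x ∈ linf Λ ν univ, b * x * star b ∈ linf Λ ν univ ∧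
              star b * x * b ∈ linf Λ ν univ) ∧
            ConjugatesVia δ u (canU ν) (fun x => star b * x * b)
              (linf Λ ν Y₀) (linf Λ ν W) ∧
            ∃ φ : Y → Y,
              IsInFullGroup (orbitRelOn Λ univ) ν φ ∧
              (∀ᵐ y ∂ν, y ∈ Y₀ ↔ φ y ∈ W) ∧
              (∀ a : Y → ℂ, MemLp a ⊤ ν →
                star b * mulOp Λ ν (Y₀.indicator fun y => a (φ y)) * b =
                  mulOp Λ ν (W.indicator a)) ∧
              ∀ g : Γ, ∀ᵐ t ∂μ, φ (Δ (g • t)) = δ g • φ (Δ t)))) := by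
  refine ⟨fun hθerg hOE => ⟨exists_amplification hθerg hY₀ hY₀pos hOE, fun E => ?_⟩,
    fun Δinv hΔ => ?_⟩
  · exact E.conclusion hσ hθ hwm hY₀pos hv hδ
  · exact hΔ.conclusion hσ hθ hwm hY₀ hY₀pos hv hδ
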